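/- **Well-posedness of the deformed cell problem.** *Setting.* Let $\hat Y=[0,1]^3$ and let $\hat\Sigma\subset\hat Y$ be a compact (piecewise) $C^1$ surface, possibly with boundary, edges or corners: $\hat\Sigma$ is compact, has finite area, and up to a set of area zero every point of $\hat\Sigma$ has a neighbourhood in which $\hat\Sigma$ is an embedded two-dimensional $C^1$ surface. Let $\hat\tau_1,\hat\tau_2$ be measurable orthonormal tangential fields on $\hat\Sigma$ and $\hat\nu$ a unit normal. Let $$H(\hat Y,\hat\Sigma)=\{\varphi\in H^1_{\mathrm{per}}(\hat Y,\mathbb C):\ \hat\tau_k\cdot\hat\nabla\varphi\in L^2(\hat\Sigma,\mathbb C),\ k=1,2\},$$ where $H^1_{\mathrm{per}}$ is the space of $\mathbb Z^3$-periodic $H^1$ functions and $\hat\tau_k\cdot\hat\nabla\varphi$ are the weak tangential derivatives of the trace of $\varphi$ on $\hat\Sigma$. Let $\hat q\in D(\hat Y,\hat\Sigma)$, i.e. $\hat q\in W^{1,\infty}_0(\hat Y;\mathbb R^3)$ (equivalently: Lipschitz on $\hat Y$ and zero on $\partial\hat Y$) with $\hat\tau_k\cdot\hat\nabla\hat q\in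 L^\infty(\hat\Sigma)$, and let $y(\hat y)=\hat y+\hat q(\hat y)$ be a bijection of $\hat Y$ onto the unit cell $Y=[0,1]^3$; put $\Sigma=y(\hat\Sigma)$, $\hat F=I+\hat\nabla\hat q$, $\hat J=\det\hat F$. Assume $\hat J\ge\delta$ a.e. in $\hat Y$ for some $\delta>0$. Let $\omega>0$, and let $\varepsilon\in L^\infty(Y,\mathbb C^{3\times3})$, $\sigma\in L^\infty(\Sigma,\mathbb C^{3\times3})$ have symmetric real and imaginary parts, with $\operatorname{Im}\varepsilon$ uniformly elliptic and $\operatorname{Re}\sigma$ uniformly elliptic on tangent vectors of $\Sigma$. For $\chi=(\chi_i)_{i=1}^3$, $\varphi=(\varphi_i)_{i=1}^3$ in $H(\hat Y,\hat\Sigma)^3$, and forcings $A\in L^2(\hat Y;\mathbb C^{3\times3})$, $B\in L^2(\hat\Sigma;\mathbb C^{3\times3})$ with columns $A_i,B_i$, let $$E_{A,B}(\chi,\varphi)=\sum_{i=1}^3\Big[\int_{\hat Y}\varepsilon(y(\hat y))\,(A_i+\hat F^{-T}\hat\nabla\chi_i^T)\cdot\overline{\hat F^{-T}\hat\nabla\varphi_i^T}\,\hat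 J\,d\hat y-\frac1{i\omega}\int_{\hat\Sigma}\sigma(y(\hat y))\,P(B_i+\hat F^{-T}\hat\nabla\chi_i^T)\cdot\overline{P\hat F^{-T}\hat\nabla\varphi_i^T}\;\|\hat F^{-T}\hat\nu\|\hat J\,d\hat o\Big],$$ where $P$ is either (a) the orthogonal projection onto the tangent plane $\operatorname{span}(\hat F\hat\tau_1,\hat F\hat\tau_2)$ of $\Sigma$, or (b) $P=\sum_{k=1}^2\tau_k\tau_k^T$ with $\tau_k=\hat F\hat\tau_k/\|\hat F\hat\tau_k\|$ (the two agree when $\hat F\hat\tau_1\perp\hat F\hat\tau_2$). On $\hat\Sigma$ these expressions involve only tangential derivatives of $\hat q$ and of $\chi_i,\varphi_i$, because $\hat F\hat\tau_k\cdot\hat F^{-T}\hat\nabla\chi_i^T=\hat\tau_k\cdot\hat\nabla\chi_i$ and $\|\hat F^{-T}\hat\nu\|\hat J=\|\hat F\hat\tau_1\times\hat F\hat\tau_2\|$. The deformed cell problem is: find $\chi\in H(\hat Y,\hat\Sigma)^3$ with $E_{I,I}(\chi,\varphi)=0$ for all $\varphi\in H(\hat Y,\hat\Sigma)^3$, where $I$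 is the unit matrix. *Theorem.* In both cases (a) and (b) the deformed cell problem is well-posed: it has a solution $\chi\in H(\hat Y,\hat\Sigma)^3$ with $\int_{\hat Y}\chi_i=0$, and every other solution differs from it by additive constants. More precisely, there is a constant $C$ such that for all forcings $A\in L^2(\hat Y)$, $B\in L^2(\hat\Sigma)$ the integrals defining $E_{A,B}$ converge absolutely, and the problem $E_{A,B}(\chi,\varphi)=0$ for all $\varphi\in H(\hat Y,\hat\Sigma)^3$ has a solution $\chi$ with mean value zero, unique up to additive constants, satisfying $$\sum_{i=1}^3\Big(\|\chi_i\|^2_{H^1(\hat Y)}+\sum_{k=1}^2\|\hat\tau_k\cdot\hat\nabla\chi_i\|^2_{L^2(\hat\Sigma)}\Big)\le C\big(\|A\|_{L^2(\hat Y)}^2+\|B\|_{L^2(\hat\Sigma)}^2\big).$$ -/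

import Mathlib

open Set Filter Topology MeasureTheory
open scoped ContDiff RealInnerProductSpace

namespace CellProblem

noncomputable section

/-- Three-dimensional Euclidean space. -/
abbrev R3 := EuclideanSpace ℝ (Fin 3)

/-- Two-dimensional Euclidean space (parameter domain of surface charts). -/
abbrev R2 := EuclideanSpace ℝ (Fin 2)

/-- The `j`-th unit vector. -/
def e (j : Fin 3) : R3 := EuclideanSpace.single j (1 : ℝ)

/-- The closed unit cell `[0,1]³`. -/
def cell : Set R3 := {p | ∀ i, p i ∈ Icc (0 : ℝ) 1}

/-- Volume measure on the unit cell. -/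
def vol : Measure R3 := volume.restrict cell

/-- Surface measure on `S`: the two-dimensional Hausdorff measure, normalised so that it is
area on planes. -/
def area (S : Set R3) : Measure R3 := (Measure.euclideanHausdorffMeasure 2).restrict S

/-! ### Surfaces -/

/-- `Φ : U → S` is a regular `C¹` parametrisation of a relatively open part of `S`. -/
structure IsChart (S : Set R3) (U : Set R2) (Φ : R2 → R3) : Prop where
  isOpen : IsOpen U
  contDiffOn : ContDiffOn ℝ 1 Φ U
  immersion : ∀ z ∈ U, Function.Injective (fderiv ℝ Φ z)
  embedding : IsEmbedding (U.domRestrict Φ)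
  relOpen : ∃ O : Set R3, IsOpen O ∧ Φ '' U = S ∩ O

/-- The points near which `S` is an embedded two-dimensional `C¹` surface without boundary. -/
def regularPoints (S : Set R3) : Set R3 :=
  {p | ∃ (U : Set R2) (Φ : R2 → R3), IsChart S U Φ ∧ p ∈ Φ '' U}

/-- Compact (piecewise) `C¹` surfaces in the unit cell: finite area, and an embedded `C¹` surface
away from a set of area zero (boundary curves, edges, corners, seams on the faces of the cell).
Every compact embedded `C¹` surface, with or without boundary or corners, is of this kind. -/
structure IsSurface (S : Set R3) : Prop where
  isCompact : IsCompact S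
  subset_cell : S ⊆ cell
  finite_area : area S univ < ⊤
  ae_regular : ∀ᵐ p ∂area S, p ∈ regularPoints S

/-- The tangent space of `S` at `p`, spanned by the tangent cone. -/
def tangentPlane (S : Set R3) (p : R3) : Submodule ℝ R3 :=
  Submodule.span ℝ (tangentConeAt ℝ S p)

/-- `τ 0, τ 1` are (measurable) orthonormal tangential fields on `S`. -/
structure IsTangentFrame (S : Set R3) (τ : Fin 2 → R3 → R3) : Prop where
  aestronglyMeasurable : ∀ k, AEStronglyMeasurable (τ k) (area S)
  orthonormal : ∀ᵐ p ∂area S, Orthonormal ℝ (fun k => τ k p)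
  tangent : ∀ᵐ p ∂area S, ∀ k, τ k p ∈ tangentPlane S p

/-! ### The function space `H` -/

/-- Periodicity with period one in all three coordinate directions. -/
def IsPeriodic {α : Type*} (f : R3 → α) : Prop := ∀ p i, f (p + e i) = f p

/-- `G` is the weak gradient of `f` on `ℝ³`. -/
def HasWeakGrad (f : R3 → ℂ) (G : R3 → Fin 3 → ℂ) : Prop :=
  ∀ η : R3 → ℝ, ContDiff ℝ ∞ η → HasCompactSupport η → ∀ j,
    ∫ p, f p * (fderiv ℝ η p (e j) : ℂ) = -∫ p, G p j * (η p : ℂ)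

/-- `u` is the trace on `S` of the periodic `H¹` function `f` with weak gradient `G`: there are
smooth periodic functions which converge to `f` in `H¹` of the cell and whose restrictions to `S`
converge to `u` almost everywhere on `S`. -/
def IsTrace (S : Set R3) (f : R3 → ℂ) (G : R3 → Fin 3 → ℂ) (u : R3 → ℂ) : Prop :=
  ∃ φ : ℕ → R3 → ℂ, (∀ n, ContDiff ℝ ∞ (φ n) ∧ IsPeriodic (φ n)) ∧
    Tendsto (fun n => ∫ p, (‖φ n p - f p‖ ^ 2
      + ∑ j, ‖fderiv ℝ (φ n) p (e j) - G p j‖ ^ 2) ∂vol) atTop (𝓝 0) ∧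
    ∀ᵐ p ∂area S, Tendsto (fun n => φ n p) atTop (𝓝 (u p))

/-- The function `u` on `S` has the weak tangential derivatives `g k` in direction `τ k`
(that is, weak tangential gradient `∑ k, g k • τ k`), tested in every chart `Φ : U → S`:
the weak derivative of `u ∘ Φ` in direction `w` is `∑ k, g k * ⟪τ k, DΦ w⟫`. -/
def HasWeakTangentialGrad (S : Set R3) (τ : Fin 2 → R3 → R3) (u : R3 → ℂ)
    (g : R3 → Fin 2 → ℂ) : Prop :=
  ∀ (U : Set R2) (Φ : R2 → R3), IsChart S U Φ →
    LocallyIntegrableOn (fun z => u (Φ z)) U ∧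
    ∀ η : R2 → ℝ, ContDiff ℝ ∞ η → HasCompactSupport η → tsupport η ⊆ U → ∀ w : R2,
      ∫ z in U, u (Φ z) * (fderiv ℝ η z w : ℂ)
        = -∫ z in U, (∑ k, g (Φ z) k * (⟪τ k (Φ z), fderiv ℝ Φ z w⟫ : ℂ)) * (η z : ℂ)

/-- Elements of the space `H` of periodic complex `H¹` functions whose trace on `S` has
tangential derivatives `τ k · ∇` in `L²(S)`. The weak gradient `grad` and the tangential
derivatives `tgrad` are determined by `val` up to null sets. -/
structure H (S : Set R3) (τ : Fin 2 → R3 → R3) where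
  val : R3 → ℂ
  grad : R3 → Fin 3 → ℂ
  tgrad : R3 → Fin 2 → ℂ
  val_periodic : IsPeriodic val
  grad_periodic : IsPeriodic grad
  val_memLp : MemLp val 2 vol
  grad_memLp : MemLp grad 2 vol
  hasWeakGrad : HasWeakGrad val grad
  tgrad_memLp : MemLp tgrad 2 (area S)
  exists_trace : ∃ u, IsTrace S val grad u ∧ HasWeakTangentialGrad S τ u tgrad

/-- Squared norm of a triple of elements of `H`. -/
def normSq {S : Set R3} {τ : Fin 2 → R3 → R3} (χ : Fin 3 → H S τ) : ℝ :=
  ∑ i, ((∫ p, (‖(χ i).val p‖ ^ 2 + ∑ j, ‖(χ i).grad p j‖ ^ 2) ∂vol)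
    + (∫ p, (∑ k, ‖(χ i).tgrad p k‖ ^ 2) ∂area S))

/-! ### The deformation -/

/-- The space `D` of deformation fields: `W^{1,∞}` vector fields on the cell vanishing on its
boundary (on the convex cell these are exactly the Lipschitz fields vanishing on the boundary)
with bounded tangential derivatives along `S`. -/
structure MemD (S : Set R3) (q : R3 → R3) : Prop where
  lipschitz : ∃ L, LipschitzOnWith L q cell
  boundary : ∀ p ∈ frontier cell, q p = 0
  tangential : ∃ C : ℝ, ∀ᵐ p ∂area S, DifferentiableWithinAt ℝ q S p ∧
    ∀ v ∈ tangentPlane S p, ‖fderivWithin ℝ q S p v‖ ≤ C * ‖v‖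

/-- The deformation map `y(p) = p + q(p)`. -/
def deform (q : R3 → R3) (p : R3) : R3 := p + q p

/-- The transformation gradient `F = I + ∇q`, with `(∇q) i j = ∂q_i/∂p_j`. -/
def F (q : R3 → R3) (p : R3) : Matrix (Fin 3) (Fin 3) ℝ :=
  1 + Matrix.of fun i j => fderiv ℝ q p (e j) i

/-- The transformation determinant `J = det F`. -/
def J (q : R3 → R3) (p : R3) : ℝ := (F q p).det

/-- The push-forward `F τ k` of the tangential field `τ k` at a point of `S`. It only involves
tangential derivatives of `q`, which are the ones that exist on `S`. -/
def pushFrame (S : Set R3) (τ : Fin 2 → R3 → R3) (q : R3 → R3) (p : R3) (k : Fin 2) : R3 :=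
  τ k p + fderivWithin ℝ q S p (τ k p)

/-- Gram matrix of a pair of vectors. -/
def gram (a : Fin 2 → R3) : Matrix (Fin 2) (Fin 2) ℝ := Matrix.of fun k l => ⟪a k, a l⟫

/-- The surface element. For `a k = F τ k` with `(τ 0, τ 1, ν)` orthonormal this is
`‖F τ₀ × F τ₁‖ = ‖cof(F) ν‖ = ‖F⁻ᵀ ν‖ J`. -/
def surfaceElement (a : Fin 2 → R3) : ℝ := Real.sqrt (gram a).det

/-- `tangentialPart M a b = ∑ k l, M k l * b l • a k`. -/
def tangentialPart (M : Matrix (Fin 2) (Fin 2) ℝ) (a : Fin 2 → R3) (b : Fin 2 → ℂ) :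
    Fin 3 → ℂ :=
  fun j => ∑ k, ∑ l, (M k l : ℂ) * b l * (a k j : ℂ)

/-- With `M = projCoeff a` and `b l = a l · w`, `tangentialPart M a b` is the orthogonal
projection of `w` to the plane spanned by `a 0, a 1`. -/
def projCoeff (a : Fin 2 → R3) : Matrix (Fin 2) (Fin 2) ℝ := (gram a)⁻¹

/-- With `M = frameCoeff a` and `b l = a l · w`, `tangentialPart M a b` is
`∑ k, t k (t k)ᵀ w` for the normalised vectors `t k = a k / ‖a k‖`. -/
def frameCoeff (a : Fin 2 → R3) : Matrix (Fin 2) (Fin 2) ℝ :=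
  Matrix.diagonal fun k => (‖a k‖ ^ 2)⁻¹

/-! ### Material tensors -/

/-- Bounded measurable tensor fields on the cell with symmetric real and imaginary parts and
uniformly elliptic imaginary part. -/
structure IsPermittivity (ε : R3 → Matrix (Fin 3) (Fin 3) ℂ) : Prop where
  aestronglyMeasurable : ∀ i j, AEStronglyMeasurable (fun y => ε y i j) vol
  bounded : ∃ C : ℝ, ∀ᵐ y ∂vol, ∀ i j, ‖ε y i j‖ ≤ C
  symm : ∀ᵐ y ∂vol, (ε y).IsSymm
  elliptic : ∃ c : ℝ, 0 < c ∧ ∀ᵐ y ∂vol, ∀ ξ : R3,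
    c * ‖ξ‖ ^ 2 ≤ ∑ i, ∑ j, (ε y i j).im * ξ j * ξ i

/-- Bounded measurable tensor fields on `S` with symmetric real and imaginary parts and real part
uniformly elliptic on tangent vectors of `S`. -/
structure IsConductivity (S : Set R3) (σ : R3 → Matrix (Fin 3) (Fin 3) ℂ) : Prop where
  aestronglyMeasurable : ∀ i j, AEStronglyMeasurable (fun y => σ y i j) (area S)
  bounded : ∃ C : ℝ, ∀ᵐ y ∂area S, ∀ i j, ‖σ y i j‖ ≤ C
  symm : ∀ᵐ y ∂area S, (σ y).IsSymm
  elliptic : ∃ c : ℝ, 0 < c ∧ ∀ᵐ y ∂area S, ∀ ξ ∈ tangentPlane S y,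
    c * ‖ξ‖ ^ 2 ≤ ∑ i, ∑ j, (σ y i j).re * ξ j * ξ i

/-! ### The deformed cell problem -/

/-- The matrix `F⁻ᵀ` applied to a complex vector. -/
def invTransposeMul (q : R3 → R3) (p : R3) (v : Fin 3 → ℂ) : Fin 3 → ℂ :=
  Matrix.mulVec (((F q p)⁻¹.transpose).map (fun x : ℝ => (x : ℂ))) v

/-- Volume integrand `∑ i, ε(y(p)) (A_i + F⁻ᵀ∇χ_i) · conj(F⁻ᵀ∇φ_i) J`; the columns `A_i` of the
forcing are the unit vectors in the cell problem. -/
def volumeIntegrand {S : Set R3} {τ : Fin 2 → R3 → R3} (q : R3 → R3)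
    (ε : R3 → Matrix (Fin 3) (Fin 3) ℂ) (A : R3 → Fin 3 → Fin 3 → ℂ)
    (χ φ : Fin 3 → H S τ) (p : R3) : ℂ :=
  ∑ i, dotProduct
      (Matrix.mulVec (ε (deform q p)) (A p i + invTransposeMul q p ((χ i).grad p)))
      (star (invTransposeMul q p ((φ i).grad p)))
    * (J q p : ℂ)

/-- Surface integrand
`∑ i, σ(y(p)) P(B_i + F⁻ᵀ∇χ_i) · conj(P F⁻ᵀ∇φ_i) ‖F⁻ᵀν‖ J` where `P` is the tangential operator
with coefficients `coeff` with respect to `a k = F τ k`. Note `a l · F⁻ᵀ∇χ_i = τ l · ∇χ_i`. -/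
def surfaceIntegrand {S : Set R3} {τ : Fin 2 → R3 → R3} (q : R3 → R3)
    (coeff : (Fin 2 → R3) → Matrix (Fin 2) (Fin 2) ℝ)
    (σ : R3 → Matrix (Fin 3) (Fin 3) ℂ) (B : R3 → Fin 3 → Fin 3 → ℂ)
    (χ φ : Fin 3 → H S τ) (p : R3) : ℂ :=
  ∑ i, dotProduct
      (Matrix.mulVec (σ (deform q p))
        (tangentialPart (coeff (pushFrame S τ q p)) (pushFrame S τ q p)
          (fun l => (∑ j, (pushFrame S τ q p l j : ℂ) * B p i j) + (χ i).tgrad p l)))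
      (star (tangentialPart (coeff (pushFrame S τ q p)) (pushFrame S τ q p) ((φ i).tgrad p)))
    * (surfaceElement (pushFrame S τ q p) : ℂ)

/-- The form `E(χ, φ; q)` with volume forcing `A` and surface forcing `B`. -/
def E {S : Set R3} {τ : Fin 2 → R3 → R3} (q : R3 → R3)
    (coeff : (Fin 2 → R3) → Matrix (Fin 2) (Fin 2) ℝ) (freq : ℝ)
    (ε σ : R3 → Matrix (Fin 3) (Fin 3) ℂ) (A B : R3 → Fin 3 → Fin 3 → ℂ)
    (χ φ : Fin 3 → H S τ) : ℂ :=
  (∫ p, volumeIntegrand q ε A χ φ p ∂vol)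
    - 1 / (Complex.I * (freq : ℂ)) * (∫ p, surfaceIntegrand q coeff σ B χ φ p ∂area S)

/-- The forcing of the cell problem: the unit matrix. -/
def unitForcing : R3 → Fin 3 → Fin 3 → ℂ := fun _ i j => if i = j then 1 else 0

/-- `χ` solves the problem with forcing `A`, `B`. -/
def Solves {S : Set R3} {τ : Fin 2 → R3 → R3} (q : R3 → R3)
    (coeff : (Fin 2 → R3) → Matrix (Fin 2) (Fin 2) ℝ) (freq : ℝ)
    (ε σ : R3 → Matrix (Fin 3) (Fin 3) ℂ) (A B : R3 → Fin 3 → Fin 3 → ℂ)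
    (χ : Fin 3 → H S τ) : Prop :=
  ∀ φ : Fin 3 → H S τ, E q coeff freq ε σ A B χ φ = 0

/-- There is a solution with mean value zero, and every solution differs from it by constants. -/
def IsUniqueSolution {S : Set R3} {τ : Fin 2 → R3 → R3} (q : R3 → R3)
    (coeff : (Fin 2 → R3) → Matrix (Fin 2) (Fin 2) ℝ) (freq : ℝ)
    (ε σ : R3 → Matrix (Fin 3) (Fin 3) ℂ) (A B : R3 → Fin 3 → Fin 3 → ℂ)
    (χ : Fin 3 → H S τ) : Prop :=
  Solves q coeff freq ε σ A B χ ∧ (∀ i, (∫ p, (χ i).val p ∂vol) = 0) ∧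
    ∀ χ' : Fin 3 → H S τ, Solves q coeff freq ε σ A B χ' →
      ∃ c : Fin 3 → ℂ, ∀ i, ∀ᵐ p, (χ' i).val p = (χ i).val p + c i

/-- Well-posedness of the deformed cell problem: the form is well defined on `H`; the cell problem
has a solution, unique up to additive constants; and the same holds for arbitrary
square-integrable forcings, with solution depending continuously on the forcing. -/
def IsWellPosed (S : Set R3) (τ : Fin 2 → R3 → R3) (q : R3 → R3)
    (coeff : (Fin 2 → R3) → Matrix (Fin 2) (Fin 2) ℝ) (freq : ℝ)
    (ε σ : R3 → Matrix (Fin 3) (Fin 3) ℂ) : Prop :=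
  (∃ χ : Fin 3 → H S τ, IsUniqueSolution q coeff freq ε σ unitForcing unitForcing χ) ∧
  ∃ C : ℝ, ∀ A B : R3 → Fin 3 → Fin 3 → ℂ, MemLp A 2 vol → MemLp B 2 (area S) →
    (∀ χ φ : Fin 3 → H S τ, Integrable (volumeIntegrand q ε A χ φ) vol ∧
      Integrable (surfaceIntegrand q coeff σ B χ φ) (area S)) ∧
    ∃ χ : Fin 3 → H S τ, IsUniqueSolution q coeff freq ε σ A B χ ∧
      normSq χ ≤ C * ((∫ p, (∑ i, ∑ j, ‖A p i j‖ ^ 2) ∂vol)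
        + (∫ p, (∑ i, ∑ j, ‖B p i j‖ ^ 2) ∂area S))

end

end CellProblem

open Set Filter Topology MeasureTheory
open scoped ContDiff RealInnerProductSpace ENNReal NNReal Pointwise

namespace CellProblem

/-! ### Lipschitz images -/

/-! Up to a factor `i` the form is coercive. Since −1/(iω) = i/ω, the form is `i` times a sum of
three decoupled copies of one scalar form, with tensor −iε in the volume and σ/ω on the surface. For
a symmetric complex matrix `M` the real part of `Mu · ū` only sees Re M, evaluated on Re u and Im u
(`dotProduct_mulVec_star_self`). Because Re(−iε) = Im ε, the two ellipticity assumptions bound the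
real part of each scalar form from below by the squared norms of F⁻ᵀ∇χ and of the tangential part.
Bounded left inverses of F⁻ᵀ and of the matrix of P turn this into a bound by ∇χ and the tangential
derivatives (`exists_pullForce_coercive`). Lax–Milgram, applied to pairs (gradient, tangential
derivatives), then gives existence and the estimate. The difference of two solutions has zero
gradient, hence is constant by the Poincaré inequality.

Two things need real work. One is completeness: the pairs coming from `H` must form a closed
subspace of L² × L² (`isClosed_gradSpace`). The Poincaré inequality recovers the values from the
gradients. A trace inequality lets the weak tangential identity pass to the limit; it is proved by
thickening a chart in a transversal direction, which makes it a bi-Lipschitz map onto a piece of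
space, and integrating along the transversal segments.

The other is the surface coefficient. The hypothesis J ≥ δ holds only almost everywhere in the
volume and says nothing directly on the surface. Together with bijectivity it nevertheless forces
the inverse deformation to be globally Lipschitz, by a packing argument
(`MemD.exists_antilipschitz`). Consequently null sets of the deformed surface pull back to null
sets, so that the bounds on σ survive composition, and differentiation along the surface yields a
uniform lower bound for the stretching of tangent vectors (`exists_pushFrame_bounds`).

The cases (a) and (b) differ only in a 2 × 2 matrix expressing P through the pushed-forward frame.
The argument uses nothing about it beyond boundedness and a bounded inverse, so one proof
(`isWellPosed_of_coeff`) serves both. -/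

theorem euclideanHausdorffMeasure_image_le {X Y : Type*} [EMetricSpace X] [MeasurableSpace X]
    [BorelSpace X] [EMetricSpace Y] [MeasurableSpace Y] [BorelSpace Y] {K : ℝ≥0} {f : X → Y}
    {s : Set X} (d : ℕ) (h : LipschitzOnWith K f s) :
    μHE[d] (f '' s) ≤ (K : ℝ≥0∞) ^ d * μHE[d] s := by
  have := h.hausdorffMeasure_image_le (d := d) (by positivity)
  simp only [Measure.euclideanHausdorffMeasure_def, Measure.smul_apply, ENNReal.smul_def,
    smul_eq_mul]
  rw [mul_left_comm]
  gcongr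
  simpa using this

/-- Each Haar measure is a multiple of the Hausdorff measure of its dimension, for which the
Lipschitz estimate is known. This covers `R2 × ℝ`, whose product metric is not Euclidean. The
constant depends on `K` only, not on the map or the set. -/
theorem exists_addHaar_image_le {E F : Type*} [NormedAddCommGroup E] [NormedSpace ℝ E]
    [FiniteDimensional ℝ E] [MeasurableSpace E] [BorelSpace E] [NormedAddCommGroup F]
    [NormedSpace ℝ F] [FiniteDimensional ℝ F] [MeasurableSpace F] [BorelSpace F]
    (μ : Measure E) [μ.IsAddHaarMeasure] (ν : Measure F) [ν.IsAddHaarMeasure]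
    (h : Module.finrank ℝ E = Module.finrank ℝ F) (K : ℝ≥0) :
    ∃ C : ℝ≥0, ∀ (f : E → F) (s : Set E), LipschitzOnWith K f s → ν (f '' s) ≤ C * μ s := by
  have h1 := Measure.isAddLeftInvariant_eq_smul ν (μHE[Module.finrank ℝ F] : Measure F)
  have h2 := Measure.isAddLeftInvariant_eq_smul (μHE[Module.finrank ℝ E] : Measure E) μ
  refine ⟨ν.addHaarScalarFactor (μHE[Module.finrank ℝ F] : Measure F) *
    (K ^ Module.finrank ℝ F * (μHE[Module.finrank ℝ E] : Measure E).addHaarScalarFactor μ),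
    fun f s hf => ?_⟩
  have h3 := euclideanHausdorffMeasure_image_le (Module.finrank ℝ F) hf
  have h4 : (μHE[Module.finrank ℝ E] : Measure E) s
      = (μHE[Module.finrank ℝ E] : Measure E).addHaarScalarFactor μ * μ s := by
    have := congrArg (fun m : Measure E => m s) h2
    rwa [Measure.smul_apply, ENNReal.smul_def, smul_eq_mul] at this
  have h5 : ν (f '' s) = ν.addHaarScalarFactor (μHE[Module.finrank ℝ F] : Measure F)
      * (μHE[Module.finrank ℝ F] : Measure F) (f '' s) := by
    have := congrArg (fun m : Measure F => m (f '' s)) h1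
    rwa [Measure.smul_apply, ENNReal.smul_def, smul_eq_mul] at this
  rw [h5]
  push_cast
  rw [mul_assoc, mul_assoc]
  gcongr
  rw [← h4]
  simpa [h] using h3

/-! ### The unit cell -/

theorem isCompact_cell : IsCompact cell := by
  have : cell = (EuclideanSpace.equiv (Fin 3) ℝ).toHomeomorph ⁻¹' Icc 0 1 := by
    ext p
    exact ⟨fun h => ⟨fun i => (h i).1, fun i => (h i).2⟩, fun h i => ⟨h.1 i, h.2 i⟩⟩
  rw [this]
  exact (Homeomorph.isCompact_preimage _).2 isCompact_Icc

theorem isClosed_cell : IsClosed cell := isCompact_cell.isClosed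

theorem measurableSet_cell : MeasurableSet cell := isClosed_cell.measurableSet

theorem convex_cell : Convex ℝ cell := by
  have : cell = ⋂ i, (fun p : R3 => p i) ⁻¹' Icc (0:ℝ) 1 := by ext; simp [cell]
  rw [this]
  exact convex_iInter fun i => (convex_Icc 0 1).linear_preimage
    ((EuclideanSpace.proj i : R3 →L[ℝ] ℝ) : R3 →ₗ[ℝ] ℝ)

theorem volume_cell : volume cell = 1 := by
  have h := (EuclideanSpace.volume_preserving_symm_measurableEquiv_toLp (Fin 3)).symm
  have : cell = (MeasurableEquiv.toLp 2 (Fin 3 → ℝ)).symm ⁻¹' Icc 0 1 := by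
    ext p
    exact ⟨fun h => ⟨fun i => (h i).1, fun i => (h i).2⟩, fun h i => ⟨h.1 i, h.2 i⟩⟩
  rw [this, (EuclideanSpace.volume_preserving_symm_measurableEquiv_toLp (Fin 3)).measure_preimage
    measurableSet_Icc.nullMeasurableSet, Real.volume_Icc_pi]
  simp

instance : IsProbabilityMeasure vol := ⟨by simp [vol, volume_cell]⟩

/-- The half open unit cell. -/
def halfCell : Set R3 := ZSpan.fundamentalDomain (EuclideanSpace.basisFun (Fin 3) ℝ).toBasis

theorem mem_halfCell {p : R3} : p ∈ halfCell ↔ ∀ i, p i ∈ Ico (0 : ℝ) 1 := by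
  simp [halfCell, ZSpan.mem_fundamentalDomain]

theorem measurableSet_halfCell : MeasurableSet halfCell :=
  ZSpan.fundamentalDomain_measurableSet _

theorem halfCell_ae_eq : halfCell =ᵐ[volume] cell := by
  have h1 : cell = (MeasurableEquiv.toLp 2 (Fin 3 → ℝ)).symm ⁻¹' Icc 0 1 := by
    ext p
    exact ⟨fun h => ⟨fun i => (h i).1, fun i => (h i).2⟩, fun h i => ⟨h.1 i, h.2 i⟩⟩
  have h2 : halfCell = (MeasurableEquiv.toLp 2 (Fin 3 → ℝ)).symm ⁻¹'
      (univ.pi fun _ => Ico 0 1) := by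
    ext p; simp [mem_halfCell]
  rw [h1, h2]
  exact (EuclideanSpace.volume_preserving_symm_measurableEquiv_toLp
    (Fin 3)).quasiMeasurePreserving.preimage_ae_eq
    (Measure.univ_pi_Ico_ae_eq_Icc (f := (0 : Fin 3 → ℝ)) (g := 1))

theorem vol_eq_restrict_halfCell : vol = volume.restrict halfCell :=
  (Measure.restrict_congr_set halfCell_ae_eq).symm

/-! ### Periodic functions and integer translates of the cell. -/

theorem IsPeriodic.comp {α β : Type*} {f : R3 → α} (hf : IsPeriodic f) (g : α → β) :
    IsPeriodic fun p => g (f p) := fun p i =>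
  congrArg g (hf p i)

theorem IsPeriodic.add_mem_span {α : Type*} {f : R3 → α} (hf : IsPeriodic f) {k : R3}
    (hk : k ∈ Submodule.span ℤ (range (EuclideanSpace.basisFun (Fin 3) ℝ).toBasis)) (p : R3) :
    f (k + p) = f p := by
  induction hk using Submodule.span_induction generalizing p with
  | mem x hx =>
    obtain ⟨i, rfl⟩ := hx
    have := hf p i
    rw [add_comm]; simpa [e] using this
  | zero => simp
  | add x y _ _ hx hy => rw [add_assoc, hx, hy]
  | smul a x _ hx =>
    induction a using Int.induction_on generalizing p with
    | zero => simp
    | succ n ih => rw [add_smul, one_smul, add_assoc, ih, hx]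
    | pred n ih =>
      rw [sub_smul, one_smul, ← hx]
      rw [← ih p]; congr 1; abel

/-- A translate of the half open cell is again a fundamental domain of the lattice, and a periodic
function has the same integral over all fundamental domains. -/
theorem IsPeriodic.lintegral_add {h : R3 → ℝ≥0∞} (hh : IsPeriodic h) (v : R3) :
    ∫⁻ p, h (p + v) ∂vol = ∫⁻ p, h p ∂vol := by
  set b := (EuclideanSpace.basisFun (Fin 3) ℝ).toBasis
  have h1 : IsAddFundamentalDomain (Submodule.span ℤ (range b)).toAddSubgroup halfCell
      (volume : Measure R3) := ZSpan.isAddFundamentalDomain' b volume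
  have h2 := h1.vadd_of_comm v
  have hmp : MeasurePreserving (fun p : R3 => p + v) volume volume :=
    measurePreserving_add_right volume v
  rw [vol_eq_restrict_halfCell]
  have : Countable (Submodule.span ℤ (range b)).toAddSubgroup :=
    inferInstanceAs (Countable (Submodule.span ℤ (range b)))
  have h3 := h1.setLIntegral_eq h2 h (fun g x => hh.add_mem_span g.2 x)
  rw [h3]
  have : (v +ᵥ halfCell : Set R3) = (fun p : R3 => p + v) '' halfCell := by
    ext x
    exact ⟨fun ⟨y, hy, h⟩ => ⟨y, hy, by simpa [add_comm] using h⟩,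
      fun ⟨y, hy, h⟩ => ⟨y, hy, by simpa [add_comm] using h⟩⟩
  rw [this, hmp.setLIntegral_comp_emb (MeasurableEquiv.addRight v).measurableEmbedding]

/-- Integer translates of the half open cell containing a given point. -/
theorem sub_floor_mem_halfCell (p : R3) :
    p - ∑ i, (⌊p i⌋ : ℝ) • e i ∈ halfCell := by
  refine mem_halfCell.2 fun j => ?_
  have : (∑ i, (⌊p i⌋ : ℝ) • e i) j = ⌊p j⌋ := by
    simp [e, Pi.single_apply]
  rw [PiLp.sub_apply, this]
  exact ⟨by linarith [Int.floor_le (p j)], by linarith [Int.lt_floor_add_one (p j)]⟩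

/-- The lattice point with integer coordinates `k`. -/
noncomputable def lattice (k : Fin 3 → ℤ) : R3 := ∑ i, (k i : ℝ) • e i

theorem lattice_mem_span (k : Fin 3 → ℤ) : lattice k ∈
    Submodule.span ℤ (range (EuclideanSpace.basisFun (Fin 3) ℝ).toBasis) := by
  refine Submodule.sum_mem _ fun i _ => ?_
  rw [Int.cast_smul_eq_zsmul]
  exact Submodule.smul_mem _ _ (Submodule.subset_span ⟨i, by simp [e]⟩)

theorem IsPeriodic.add_lattice {α : Type*} {f : R3 → α} (hf : IsPeriodic f) (k : Fin 3 → ℤ)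
    (p : R3) : f (lattice k + p) = f p := hf.add_mem_span (lattice_mem_span k) p

/-- A ball is covered by finitely many integer translates of the half open cell, each contributing
the integral over one period; `N` counts them. -/
theorem exists_lintegral_closedBall_le (R : ℝ) :
    ∃ N : ℝ≥0, ∀ h : R3 → ℝ≥0∞, Measurable h → IsPeriodic h →
      ∫⁻ p in Metric.closedBall 0 R, h p ≤ N * ∫⁻ p, h p ∂vol := by
  obtain ⟨M, hM⟩ := exists_nat_gt (R + 1)
  -- Coordinates of points of the ball lie in [-R, R], so their integer parts lie in [-M, M].
  let I : Finset (Fin 3 → ℤ) := Fintype.piFinset fun _ => Finset.Icc (-(M : ℤ)) M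
  refine ⟨I.card, fun h hm hp => ?_⟩
  have hcov : Metric.closedBall (0 : R3) R ⊆ ⋃ k ∈ I, (fun p => p - lattice k) ⁻¹' halfCell := by
    intro p hpR
    refine mem_iUnion₂.2 ⟨fun i => ⌊p i⌋, ?_, sub_floor_mem_halfCell p⟩
    refine Fintype.mem_piFinset.2 fun i => Finset.mem_Icc.2 ?_
    have h1 : |p i| ≤ R := by
      have := PiLp.norm_apply_le p i
      simp at hpR
      exact this.trans hpR
    rw [abs_le] at h1
    constructor
    · rw [Int.le_floor]; push_cast; linarith
    · have h2 : (⌊p i⌋ : ℝ) ≤ M := (Int.floor_le _).trans (by linarith)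
      exact_mod_cast h2
  calc ∫⁻ p in Metric.closedBall 0 R, h p
      ≤ ∫⁻ p in ⋃ k ∈ I, (fun p => p - lattice k) ⁻¹' halfCell, h p := lintegral_mono_set hcov
    _ ≤ ∑ k ∈ I, ∫⁻ p in (fun p => p - lattice k) ⁻¹' halfCell, h p := by
      induction I using Finset.induction_on with
      | empty => simp
      | insert a s ha ih =>
        rw [Finset.sum_insert ha, Finset.set_biUnion_insert]
        exact (lintegral_union_le _ _ _).trans (by gcongr)
    _ = ∑ k ∈ I, ∫⁻ p, h p ∂vol := by
      refine Finset.sum_congr rfl fun k _ => ?_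
      rw [vol_eq_restrict_halfCell]
      have hmp : MeasurePreserving (fun p : R3 => p - lattice k) volume volume :=
        measurePreserving_sub_right volume (lattice k)
      rw [← hmp.setLIntegral_comp_preimage_emb
        (MeasurableEquiv.subRight (lattice k)).measurableEmbedding h halfCell]
      refine lintegral_congr fun p => ?_
      rw [← hp.add_lattice k (p - lattice k)]; simp
    _ = I.card * ∫⁻ p, h p ∂vol := by simp
    _ = _ := by simp

/-- Almost everywhere statements on the cell extend by periodicity. -/
theorem ae_of_ae_vol {P : R3 → Prop} (hP : IsPeriodic P) (h : ∀ᵐ p ∂vol, P p) : ∀ᵐ p, P p := by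
  rw [vol_eq_restrict_halfCell] at h
  have hmp (k : Fin 3 → ℤ) : MeasurePreserving (fun p : R3 => p - lattice k) volume volume :=
    measurePreserving_sub_right volume (lattice k)
  have h1 : ∀ᵐ p, p ∈ halfCell → P p := by
    rwa [ae_restrict_iff' (measurableSet_halfCell)] at h
  have h2 : ∀ᵐ p, ∀ k, p - lattice k ∈ halfCell → P (p - lattice k) :=
    ae_all_iff.2 fun k => (hmp k).quasiMeasurePreserving.ae h1
  filter_upwards [h2] with p hp
  have := hp (fun i => ⌊p i⌋) (sub_floor_mem_halfCell p)
  rw [← hP.add_lattice (fun i => ⌊p i⌋)] at this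
  simpa using this

/-- Periodic extension of the restriction of a function to the half open cell. -/
noncomputable def periodize {α : Type*} (f : R3 → α) (p : R3) : α :=
  f (p - lattice fun i => ⌊p i⌋)

theorem isPeriodic_periodize {α : Type*} (f : R3 → α) : IsPeriodic (periodize f) := by
  intro p j
  unfold periodize
  congr 1
  ext i
  have (k : Fin 3 → ℤ) : (lattice k) i = k i := by
    simp [lattice, e, Pi.single_apply]
  simp only [PiLp.sub_apply, this, PiLp.add_apply]
  rcases eq_or_ne i j with rfl | h
  · simp [e]
  · simp [e, h]

theorem periodize_ae_eq {α : Type*} (f : R3 → α) : periodize f =ᵐ[vol] f := by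
  rw [vol_eq_restrict_halfCell]
  filter_upwards [ae_restrict_mem (measurableSet_halfCell)] with p hp
  have : (lattice fun i => ⌊p i⌋) = 0 := by
    have h0 : ∀ i, ⌊p i⌋ = 0 := fun i => Int.floor_eq_zero_iff.2 (mem_halfCell.1 hp i)
    simp [lattice, h0]
  simp [periodize, this]


/-! ### Charts -/

/-- The range of `D` is a plane, so any `w` outside it completes `D` to an isomorphism. This is the
linear model for thickening a surface chart to a chart of space. -/
theorem exists_transversal {D : R2 →L[ℝ] R3} (hD : Function.Injective D) :
    ∃ (w : R3) (A : (R2 × ℝ) ≃L[ℝ] R3), ∀ z t, A (z, t) = D z + t • w := by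
  have hlt : D.range < ⊤ := by
    refine Submodule.lt_top_of_finrank_lt_finrank ?_
    have := LinearMap.finrank_range_of_inj (f := D.toLinearMap) hD
    simp only [finrank_euclideanSpace, Fintype.card_fin] at this ⊢
    have h2 : Module.finrank ℝ D.range = 2 := this
    omega
  obtain ⟨w, -, hw⟩ := SetLike.exists_of_lt hlt
  let B : (R2 × ℝ) →L[ℝ] R3 := D.coprod (ContinuousLinearMap.toSpanSingleton ℝ w)
  have hBapp : ∀ z t, B (z, t) = D z + t • w := fun z t => by simp [B]
  have hB : Function.Injective B.toLinearMap := by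
    rw [injective_iff_map_eq_zero]
    rintro ⟨z, t⟩ h
    have h' : D z + t • w = 0 := by rw [← hBapp]; exact h
    have ht : t = 0 := by
      by_contra ht
      apply hw
      refine ⟨-(t⁻¹) • z, ?_⟩
      have : D z = -(t • w) := eq_neg_of_add_eq_zero_left h'
      have h3 : D (-(t⁻¹) • z) = w := by
        rw [map_smul, this, neg_smul, smul_neg, neg_neg, smul_smul, inv_mul_cancel₀ ht, one_smul]
      exact h3
    subst ht
    have : D z = D 0 := by simpa using h'
    simpa using hD this
  have hfr : Module.finrank ℝ (R2 × ℝ) = Module.finrank ℝ R3 := by simp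
  exact ⟨w, (LinearEquiv.ofInjectiveOfFinrankEq B.toLinearMap hB hfr).toContinuousLinearEquiv,
    fun z t => hBapp z t⟩

theorem IsChart.hasStrictFDerivAt {S : Set R3} {U : Set R2} {Φ : R2 → R3} (h : IsChart S U Φ)
    {z : R2} (hz : z ∈ U) : HasStrictFDerivAt Φ (fderiv ℝ Φ z) z :=
  ((h.contDiffOn.contDiffAt (h.isOpen.mem_nhds hz))).hasStrictFDerivAt (by simp)

theorem IsChart.hasFDerivAt {S : Set R3} {U : Set R2} {Φ : R2 → R3} (h : IsChart S U Φ)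
    {z : R2} (hz : z ∈ U) : HasFDerivAt Φ (fderiv ℝ Φ z) z :=
  (h.hasStrictFDerivAt hz).hasFDerivAt

theorem IsChart.continuousOn {S : Set R3} {U : Set R2} {Φ : R2 → R3} (h : IsChart S U Φ) :
    ContinuousOn Φ U := h.contDiffOn.continuousOn

theorem IsChart.mem {S : Set R3} {U : Set R2} {Φ : R2 → R3} (h : IsChart S U Φ)
    {z : R2} (hz : z ∈ U) : Φ z ∈ S := by
  obtain ⟨O, -, hO⟩ := h.relOpen
  exact (hO ▸ mem_image_of_mem Φ hz : Φ z ∈ S ∩ O).1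

/-- The thickened chart `(z, t) ↦ Φ z + t • w` has invertible strict derivative at `(z₀, 0)`. Near
that point it is therefore a small perturbation of a linear isomorphism, hence Lipschitz in both
directions. -/
theorem IsChart.exists_bilipschitz {S : Set R3} {U : Set R2} {Φ : R2 → R3} (h : IsChart S U Φ)
    {z₀ : R2} (hz : z₀ ∈ U) : ∃ (w : R3) (K K' : ℝ≥0) (r : ℝ), 0 < r ∧
      Metric.closedBall z₀ r ⊆ U ∧
      LipschitzOnWith K (fun x : R2 × ℝ => Φ x.1 + x.2 • w)
        (Metric.closedBall z₀ r ×ˢ Metric.closedBall 0 r) ∧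
      ∀ x ∈ Metric.closedBall z₀ r ×ˢ Metric.closedBall (0 : ℝ) r,
      ∀ y ∈ Metric.closedBall z₀ r ×ˢ Metric.closedBall (0 : ℝ) r,
        dist x y ≤ K' * dist (Φ x.1 + x.2 • w) (Φ y.1 + y.2 • w) := by
  obtain ⟨w, A, hA⟩ := exists_transversal (h.immersion z₀ hz)
  have hder : HasStrictFDerivAt (fun x : R2 × ℝ => Φ x.1 + x.2 • w) (A : (R2 × ℝ) →L[ℝ] R3)
      (z₀, 0) := by
    have h1 : HasStrictFDerivAt (fun x : R2 × ℝ => Φ x.1)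
        ((fderiv ℝ Φ z₀).comp (ContinuousLinearMap.fst ℝ R2 ℝ)) (z₀, (0 : ℝ)) :=
      HasStrictFDerivAt.comp (z₀, (0 : ℝ)) (h.hasStrictFDerivAt hz) hasStrictFDerivAt_fst
    have h2 : HasStrictFDerivAt (fun x : R2 × ℝ => x.2 • w)
        ((ContinuousLinearMap.snd ℝ R2 ℝ).smulRight w) (z₀, (0 : ℝ)) :=
      hasStrictFDerivAt_snd.smul_const w
    have hAe : (A : (R2 × ℝ) →L[ℝ] R3) =
        (fderiv ℝ Φ z₀).comp (ContinuousLinearMap.fst ℝ R2 ℝ) +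
          (ContinuousLinearMap.snd ℝ R2 ℝ).smulRight w :=
      ContinuousLinearMap.ext fun x => hA x.1 x.2
    rw [hAe]
    exact h1.add h2
  obtain ⟨s, hs, hso, hap⟩ := hder.approximates_deriv_on_open_nhds
  obtain ⟨r₁, hr₁, hr₁U⟩ := Metric.nhds_basis_closedBall.mem_iff.1 (h.isOpen.mem_nhds hz)
  obtain ⟨r₂, hr₂, hr₂s⟩ := Metric.nhds_basis_closedBall.mem_iff.1 (hso.mem_nhds hs)
  have hsub : Metric.closedBall z₀ (min r₁ r₂) ×ˢ Metric.closedBall (0 : ℝ) (min r₁ r₂) ⊆ s := by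
    rw [closedBall_prod_same]
    exact (Metric.closedBall_subset_closedBall (min_le_right _ _)).trans hr₂s
  -- The linear approximation has error constant ‖A⁻¹‖⁻¹/2; an error strictly below ‖A⁻¹‖⁻¹ is what
  -- the lower Lipschitz bound requires.
  have hpos : Subsingleton (R2 × ℝ) ∨
      ‖(A.symm : R3 →L[ℝ] R2 × ℝ)‖₊⁻¹ / 2 < ‖(A.symm : R3 →L[ℝ] R2 × ℝ)‖₊⁻¹ :=
    Or.inr (NNReal.half_lt_self (by
      simpa using (ContinuousLinearEquiv.subsingleton_or_norm_symm_pos A).resolve_left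
        (by exact not_subsingleton _) |>.ne'))
  have hanti := hap.antilipschitz hpos
  refine ⟨w, ‖(A : (R2 × ℝ) →L[ℝ] R3)‖₊ + ‖(A.symm : R3 →L[ℝ] R2 × ℝ)‖₊⁻¹ / 2,
    (‖(A.symm : R3 →L[ℝ] R2 × ℝ)‖₊⁻¹ - ‖(A.symm : R3 →L[ℝ] R2 × ℝ)‖₊⁻¹ / 2)⁻¹,
    min r₁ r₂, lt_min hr₁ hr₂,
    (Metric.closedBall_subset_closedBall (min_le_left _ _)).trans hr₁U,
    (lipschitzOnWith_iff_restrict.2 hap.lipschitz).mono hsub, fun x hx y hy => ?_⟩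
  exact hanti.le_mul_dist ⟨x, hsub hx⟩ ⟨y, hsub hy⟩

/-- In a small ball, a chart is bi-Lipschitz. -/
theorem IsChart.exists_bilipschitz_ball {S : Set R3} {U : Set R2} {Φ : R2 → R3}
    (h : IsChart S U Φ) {z₀ : R2} (hz : z₀ ∈ U) : ∃ (K K' : ℝ≥0) (r : ℝ), 0 < r ∧
      Metric.closedBall z₀ r ⊆ U ∧ LipschitzOnWith K Φ (Metric.closedBall z₀ r) ∧
      ∀ x ∈ Metric.closedBall z₀ r, ∀ y ∈ Metric.closedBall z₀ r,
        dist x y ≤ K' * dist (Φ x) (Φ y) := by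
  obtain ⟨w, K, K', r, hr, hU, hL, hA⟩ := h.exists_bilipschitz hz
  have h0 : (0 : ℝ) ∈ Metric.closedBall (0 : ℝ) r := Metric.mem_closedBall_self hr.le
  refine ⟨K, K', r, hr, hU, ?_, fun x hx y hy => ?_⟩
  · refine LipschitzOnWith.of_dist_le_mul fun x hx y hy => ?_
    simpa [Prod.dist_eq] using hL.dist_le_mul (x, 0) ⟨hx, h0⟩ (y, 0) ⟨hy, h0⟩
  · simpa [Prod.dist_eq] using hA (x, 0) ⟨hx, h0⟩ (y, 0) ⟨hy, h0⟩

/-- Images of open parameter sets are relatively open in the surface. -/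
theorem IsChart.exists_isOpen_image {S : Set R3} {U V : Set R2} {Φ : R2 → R3}
    (h : IsChart S U Φ) (hV : IsOpen V) (hVU : V ⊆ U) :
    ∃ O : Set R3, IsOpen O ∧ Φ '' V = S ∩ O := by
  obtain ⟨O, hO, hSO⟩ := h.relOpen
  have h1 : IsOpen ((↑) ⁻¹' V : Set U) := hV.preimage continuous_subtype_val
  obtain ⟨W, hW, hWV⟩ := h.embedding.isInducing.isOpen_iff.1 h1
  refine ⟨O ∩ W, hO.inter hW, ?_⟩
  rw [← inter_assoc, ← hSO]
  ext p
  constructor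
  · rintro ⟨z, hz, rfl⟩
    refine ⟨mem_image_of_mem Φ (hVU hz), ?_⟩
    have : (⟨z, hVU hz⟩ : U) ∈ U.domRestrict Φ ⁻¹' W := by rw [hWV]; exact hz
    exact this
  · rintro ⟨⟨z, hz, rfl⟩, hp⟩
    have : (⟨z, hz⟩ : U) ∈ ((↑) ⁻¹' V : Set U) := by rw [← hWV]; exact hp
    exact ⟨z, this, rfl⟩

theorem IsSurface.measurableSet {S : Set R3} (h : IsSurface S) : MeasurableSet S :=
  h.isCompact.isClosed.measurableSet

/-- A property which holds almost everywhere in every small parameter ball holds almost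
everywhere on the surface. -/
theorem IsSurface.ae_of_chart {S : Set R3} (hS : IsSurface S) {P : R3 → Prop}
    (hP : ∀ U Φ, IsChart S U Φ → ∀ z₀ ∈ U, ∃ r > 0, Metric.closedBall z₀ r ⊆ U ∧
      ∀ᵐ z ∂volume.restrict (Metric.closedBall z₀ r), P (Φ z)) :
    ∀ᵐ p ∂area S, P p := by
  have hreg := hS.ae_regular
  have hSm := hS.measurableSet
  suffices h : (Measure.euclideanHausdorffMeasure 2 : Measure R3)
      {p | p ∈ S ∧ p ∈ regularPoints S ∧ ¬ P p} = 0 by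
    have h2 : ∀ᵐ p ∂area S, ¬ (p ∈ S ∧ p ∈ regularPoints S ∧ ¬ P p) :=
      ae_mono Measure.restrict_le_self (measure_eq_zero_iff_ae_notMem.1 h)
    filter_upwards [hreg, h2, ae_restrict_mem hSm] with p h3 h4 h5
    by_contra h6
    exact h4 ⟨h5, h3, h6⟩
  -- By second countability it suffices that every exceptional regular point has a relative
  -- neighbourhood in which the exceptional set is null. There the set is a Lipschitz image of a
  -- null set of parameters.
  refine measure_null_of_locally_null _ ?_
  rintro p ⟨hpS, ⟨U, Φ, hΦ, z₀, hz₀, rfl⟩, hpP⟩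
  obtain ⟨r, hr, hrU, hae⟩ := hP U Φ hΦ z₀ hz₀
  obtain ⟨K, K', r', hr', hrU', hL, -⟩ := hΦ.exists_bilipschitz_ball hz₀
  set ρ := min r r'
  have hρ : 0 < ρ := lt_min hr hr'
  have hsub : Metric.ball z₀ ρ ⊆ Metric.closedBall z₀ r :=
    Metric.ball_subset_closedBall.trans (Metric.closedBall_subset_closedBall (min_le_left _ _))
  have hsub' : Metric.ball z₀ ρ ⊆ Metric.closedBall z₀ r' :=
    Metric.ball_subset_closedBall.trans (Metric.closedBall_subset_closedBall (min_le_right _ _))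
  obtain ⟨O, hO, hSO⟩ := hΦ.exists_isOpen_image Metric.isOpen_ball (hsub.trans hrU)
  have hpO : Φ z₀ ∈ O := (hSO ▸ mem_image_of_mem Φ (Metric.mem_ball_self hρ) : _ ∈ S ∩ O).2
  refine ⟨{p | p ∈ S ∧ p ∈ regularPoints S ∧ ¬ P p} ∩ O,
    inter_mem self_mem_nhdsWithin (mem_nhdsWithin_of_mem_nhds (hO.mem_nhds hpO)), ?_⟩
  have hnull : volume {z | z ∈ Metric.ball z₀ ρ ∧ ¬ P (Φ z)} = 0 := by
    rw [ae_restrict_iff' Metric.isClosed_closedBall.measurableSet] at hae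
    refine measure_mono_null (fun z hz => ?_) hae
    exact fun hh => hz.2 (hh (hsub hz.1))
  have himg := euclideanHausdorffMeasure_image_le 2
    (hL.mono (fun z hz => hsub' hz.1 : {z | z ∈ Metric.ball z₀ ρ ∧ ¬ P (Φ z)} ⊆ _))
  rw [EuclideanSpace.euclideanHausdorffMeasure_eq_volume, hnull, mul_zero] at himg
  refine measure_mono_null ?_ (le_antisymm himg zero_le)
  rintro p ⟨⟨hp1, -, hp3⟩, hp4⟩
  obtain ⟨z, hz, rfl⟩ := (hSO ▸ ⟨hp1, hp4⟩ : p ∈ Φ '' Metric.ball z₀ ρ)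
  exact ⟨z, ⟨hz, hp3⟩, rfl⟩

/-- Parameter measure is bounded by a multiple of area. -/
theorem IsChart.exists_map_le {S : Set R3} {U : Set R2} {Φ : R2 → R3}
    (h : IsChart S U Φ) {K : Set R2} (hK : IsCompact K) (hKU : K ⊆ U) :
    ∃ C : ℝ≥0, (volume.restrict K).map Φ ≤ C • area S := by
  have key : ∃ C : ℝ≥0, ∀ T : Set R3, MeasurableSet T →
      volume (K ∩ Φ ⁻¹' T) ≤ C * (Measure.euclideanHausdorffMeasure 2) (T ∩ S) := by
    refine hK.induction_on (p := fun K => ∃ C : ℝ≥0, ∀ T : Set R3, MeasurableSet T →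
      volume (K ∩ Φ ⁻¹' T) ≤ C * (Measure.euclideanHausdorffMeasure 2) (T ∩ S)) ?_ ?_ ?_ ?_
    · exact ⟨0, by simp⟩
    · rintro s t hst ⟨C, hC⟩
      exact ⟨C, fun T hT => (measure_mono (inter_subset_inter_left _ hst)).trans (hC T hT)⟩
    · rintro s t ⟨C, hC⟩ ⟨C', hC'⟩
      refine ⟨C + C', fun T hT => ?_⟩
      rw [union_inter_distrib_right]
      refine (measure_union_le _ _).trans ?_
      push_cast
      rw [add_mul]
      exact add_le_add (hC T hT) (hC' T hT)
    · intro z hz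
      -- On a small ball `Φ` has a `K'`-Lipschitz inverse, so the area of an image controls the
      -- parameter measure with factor `K' ^ 2`. Compactness of `K` reduces the claim to such balls.
      obtain ⟨-, K', r, hr, hrU, -, hA⟩ := h.exists_bilipschitz_ball (hKU hz)
      refine ⟨Metric.closedBall z r, mem_nhdsWithin_of_mem_nhds (Metric.closedBall_mem_nhds z hr),
        K' ^ 2, fun T hT => ?_⟩
      set B := Metric.closedBall z r
      have hinj : InjOn Φ B := fun x hx y hy hxy => by
        have := hA x hx y hy
        rw [hxy, dist_self, mul_zero] at this
        exact dist_le_zero.1 this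
      let g : R3 → R2 := Function.invFunOn Φ B
      have hg : ∀ x ∈ B, g (Φ x) = x := fun x hx => hinj.leftInvOn_invFunOn hx
      have hgL : LipschitzOnWith K' g (Φ '' (B ∩ Φ ⁻¹' T)) := by
        refine LipschitzOnWith.of_dist_le_mul ?_
        rintro _ ⟨x, hx, rfl⟩ _ ⟨y, hy, rfl⟩
        rw [hg x hx.1, hg y hy.1]
        exact hA x hx.1 y hy.1
      have h1 := euclideanHausdorffMeasure_image_le 2 hgL
      rw [EuclideanSpace.euclideanHausdorffMeasure_eq_volume] at h1
      have h2 : g '' (Φ '' (B ∩ Φ ⁻¹' T)) = B ∩ Φ ⁻¹' T := by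
        rw [image_image]
        exact (image_congr fun x hx => hg x hx.1).trans (image_id' _)
      rw [h2] at h1
      push_cast
      refine h1.trans ?_
      gcongr
      rintro _ ⟨x, hx, rfl⟩
      exact ⟨hx.2, h.mem (hrU hx.1)⟩
  obtain ⟨C, hC⟩ := key
  refine ⟨C, Measure.le_iff.2 fun T hT => ?_⟩
  have hm : AEMeasurable Φ (volume.restrict K) :=
    (h.continuousOn.mono hKU).aemeasurable hK.measurableSet
  rw [Measure.map_apply_of_aemeasurable hm hT, Measure.restrict_apply₀ (hm.nullMeasurableSet_preimage hT),
    Measure.smul_apply, area, Measure.restrict_apply hT, inter_comm]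
  exact hC T hT

theorem IsChart.aemeasurable {S : Set R3} {U : Set R2} {Φ : R2 → R3}
    (h : IsChart S U Φ) {K : Set R2} (hK : IsCompact K) (hKU : K ⊆ U) :
    AEMeasurable Φ (volume.restrict K) :=
  (h.continuousOn.mono hKU).aemeasurable hK.measurableSet

theorem IsChart.quasiMeasurePreserving {S : Set R3} {U : Set R2} {Φ : R2 → R3}
    (h : IsChart S U Φ) {K : Set R2} (hK : IsCompact K) (hKU : K ⊆ U) :
    (volume.restrict K).map Φ ≪ area S := by
  obtain ⟨C, hC⟩ := h.exists_map_le hK hKU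
  exact (Measure.absolutelyContinuous_of_le hC).trans Measure.smul_absolutelyContinuous

theorem IsChart.ae_comp {S : Set R3} {U : Set R2} {Φ : R2 → R3}
    (h : IsChart S U Φ) {K : Set R2} (hK : IsCompact K) (hKU : K ⊆ U) {P : R3 → Prop}
    (hP : ∀ᵐ p ∂area S, P p) : ∀ᵐ z ∂volume.restrict K, P (Φ z) :=
  ae_of_ae_map (h.aemeasurable hK hKU) ((h.quasiMeasurePreserving hK hKU).ae_le hP)

theorem IsChart.aestronglyMeasurable_comp {S : Set R3} {U : Set R2} {Φ : R2 → R3} {β : Type*}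
    [TopologicalSpace β] (h : IsChart S U Φ) {K : Set R2} (hK : IsCompact K) (hKU : K ⊆ U)
    {f : R3 → β} (hf : AEStronglyMeasurable f (area S)) :
    AEStronglyMeasurable (fun z => f (Φ z)) (volume.restrict K) :=
  (hf.mono_ac (h.quasiMeasurePreserving hK hKU)).comp_aemeasurable (h.aemeasurable hK hKU)

theorem IsChart.exists_lintegral_le {S : Set R3} {U : Set R2} {Φ : R2 → R3}
    (h : IsChart S U Φ) {K : Set R2} (hK : IsCompact K) (hKU : K ⊆ U) :
    ∃ C : ℝ≥0, ∀ g : R3 → ℝ≥0∞, AEMeasurable g (area S) →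
      ∫⁻ z in K, g (Φ z) ≤ C * ∫⁻ p, g p ∂area S := by
  obtain ⟨C, hC⟩ := h.exists_map_le hK hKU
  refine ⟨C, fun g hg => ?_⟩
  rw [← lintegral_map' (hg.mono_ac (h.quasiMeasurePreserving hK hKU)) (h.aemeasurable hK hKU)]
  refine (lintegral_mono' hC le_rfl).trans ?_
  rw [lintegral_smul_measure]
  rfl

/-! ### Tangent spaces -/

/-- Points of `S` close to `Φ z` lie in the image of a small ball because that image is relatively
open. The lower Lipschitz bound makes their parameter increments of the same order as the increments
in space, so a limit of rescaled secants is a limit of values of the derivative, whose range is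
closed. The other inclusion is the chain rule. In particular the cone is already a linear space
here. -/
theorem IsChart.tangentConeAt_eq {S : Set R3} {U : Set R2} {Φ : R2 → R3}
    (h : IsChart S U Φ) {z : R2} (hz : z ∈ U) :
    tangentConeAt ℝ S (Φ z) = range (fderiv ℝ Φ z) := by
  apply subset_antisymm
  · intro v hv
    obtain ⟨K, K', r, hr, hrU, -, hA⟩ := h.exists_bilipschitz_ball hz
    obtain ⟨O, hO, hSO⟩ := h.exists_isOpen_image Metric.isOpen_ball
      (Metric.ball_subset_closedBall.trans hrU)
    have hpO : Φ z ∈ O := (hSO ▸ mem_image_of_mem Φ (Metric.mem_ball_self hr) : _ ∈ S ∩ O).2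
    obtain ⟨α, l, hl, c, d, hd, hdS, hcd⟩ := exists_fun_of_mem_tangentConeAt hv
    have hpd : Tendsto (fun n => Φ z + d n) l (𝓝 (Φ z)) := by
      simpa using tendsto_const_nhds.add hd
    have hev : ∀ᶠ n in l, ∃ y ∈ Metric.ball z r, Φ y = Φ z + d n := by
      filter_upwards [hdS, hpd.eventually (hO.mem_nhds hpO)] with n h1 h2
      have : Φ z + d n ∈ Φ '' Metric.ball z r := by rw [hSO]; exact ⟨h1, h2⟩
      exact this
    obtain ⟨y, hy⟩ := hev.choice
    have hyd : ∀ᶠ n in l, ‖y n - z‖ ≤ K' * ‖d n‖ := by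
      filter_upwards [hy] with n hn
      have := hA (y n) (Metric.ball_subset_closedBall hn.1) z (Metric.mem_closedBall_self hr.le)
      rw [dist_eq_norm, dist_eq_norm, hn.2] at this
      simpa using this
    have hOd : (fun n => y n - z) =O[l] d := Asymptotics.IsBigO.of_bound K' hyd
    have hyz : Tendsto y l (𝓝 z) := by
      have := hOd.trans_tendsto hd
      simpa using this.add_const z
    have hlo : (fun n => Φ (y n) - Φ z - fderiv ℝ Φ z (y n - z)) =o[l] d :=
      (((h.hasFDerivAt hz).isLittleO).comp_tendsto hyz).trans_isBigO hOd
    have hlo' : (fun n => c n • (Φ (y n) - Φ z - fderiv ℝ Φ z (y n - z))) =o[l]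
        fun n => c n • d n := (Asymptotics.isBigO_refl c l).smul_isLittleO hlo
    have hlim := (Asymptotics.isLittleO_one_iff ℝ).1 (hlo'.trans_isBigO (hcd.isBigO_one ℝ))
    have hlim2 : Tendsto (fun n => fderiv ℝ Φ z (c n • (y n - z))) l (𝓝 v) := by
      have := hcd.sub hlim
      rw [sub_zero] at this
      refine this.congr' ?_
      filter_upwards [hy] with n hn
      rw [hn.2, map_smul, ← smul_sub]
      congr 1
      abel
    have hcl : IsClosed ((fderiv ℝ Φ z).range : Set R3) :=
      Submodule.closed_of_finiteDimensional _
    exact hcl.mem_of_tendsto hlim2 (Eventually.of_forall fun n => ⟨_, rfl⟩)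
  · rintro _ ⟨w, rfl⟩
    have h1 := (h.hasFDerivAt hz).hasFDerivWithinAt (s := U)
    have h2 := h1.mapsTo_tangent_cone
      (by rw [tangentConeAt_of_mem_nhds (h.isOpen.mem_nhds hz)]; exact mem_univ w)
    refine tangentConeAt_mono ?_ h2
    rintro _ ⟨x, hx, rfl⟩
    exact h.mem hx


/-! ### Sobolev norms on the cell -/

/-- The classical gradient. -/
noncomputable def cgrad (φ : R3 → ℂ) (p : R3) (j : Fin 3) : ℂ := fderiv ℝ φ p (e j)

/-- The `W^{1,1}` norm on the cell. -/
noncomputable def sob1 (f : R3 → ℂ) (G : R3 → Fin 3 → ℂ) : ℝ≥0∞ :=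
  ∫⁻ p, (‖f p‖ₑ + ∑ j, ‖G p j‖ₑ) ∂vol

/-- The squared `H¹` norm on the cell. -/
noncomputable def sob2 (f : R3 → ℂ) (G : R3 → Fin 3 → ℂ) : ℝ≥0∞ :=
  ∫⁻ p, (‖f p‖ₑ ^ 2 + ∑ j, ‖G p j‖ₑ ^ 2) ∂vol

theorem ofReal_integral_eq_sob2 {f : R3 → ℂ} {G : R3 → Fin 3 → ℂ} (hf : MemLp f 2 vol)
    (hG : MemLp G 2 vol) :
    ENNReal.ofReal (∫ p, (‖f p‖ ^ 2 + ∑ j, ‖G p j‖ ^ 2) ∂vol) = sob2 f G := by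
  have hGj : ∀ j, MemLp (fun p => G p j) 2 vol := fun j => hG.eval j
  rw [ofReal_integral_eq_lintegral_ofReal]
  · refine lintegral_congr fun p => ?_
    rw [ENNReal.ofReal_add (by positivity) (by positivity),
      ENNReal.ofReal_sum_of_nonneg fun _ _ => by positivity]
    simp [ENNReal.ofReal_pow]
  · exact (hf.integrable_norm_pow two_ne_zero).add
      (integrable_finsetSum _ fun j _ => (hGj j).integrable_norm_pow two_ne_zero)
  · exact Eventually.of_forall fun p => by positivity

theorem sob2_ne_top {f : R3 → ℂ} {G : R3 → Fin 3 → ℂ} (hf : MemLp f 2 vol)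
    (hG : MemLp G 2 vol) : sob2 f G ≠ ⊤ := by
  rw [← ofReal_integral_eq_sob2 hf hG]; exact ENNReal.ofReal_ne_top

theorem enorm_add_sq_le {E : Type*} [SeminormedAddCommGroup E] (a b : E) :
    ‖a + b‖ₑ ^ 2 ≤ 2 * ‖a‖ₑ ^ 2 + 2 * ‖b‖ₑ ^ 2 := by
  have h : ‖a + b‖ ^ 2 ≤ 2 * ‖a‖ ^ 2 + 2 * ‖b‖ ^ 2 := by
    nlinarith [norm_add_le a b, sq_nonneg (‖a‖ - ‖b‖), norm_nonneg (a + b), norm_nonneg a,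
      norm_nonneg b]
  have := ENNReal.ofReal_le_ofReal h
  rw [ENNReal.ofReal_add (by positivity) (by positivity), ENNReal.ofReal_mul (by positivity),
    ENNReal.ofReal_mul (by positivity)] at this
  simpa [ENNReal.ofReal_pow] using this

theorem sob2_add_le {f g : R3 → ℂ} {F G : R3 → Fin 3 → ℂ} (hf : AEStronglyMeasurable f vol)
    (hF : AEStronglyMeasurable F vol) :
    sob2 (f + g) (F + G) ≤ 2 * sob2 f F + 2 * sob2 g G := by
  unfold sob2
  have hFj : ∀ j, AEStronglyMeasurable (fun p => F p j) vol := fun j =>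
    (continuous_apply j).comp_aestronglyMeasurable hF
  rw [← lintegral_const_mul' _ _ (by simp), ← lintegral_const_mul' _ _ (by simp),
    ← lintegral_add_left']
  · refine lintegral_mono fun p => ?_
    simp only [Pi.add_apply]
    have h1 := enorm_add_sq_le (f p) (g p)
    have h2 : ∑ j, ‖F p j + G p j‖ₑ ^ 2 ≤ 2 * ∑ j, ‖F p j‖ₑ ^ 2 + 2 * ∑ j, ‖G p j‖ₑ ^ 2 := by
      rw [Finset.mul_sum, Finset.mul_sum, ← Finset.sum_add_distrib]
      exact Finset.sum_le_sum fun j _ => enorm_add_sq_le _ _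
    refine (add_le_add h1 h2).trans (le_of_eq ?_)
    ring
  · refine AEMeasurable.const_mul ?_ _
    refine (hf.enorm.pow_const 2).add ?_
    exact Finset.aemeasurable_fun_sum _ fun j _ => (hFj j).enorm.pow_const 2

theorem sob1_add_le {f g : R3 → ℂ} {F G : R3 → Fin 3 → ℂ} (hf : AEStronglyMeasurable f vol)
    (hF : AEStronglyMeasurable F vol) :
    sob1 (f + g) (F + G) ≤ sob1 f F + sob1 g G := by
  unfold sob1
  have hFj : ∀ j, AEStronglyMeasurable (fun p => F p j) vol := fun j =>
    (continuous_apply j).comp_aestronglyMeasurable hF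
  rw [← lintegral_add_left']
  · refine lintegral_mono fun p => ?_
    simp only [Pi.add_apply]
    have h2 : ∑ j, ‖F p j + G p j‖ₑ ≤ ∑ j, ‖F p j‖ₑ + ∑ j, ‖G p j‖ₑ := by
      rw [← Finset.sum_add_distrib]
      exact Finset.sum_le_sum fun j _ => enorm_add_le _ _
    refine (add_le_add (enorm_add_le _ _) h2).trans (le_of_eq ?_)
    ring
  · exact hf.enorm.add (Finset.aemeasurable_fun_sum _ fun j _ => (hFj j).enorm)

theorem sob1_le_sob2 {f : R3 → ℂ} {G : R3 → Fin 3 → ℂ} (hf : AEStronglyMeasurable f vol)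
    (hG : AEStronglyMeasurable G vol) : sob1 f G ≤ (4 * sob2 f G) ^ (1 / 2 : ℝ) := by
  have hGj : ∀ j, AEStronglyMeasurable (fun p => G p j) vol := fun j =>
    (continuous_apply j).comp_aestronglyMeasurable hG
  have hm : AEMeasurable (fun p => ‖f p‖ₑ + ∑ j, ‖G p j‖ₑ) vol :=
    hf.enorm.add (Finset.aemeasurable_fun_sum _ fun j _ => (hGj j).enorm)
  have h := ENNReal.lintegral_mul_le_Lp_mul_Lq vol Real.HolderConjugate.two_two hm
    (aemeasurable_const (b := 1))
  simp only [Pi.mul_apply, mul_one, ENNReal.one_rpow, lintegral_const, measure_univ] at h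
  refine h.trans ?_
  gcongr
  unfold sob2
  rw [← lintegral_const_mul' _ _ (by simp)]
  refine lintegral_mono fun p => ?_
  -- The factor 4 comes from Cauchy–Schwarz for four summands, the value and three partial
  -- derivatives.
  have key : (‖f p‖ + ∑ j, ‖G p j‖) ^ 2 ≤ 4 * (‖f p‖ ^ 2 + ∑ j, ‖G p j‖ ^ 2) := by
    simp only [Fin.sum_univ_three]
    nlinarith [sq_nonneg (‖f p‖ - ‖G p 0‖), sq_nonneg (‖f p‖ - ‖G p 1‖),
      sq_nonneg (‖f p‖ - ‖G p 2‖), sq_nonneg (‖G p 0‖ - ‖G p 1‖), sq_nonneg (‖G p 0‖ - ‖G p 2‖),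
      sq_nonneg (‖G p 1‖ - ‖G p 2‖)]
  have := ENNReal.ofReal_le_ofReal key
  rw [ENNReal.ofReal_pow (by positivity), ENNReal.ofReal_mul (by positivity),
    ENNReal.ofReal_add (by positivity) (by positivity),
    ENNReal.ofReal_add (by positivity) (by positivity),
    ENNReal.ofReal_sum_of_nonneg fun _ _ => by positivity,
    ENNReal.ofReal_sum_of_nonneg fun _ _ => by positivity] at this
  simpa [ENNReal.ofReal_pow] using this

theorem tendsto_sob1_of_sob2 {f : ℕ → R3 → ℂ} {G : ℕ → R3 → Fin 3 → ℂ}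
    (hf : ∀ n, AEStronglyMeasurable (f n) vol) (hG : ∀ n, AEStronglyMeasurable (G n) vol)
    (h : Tendsto (fun n => sob2 (f n) (G n)) atTop (𝓝 0)) :
    Tendsto (fun n => sob1 (f n) (G n)) atTop (𝓝 0) := by
  have h1 : Tendsto (fun n => (4 * sob2 (f n) (G n)) ^ (1 / 2 : ℝ)) atTop (𝓝 0) := by
    have := ((ENNReal.continuous_rpow_const (y := 1 / 2)).tendsto _).comp
      (ENNReal.Tendsto.const_mul (a := 4) h (Or.inr (by simp)))
    simpa [Function.comp_def] using this
  exact tendsto_of_tendsto_of_tendsto_of_le_of_le tendsto_const_nhds h1 (fun _ => zero_le)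
    fun n => sob1_le_sob2 (hf n) (hG n)

/-! ### Smooth periodic functions -/

/-- Smooth periodic functions. -/
def IsSmoothPeriodic (φ : R3 → ℂ) : Prop := ContDiff ℝ ∞ φ ∧ IsPeriodic φ

theorem IsSmoothPeriodic.continuous {φ : R3 → ℂ} (h : IsSmoothPeriodic φ) : Continuous φ :=
  h.1.continuous

theorem IsSmoothPeriodic.differentiable {φ : R3 → ℂ} (h : IsSmoothPeriodic φ) :
    Differentiable ℝ φ := h.1.differentiable (by simp)

theorem IsSmoothPeriodic.continuous_fderiv {φ : R3 → ℂ} (h : IsSmoothPeriodic φ) (w : R3) :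
    Continuous fun p => fderiv ℝ φ p w :=
  (h.1.continuous_fderiv (by simp)).clm_apply continuous_const

theorem IsSmoothPeriodic.continuous_cgrad {φ : R3 → ℂ} (h : IsSmoothPeriodic φ) :
    Continuous (cgrad φ) := continuous_pi fun j => h.continuous_fderiv (e j)

theorem IsSmoothPeriodic.cgrad_periodic {φ : R3 → ℂ} (h : IsSmoothPeriodic φ) :
    IsPeriodic (cgrad φ) := by
  intro p i
  have : (fun q => φ (q + e i)) = φ := funext fun q => h.2 q i
  funext j
  unfold cgrad
  conv_rhs => rw [← this]
  rw [fderiv_comp_add_right]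

theorem memLp_vol_of_continuous {E : Type*} [NormedAddCommGroup E] {f : R3 → E}
    (hf : Continuous f) : MemLp f 2 vol := by
  obtain ⟨C, hC⟩ := isCompact_cell.exists_bound_of_continuousOn hf.continuousOn
  exact MemLp.of_bound hf.aestronglyMeasurable C
    (ae_restrict_of_forall_mem measurableSet_cell hC)

theorem IsSmoothPeriodic.memLp {φ : R3 → ℂ} (h : IsSmoothPeriodic φ) : MemLp φ 2 vol :=
  memLp_vol_of_continuous h.continuous

theorem IsSmoothPeriodic.cgrad_memLp {φ : R3 → ℂ} (h : IsSmoothPeriodic φ) :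
    MemLp (cgrad φ) 2 vol := memLp_vol_of_continuous h.continuous_cgrad

theorem IsSmoothPeriodic.add {φ ψ : R3 → ℂ} (h : IsSmoothPeriodic φ) (h' : IsSmoothPeriodic ψ) :
    IsSmoothPeriodic (φ + ψ) :=
  ⟨h.1.add h'.1, fun p i => by simp [h.2 p i, h'.2 p i]⟩

theorem IsSmoothPeriodic.const_smul {φ : R3 → ℂ} (h : IsSmoothPeriodic φ) (c : ℂ) :
    IsSmoothPeriodic (c • φ) :=
  ⟨contDiff_const.smul h.1, fun p i => by simp [h.2 p i]⟩

theorem isSmoothPeriodic_const (c : ℂ) : IsSmoothPeriodic fun _ => c :=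
  ⟨contDiff_const, fun _ _ => rfl⟩

theorem IsSmoothPeriodic.sub {φ ψ : R3 → ℂ} (h : IsSmoothPeriodic φ) (h' : IsSmoothPeriodic ψ) :
    IsSmoothPeriodic (φ - ψ) :=
  ⟨h.1.sub h'.1, fun p i => by simp [h.2 p i, h'.2 p i]⟩

theorem IsSmoothPeriodic.cgrad_add {φ ψ : R3 → ℂ} (h : IsSmoothPeriodic φ)
    (h' : IsSmoothPeriodic ψ) : cgrad (φ + ψ) = cgrad φ + cgrad ψ := by
  funext p j
  simp [cgrad, fderiv_add (h.differentiable p) (h'.differentiable p)]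

theorem IsSmoothPeriodic.cgrad_sub {φ ψ : R3 → ℂ} (h : IsSmoothPeriodic φ)
    (h' : IsSmoothPeriodic ψ) : cgrad (φ - ψ) = cgrad φ - cgrad ψ := by
  funext p j
  simp [cgrad, fderiv_sub (h.differentiable p) (h'.differentiable p)]

theorem IsSmoothPeriodic.cgrad_const_smul {φ : R3 → ℂ} (h : IsSmoothPeriodic φ) (c : ℂ) :
    cgrad (c • φ) = c • cgrad φ := by
  funext p j
  simp [cgrad, fderiv_const_smul (h.differentiable p)]

theorem cgrad_const (c : ℂ) : cgrad (fun _ => c) = 0 := by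
  funext p j
  simp [cgrad]

/-! ### The trace inequality -/

theorem enorm_fderiv_apply_le (φ : R3 → ℂ) (p w : R3) :
    ‖fderiv ℝ φ p w‖ₑ ≤ ‖w‖ₑ * ∑ j, ‖cgrad φ p j‖ₑ := by
  have hw : w = ∑ j, w j • e j := by
    ext i; simp [e, Pi.single_apply]
  conv_lhs => rw [hw]
  rw [map_sum, Finset.mul_sum]
  refine (enorm_sum_le _ _).trans (Finset.sum_le_sum fun j _ => ?_)
  rw [map_smul, enorm_smul]
  gcongr
  · exact enorm_le_iff_norm_le.2 (PiLp.norm_apply_le w j)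
  · rfl

/-- The fundamental theorem of calculus bounds `φ x` by the value at any other point of the segment
plus the integral of the gradient along it; this is averaged over `t` in [0, r]. It is the
one-dimensional core of the trace inequality. -/
theorem IsSmoothPeriodic.mul_enorm_le {φ : R3 → ℂ} (h : IsSmoothPeriodic φ) (x w : R3) {r : ℝ} :
    ENNReal.ofReal r * ‖φ x‖ₑ ≤ ∫⁻ t in Icc 0 r, (‖φ (x + t • w)‖ₑ
      + ENNReal.ofReal r * ‖w‖ₑ * ∑ j, ‖cgrad φ (x + t • w) j‖ₑ) := by
  have hline : Continuous fun t : ℝ => x + t • w := by fun_prop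
  have hg : Measurable fun t : ℝ => ∑ j, ‖cgrad φ (x + t • w) j‖ₑ := by
    refine Finset.measurable_fun_sum _ fun j _ => ?_
    exact (((continuous_apply j).comp (h.continuous_cgrad)).comp hline).enorm.measurable
  have hd : ∀ t, HasDerivAt (fun t : ℝ => φ (x + t • w)) (fderiv ℝ φ (x + t • w) w) t := by
    intro t
    have h1 : HasDerivAt (fun t : ℝ => x + t • w) w t := by
      simpa using ((hasDerivAt_id t).smul_const w).const_add x
    exact (h.differentiable _).hasFDerivAt.comp_hasDerivAt t h1
  have hc : Continuous fun t : ℝ => fderiv ℝ φ (x + t • w) w := (h.continuous_fderiv w).comp hline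
  set Q := ∫⁻ t in Icc 0 r, ∑ j, ‖cgrad φ (x + t • w) j‖ₑ
  have hpt : ∀ t ∈ Icc 0 r, ‖φ x‖ₑ ≤ ‖φ (x + t • w)‖ₑ + ‖w‖ₑ * Q := by
    intro t ht
    have hint := intervalIntegral.integral_eq_sub_of_hasDerivAt (a := 0) (b := t)
      (fun s _ => hd s) (hc.intervalIntegrable _ _)
    have h0 : φ x = φ (x + t • w) - ∫ s in (0 : ℝ)..t, fderiv ℝ φ (x + s • w) w := by
      rw [hint]; simp
    calc ‖φ x‖ₑ ≤ ‖φ (x + t • w)‖ₑ + ‖∫ s in (0 : ℝ)..t, fderiv ℝ φ (x + s • w) w‖ₑ := by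
          conv_lhs => rw [h0]
          exact enorm_sub_le
      _ ≤ _ := by
        gcongr
        rw [intervalIntegral.integral_of_le ht.1]
        refine (enorm_integral_le_lintegral_enorm _).trans ?_
        rw [← lintegral_const_mul _ hg]
        refine (lintegral_mono fun s => enorm_fderiv_apply_le φ (x + s • w) w).trans ?_
        exact lintegral_mono_set (Ioc_subset_Icc_self.trans (Icc_subset_Icc_right ht.2))
  calc ENNReal.ofReal r * ‖φ x‖ₑ = ∫⁻ t in Icc 0 r, ‖φ x‖ₑ := by simp [mul_comm]
    _ ≤ ∫⁻ t in Icc 0 r, (‖φ (x + t • w)‖ₑ + ‖w‖ₑ * Q) := 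
      setLIntegral_mono' measurableSet_Icc hpt
    _ = (∫⁻ t in Icc 0 r, ‖φ (x + t • w)‖ₑ) + ENNReal.ofReal r * ‖w‖ₑ * Q := by
      rw [lintegral_add_right _ measurable_const]
      simp only [lintegral_const, Measure.restrict_apply MeasurableSet.univ, univ_inter,
        Real.volume_Icc, sub_zero]
      ring
    _ = _ := by
      rw [lintegral_add_right _ (hg.const_mul _), lintegral_const_mul _ hg]

/-- The line estimate in the transversal direction is integrated over a ball of parameters. The
resulting integral over the thickened chart is a volume integral up to bounded distortion, and by
periodicity it is controlled by the integral over one cell. -/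
theorem IsChart.exists_trace_ball {S : Set R3} {U : Set R2} {Φ : R2 → R3} (h : IsChart S U Φ)
    {z₀ : R2} (hz : z₀ ∈ U) : ∃ (C : ℝ≥0) (r : ℝ), 0 < r ∧ Metric.closedBall z₀ r ⊆ U ∧
      ∀ φ, IsSmoothPeriodic φ →
        ∫⁻ z in Metric.closedBall z₀ r, ‖φ (Φ z)‖ₑ ≤ C * sob1 φ (cgrad φ) := by
  obtain ⟨w, K, K', r, hr, hrU, hL, hA⟩ := h.exists_bilipschitz hz
  set B := Metric.closedBall z₀ r
  set W : Set (R2 × ℝ) := B ×ˢ Icc 0 r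
  set Ψ : R2 × ℝ → R3 := fun x => Φ x.1 + x.2 • w
  have hWsub : W ⊆ B ×ˢ Metric.closedBall (0 : ℝ) r := by
    refine prod_mono_right fun t ht => ?_
    rw [mem_closedBall_zero_iff, Real.norm_eq_abs, abs_of_nonneg ht.1]
    exact ht.2
  have hWc : IsCompact W := (isCompact_closedBall z₀ r).prod isCompact_Icc
  have hΨc : ContinuousOn Ψ W := hL.continuousOn.mono hWsub
  obtain ⟨R, hR⟩ := (hWc.image_of_continuousOn hΨc).isBounded.subset_closedBall 0
  have : (volume : Measure (R2 × ℝ)).IsAddHaarMeasure := Measure.prod.instIsAddHaarMeasure _ _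
  obtain ⟨C₁, hC₁⟩ := exists_addHaar_image_le (volume : Measure R3)
    (volume : Measure (R2 × ℝ)) (by simp) K'
  obtain ⟨N, hN⟩ := exists_lintegral_closedBall_le R
  have hm : AEMeasurable Ψ (volume.restrict W) := hΨc.aemeasurable hWc.measurableSet
  -- The inverse of `Ψ` is Lipschitz, so pushing Lebesgue measure forward increases densities by at
  -- most `C₁`.
  have hmap : (volume.restrict W).map Ψ ≤ C₁ • volume.restrict (Metric.closedBall 0 R) := by
    refine Measure.le_iff.2 fun T hT => ?_
    rw [Measure.map_apply_of_aemeasurable hm hT,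
      Measure.restrict_apply₀ (hm.nullMeasurableSet_preimage hT), Measure.smul_apply,
      Measure.restrict_apply hT]
    have hA' : ∀ x ∈ W, ∀ y ∈ W, dist x y ≤ K' * dist (Ψ x) (Ψ y) := fun x hx y hy =>
      hA x (hWsub hx) y (hWsub hy)
    have hinj : InjOn Ψ W := fun x hx y hy hxy => by
      have := hA' x hx y hy
      rw [hxy, dist_self, mul_zero] at this
      exact dist_le_zero.1 this
    have hgi : ∀ x ∈ W, Function.invFunOn Ψ W (Ψ x) = x :=
      fun x hx => hinj.leftInvOn_invFunOn hx
    have hgL : LipschitzOnWith K' (Function.invFunOn Ψ W) (Ψ '' (W ∩ Ψ ⁻¹' T)) := by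
      refine LipschitzOnWith.of_dist_le_mul ?_
      rintro _ ⟨x, hx, rfl⟩ _ ⟨y, hy, rfl⟩
      rw [hgi x hx.1, hgi y hy.1]
      exact hA' x hx.1 y hy.1
    have h1 := hC₁ _ _ hgL
    have h2 : Function.invFunOn Ψ W '' (Ψ '' (W ∩ Ψ ⁻¹' T)) = W ∩ Ψ ⁻¹' T := by
      rw [image_image]
      exact (image_congr fun x hx => hgi x hx.1).trans (image_id' _)
    rw [h2] at h1
    rw [inter_comm]
    refine h1.trans ?_
    rw [ENNReal.smul_def, smul_eq_mul]
    gcongr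
    rintro _ ⟨x, hx, rfl⟩
    exact ⟨hx.2, hR (mem_image_of_mem _ hx.1)⟩
  -- This constant dominates both weights of the line estimate, 1 for the value and r‖w‖ for the
  -- gradient.
  set c : ℝ≥0 := 1 + Real.toNNReal r * ‖w‖₊
  refine ⟨(Real.toNNReal r)⁻¹ * (c * (C₁ * N)), r, hr, hrU, fun φ hφ => ?_⟩
  set g : R3 → ℝ≥0∞ := fun p => ‖φ p‖ₑ + ∑ j, ‖cgrad φ p j‖ₑ with hgdef
  have hgm : Measurable g := by
    refine hφ.continuous.enorm.measurable.add (Finset.measurable_fun_sum _ fun j _ => ?_)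
    exact ((continuous_apply j).comp hφ.continuous_cgrad).enorm.measurable
  have hgp : IsPeriodic g := fun p i => by
    simp only [g, hφ.2 p i, hφ.cgrad_periodic p i]
  have hpt : ∀ z, ENNReal.ofReal r * ‖φ (Φ z)‖ₑ ≤ c * ∫⁻ t in Icc 0 r, g (Ψ (z, t)) := by
    intro z
    refine (hφ.mul_enorm_le (Φ z) w (r := r)).trans ?_
    rw [← lintegral_const_mul' _ _ (by simp)]
    refine lintegral_mono fun t => ?_
    simp only [g, Ψ, mul_add]
    gcongr
    · exact le_mul_of_one_le_left zero_le (by simp [c])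
    · simp only [c]
      push_cast
      exact le_add_self
  have hmain : ENNReal.ofReal r * ∫⁻ z in B, ‖φ (Φ z)‖ₑ ≤ c * (C₁ * (N * sob1 φ (cgrad φ))) := by
    rw [← lintegral_const_mul' _ _ (by simp)]
    refine (lintegral_mono hpt).trans ?_
    rw [lintegral_const_mul' _ _ (by simp)]
    gcongr
    have hgΨ : AEMeasurable (fun x => g (Ψ x)) (volume.restrict W) := hgm.comp_aemeasurable hm
    have hvol : (volume.restrict W : Measure (R2 × ℝ))
        = (volume.restrict B).prod (volume.restrict (Icc 0 r)) := by
      rw [Measure.prod_restrict]; rfl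
    rw [hvol] at hgΨ
    rw [← lintegral_prod _ hgΨ, ← hvol,
      ← lintegral_map' hgm.aemeasurable hm]
    refine (lintegral_mono' hmap le_rfl).trans ?_
    rw [lintegral_smul_measure, ENNReal.smul_def, smul_eq_mul]
    gcongr
    exact hN g hgm hgp
  have hr0 : ENNReal.ofReal r ≠ 0 := by simpa using hr
  calc ∫⁻ z in B, ‖φ (Φ z)‖ₑ
      = (ENNReal.ofReal r)⁻¹ * (ENNReal.ofReal r * ∫⁻ z in B, ‖φ (Φ z)‖ₑ) := by
        rw [← mul_assoc, ENNReal.inv_mul_cancel hr0 ENNReal.ofReal_ne_top, one_mul]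
    _ ≤ (ENNReal.ofReal r)⁻¹ * (c * (C₁ * (N * sob1 φ (cgrad φ)))) := by gcongr
    _ = _ := by
      have : (Real.toNNReal r) ≠ 0 := by simpa using hr
      push_cast [ENNReal.coe_inv this]
      rw [ENNReal.ofReal]
      ring

/-- The trace inequality for smooth functions. -/
theorem IsChart.exists_trace_le {S : Set R3} {U : Set R2} {Φ : R2 → R3} (h : IsChart S U Φ)
    {K : Set R2} (hK : IsCompact K) (hKU : K ⊆ U) : ∃ C : ℝ≥0, ∀ φ, IsSmoothPeriodic φ →
      ∫⁻ z in K, ‖φ (Φ z)‖ₑ ≤ C * sob1 φ (cgrad φ) := by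
  refine hK.induction_on (p := fun K => ∃ C : ℝ≥0, ∀ φ, IsSmoothPeriodic φ →
      ∫⁻ z in K, ‖φ (Φ z)‖ₑ ≤ C * sob1 φ (cgrad φ)) ⟨0, by simp⟩ ?_ ?_ ?_
  · rintro s t hst ⟨C, hC⟩
    exact ⟨C, fun φ hφ => (lintegral_mono_set hst).trans (hC φ hφ)⟩
  · rintro s t ⟨C, hC⟩ ⟨C', hC'⟩
    refine ⟨C + C', fun φ hφ => (lintegral_union_le _ _ _).trans ?_⟩
    push_cast
    rw [add_mul]
    exact add_le_add (hC φ hφ) (hC' φ hφ)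
  · intro z hz
    obtain ⟨C, r, hr, -, hC⟩ := h.exists_trace_ball (hKU hz)
    exact ⟨_, mem_nhdsWithin_of_mem_nhds (Metric.closedBall_mem_nhds z hr), C, hC⟩


/-! ### Traces -/

theorem sob1_sub_comm (f g : R3 → ℂ) (F G : R3 → Fin 3 → ℂ) :
    sob1 (f - g) (F - G) = sob1 (g - f) (G - F) := by
  unfold sob1
  refine lintegral_congr fun p => ?_
  simp only [Pi.sub_apply]
  rw [enorm_sub_rev (f p)]
  congr 1
  exact Finset.sum_congr rfl fun j _ => enorm_sub_rev _ _

/-- The Bochner integral of a nonintegrable function is 0, so convergence of these integrals is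
meaningful only because `f` and `G` are square integrable. Under that assumption the condition can
be stated with extended nonnegative integrals, which need no integrability side conditions. -/
theorem isTrace_iff {S : Set R3} {f : R3 → ℂ} {G : R3 → Fin 3 → ℂ} {u : R3 → ℂ}
    (hf : MemLp f 2 vol) (hG : MemLp G 2 vol) : IsTrace S f G u ↔
      ∃ φ : ℕ → R3 → ℂ, (∀ n, IsSmoothPeriodic (φ n)) ∧
        Tendsto (fun n => sob2 (φ n - f) (cgrad (φ n) - G)) atTop (𝓝 0) ∧
        ∀ᵐ p ∂area S, Tendsto (fun n => φ n p) atTop (𝓝 (u p)) := by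
  unfold IsTrace
  refine exists_congr fun φ => and_congr_right fun hφ => and_congr_left fun _ => ?_
  have hφ' : ∀ n, IsSmoothPeriodic (φ n) := hφ
  have key : ∀ n, ENNReal.ofReal (∫ p, (‖φ n p - f p‖ ^ 2
      + ∑ j, ‖fderiv ℝ (φ n) p (e j) - G p j‖ ^ 2) ∂vol) = sob2 (φ n - f) (cgrad (φ n) - G) :=
    fun n => ofReal_integral_eq_sob2 ((hφ' n).memLp.sub hf) ((hφ' n).cgrad_memLp.sub hG)
  simp only [← key]
  constructor
  · intro h
    simpa using ENNReal.tendsto_ofReal h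
  · intro h
    have h2 := (ENNReal.tendsto_toReal (by simp)).comp h
    simp only [ENNReal.toReal_zero] at h2
    refine h2.congr fun n => ENNReal.toReal_ofReal (integral_nonneg fun p => by positivity)

theorem IsTrace.add {S : Set R3} {f f' : R3 → ℂ} {G G' : R3 → Fin 3 → ℂ} {u u' : R3 → ℂ}
    (hf : MemLp f 2 vol) (hG : MemLp G 2 vol) (hf' : MemLp f' 2 vol) (hG' : MemLp G' 2 vol)
    (h : IsTrace S f G u) (h' : IsTrace S f' G' u') : IsTrace S (f + f') (G + G') (u + u') := by
  obtain ⟨φ, hφ, hc, ha⟩ := (isTrace_iff hf hG).1 h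
  obtain ⟨φ', hφ', hc', ha'⟩ := (isTrace_iff hf' hG').1 h'
  refine (isTrace_iff (hf.add hf') (hG.add hG')).2 ⟨fun n => φ n + φ' n,
    fun n => (hφ n).add (hφ' n), ?_, ?_⟩
  · have h0 : Tendsto (fun n => 2 * sob2 (φ n - f) (cgrad (φ n) - G)
        + 2 * sob2 (φ' n - f') (cgrad (φ' n) - G')) atTop (𝓝 0) := by
      simpa using (ENNReal.Tendsto.const_mul (a := 2) hc (Or.inr (by simp))).add
        (ENNReal.Tendsto.const_mul (a := 2) hc' (Or.inr (by simp)))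
    refine tendsto_of_tendsto_of_tendsto_of_le_of_le tendsto_const_nhds h0 (fun _ => zero_le)
      fun n => ?_
    have := sob2_add_le (g := φ' n - f') (G := cgrad (φ' n) - G')
      ((hφ n).memLp.sub hf).aestronglyMeasurable ((hφ n).cgrad_memLp.sub hG).aestronglyMeasurable
    rw [(hφ n).cgrad_add (hφ' n), add_sub_add_comm, add_sub_add_comm]
    exact this
  · filter_upwards [ha, ha'] with p h1 h2 using h1.add h2

theorem IsTrace.const_smul {S : Set R3} {f : R3 → ℂ} {G : R3 → Fin 3 → ℂ} {u : R3 → ℂ}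
    (hf : MemLp f 2 vol) (hG : MemLp G 2 vol) (h : IsTrace S f G u) (c : ℂ) :
    IsTrace S (c • f) (c • G) (c • u) := by
  obtain ⟨φ, hφ, hc, ha⟩ := (isTrace_iff hf hG).1 h
  refine (isTrace_iff (hf.const_smul c) (hG.const_smul c)).2 ⟨fun n => c • φ n,
    fun n => (hφ n).const_smul c, ?_, ?_⟩
  · have h0 : Tendsto (fun n => ‖c‖ₑ ^ 2 * sob2 (φ n - f) (cgrad (φ n) - G)) atTop (𝓝 0) := by
      simpa using (ENNReal.Tendsto.const_mul (a := ‖c‖ₑ ^ 2) hc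
        (Or.inr (ENNReal.pow_ne_top (by simp))))
    refine h0.congr fun n => ?_
    rw [(hφ n).cgrad_const_smul, ← smul_sub, ← smul_sub]
    unfold sob2
    rw [← lintegral_const_mul' _ _ (ENNReal.pow_ne_top (by simp))]
    refine lintegral_congr fun p => ?_
    simp [enorm_mul, mul_pow, mul_add, Finset.mul_sum]
  · filter_upwards [ha] with p h1 using h1.const_smul c

/-- The trace inequality. -/
theorem IsChart.exists_isTrace_le {S : Set R3} {U : Set R2} {Φ : R2 → R3} (h : IsChart S U Φ)
    {K : Set R2} (hK : IsCompact K) (hKU : K ⊆ U) : ∃ C : ℝ≥0,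
      ∀ (f : R3 → ℂ) (G : R3 → Fin 3 → ℂ) (u : R3 → ℂ), MemLp f 2 vol → MemLp G 2 vol →
        IsTrace S f G u → ∫⁻ z in K, ‖u (Φ z)‖ₑ ≤ C * sob1 f G := by
  obtain ⟨C, hC⟩ := h.exists_trace_le hK hKU
  refine ⟨C, fun f G u hf hG hu => ?_⟩
  obtain ⟨φ, hφ, hc, ha⟩ := (isTrace_iff hf hG).1 hu
  have hm : ∀ n, AEMeasurable (fun z => ‖φ n (Φ z)‖ₑ) (volume.restrict K) := fun n =>
    (hφ n).continuous.enorm.measurable.comp_aemeasurable (h.aemeasurable hK hKU)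
  -- Fatou's lemma: almost everywhere convergence on the surface suffices, without L¹ convergence of
  -- the approximating traces.
  have h1 : ∫⁻ z in K, ‖u (Φ z)‖ₑ = ∫⁻ z in K, liminf (fun n => ‖φ n (Φ z)‖ₑ) atTop := by
    refine lintegral_congr_ae ?_
    filter_upwards [h.ae_comp hK hKU ha] with z hz
    exact (hz.enorm.liminf_eq).symm
  rw [h1]
  refine (lintegral_liminf_le' hm).trans ?_
  have h2 : ∀ n, ∫⁻ z in K, ‖φ n (Φ z)‖ₑ ≤ C * (sob1 (φ n - f) (cgrad (φ n) - G) + sob1 f G) := by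
    intro n
    refine (hC _ (hφ n)).trans ?_
    gcongr
    have := sob1_add_le (g := f) (G := G) ((hφ n).memLp.sub hf).aestronglyMeasurable
      ((hφ n).cgrad_memLp.sub hG).aestronglyMeasurable
    simpa using this
  have h3 : Tendsto (fun n => C * (sob1 (φ n - f) (cgrad (φ n) - G) + sob1 f G)) atTop
      (𝓝 (C * sob1 f G)) := by
    have := tendsto_sob1_of_sob2 (fun n => ((hφ n).memLp.sub hf).aestronglyMeasurable)
      (fun n => ((hφ n).cgrad_memLp.sub hG).aestronglyMeasurable) hc
    have h4 := ENNReal.Tendsto.const_mul (a := C) (this.add_const (sob1 f G)) (Or.inr (by simp))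
    simpa using h4
  exact (liminf_le_liminf (Eventually.of_forall h2)).trans h3.liminf_eq.le

theorem sob1_ne_top {f : R3 → ℂ} {G : R3 → Fin 3 → ℂ} (hf : MemLp f 2 vol)
    (hG : MemLp G 2 vol) : sob1 f G ≠ ⊤ :=
  ne_top_of_le_ne_top (ENNReal.rpow_ne_top_of_nonneg (by norm_num)
    (ENNReal.mul_ne_top (by simp) (sob2_ne_top hf hG)))
    (sob1_le_sob2 hf.aestronglyMeasurable hG.aestronglyMeasurable)

theorem IsTrace.integrableOn {S : Set R3} {f : R3 → ℂ} {G : R3 → Fin 3 → ℂ} {u : R3 → ℂ}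
    (hf : MemLp f 2 vol) (hG : MemLp G 2 vol) (hu : IsTrace S f G u) {U : Set R2} {Φ : R2 → R3}
    (h : IsChart S U Φ) {K : Set R2} (hK : IsCompact K) (hKU : K ⊆ U) :
    IntegrableOn (fun z => u (Φ z)) K := by
  refine ⟨?_, ?_⟩
  · obtain ⟨φ, hφ, hc, ha⟩ := (isTrace_iff hf hG).1 hu
    refine aestronglyMeasurable_of_tendsto_ae atTop (f := fun n z => φ n (Φ z)) (fun n => ?_)
      (h.ae_comp hK hKU ha)
    exact (hφ n).continuous.comp_aestronglyMeasurable
      (h.aemeasurable hK hKU).aestronglyMeasurable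
  · obtain ⟨C, hC⟩ := h.exists_isTrace_le hK hKU
    exact (hC f G u hf hG hu).trans_lt
      (ENNReal.mul_lt_top (by simp) (sob1_ne_top hf hG).lt_top)

/-- Limits in `H¹` of smooth periodic functions have a trace. -/
theorem IsSurface.exists_isTrace {S : Set R3} (hS : IsSurface S) {f : R3 → ℂ}
    {G : R3 → Fin 3 → ℂ} (hf : MemLp f 2 vol) (hG : MemLp G 2 vol) {φ : ℕ → R3 → ℂ}
    (hφ : ∀ n, IsSmoothPeriodic (φ n))
    (hc : Tendsto (fun n => sob2 (φ n - f) (cgrad (φ n) - G)) atTop (𝓝 0)) :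
    ∃ u, IsTrace S f G u := by
  have hc1 := tendsto_sob1_of_sob2 (fun n => ((hφ n).memLp.sub hf).aestronglyMeasurable)
      (fun n => ((hφ n).cgrad_memLp.sub hG).aestronglyMeasurable) hc
  -- A subsequence converging geometrically fast makes the increments summable, which yields
  -- pointwise rather than merely L¹ convergence.
  have hev : ∀ k : ℕ, ∀ᶠ n in atTop, sob1 (φ n - f) (cgrad (φ n) - G) < (2⁻¹ : ℝ≥0∞) ^ k :=
    fun k => hc1.eventually_lt_const (ENNReal.pow_pos (by simp) k)
  obtain ⟨n, hn, hnk⟩ := extraction_forall_of_eventually hev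
  set ψ : ℕ → R3 → ℂ := fun k => φ (n k)
  have hψ : ∀ k, IsSmoothPeriodic (ψ k) := fun k => hφ (n k)
  have hdiff : ∀ k, sob1 (ψ (k + 1) - ψ k) (cgrad (ψ (k + 1) - ψ k)) ≤ 2 * (2⁻¹ : ℝ≥0∞) ^ k := by
    intro k
    have h1 := sob1_add_le (g := f - ψ k) (G := G - cgrad (ψ k))
      ((hψ (k + 1)).memLp.sub hf).aestronglyMeasurable
      ((hψ (k + 1)).cgrad_memLp.sub hG).aestronglyMeasurable
    rw [sub_add_sub_cancel, sub_add_sub_cancel, sob1_sub_comm f] at h1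
    rw [(hψ _).cgrad_sub (hψ _)]
    refine h1.trans ?_
    rw [two_mul]
    refine add_le_add ((hnk (k + 1)).le.trans ?_) (hnk k).le
    exact pow_le_pow_of_le_one zero_le (by simp) (Nat.le_succ k)
  -- In each chart the trace inequality sums the L¹ norms of the increments, so the series of
  -- increments converges absolutely almost everywhere.
  have hlim : ∀ᵐ p ∂area S, ∃ l, Tendsto (fun k => ψ k p) atTop (𝓝 l) := by
    refine hS.ae_of_chart fun U Φ hΦ z₀ hz₀ => ?_
    obtain ⟨r, hr, hrU⟩ := Metric.nhds_basis_closedBall.mem_iff.1 (hΦ.isOpen.mem_nhds hz₀)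
    refine ⟨r, hr, hrU, ?_⟩
    have hBc := isCompact_closedBall z₀ r
    obtain ⟨C, hC⟩ := hΦ.exists_trace_le hBc hrU
    have hm : ∀ k, AEMeasurable (fun z => ‖(ψ (k + 1) - ψ k) (Φ z)‖ₑ)
        (volume.restrict (Metric.closedBall z₀ r)) := fun k =>
      ((hψ _).sub (hψ _)).continuous.enorm.measurable.comp_aemeasurable (hΦ.aemeasurable hBc hrU)
    have hfin : ∫⁻ z in Metric.closedBall z₀ r, ∑' k, ‖(ψ (k + 1) - ψ k) (Φ z)‖ₑ ≠ ⊤ := by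
      rw [lintegral_tsum hm]
      refine ne_top_of_le_ne_top (b := C * (2 * ∑' k : ℕ, (2⁻¹ : ℝ≥0∞) ^ k)) ?_ ?_
      · rw [ENNReal.tsum_geometric]
        refine ENNReal.mul_ne_top (by simp) (ENNReal.mul_ne_top (by simp) ?_)
        simp [ENNReal.one_sub_inv_two]
      · rw [← ENNReal.tsum_mul_left, ← ENNReal.tsum_mul_left]
        refine ENNReal.tsum_le_tsum fun k => ?_
        exact (hC _ ((hψ _).sub (hψ _))).trans (by gcongr; exact hdiff k)
    filter_upwards [ae_lt_top' (AEMeasurable.tsum hm) hfin] with z hz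
    refine cauchySeq_tendsto_of_complete ?_
    refine cauchySeq_of_edist_le_of_tsum_ne_top
      (fun k => ‖(ψ (k + 1) - ψ k) (Φ z)‖ₑ) (fun k => ?_) hz.ne
    rw [edist_comm, edist_eq_enorm_sub]; rfl
  refine ⟨fun p => limUnder atTop fun k => ψ k p, (isTrace_iff hf hG).2 ⟨ψ, hψ,
    hc.comp hn.tendsto_atTop, ?_⟩⟩
  filter_upwards [hlim] with p hp using tendsto_nhds_limUnder hp

/-! ### Weak gradients -/

theorem measurable_periodize {f : R3 → ℂ} (hf : Measurable f) : Measurable (periodize f) := by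
  refine hf.comp (measurable_id.sub ?_)
  unfold lattice
  refine Finset.measurable_fun_sum _ fun i _ => ?_
  have : Measurable fun p : R3 => p i := (EuclideanSpace.proj i : R3 →L[ℝ] ℝ).continuous.measurable
  exact (measurable_from_top (f := ((↑) : ℤ → ℝ)) |>.comp
    (Int.measurable_floor.comp this)).smul_const _

/-- Periodizing a measurable representative on the cell gives a measurable function on all of space,
and the two periodic functions agree almost everywhere because they do so on one cell. -/
theorem IsPeriodic.aestronglyMeasurable {f : R3 → ℂ} (hf : IsPeriodic f)
    (hm : AEStronglyMeasurable f vol) : AEStronglyMeasurable f volume := by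
  refine ⟨periodize (hm.mk f), (measurable_periodize hm.stronglyMeasurable_mk.measurable)
    |>.stronglyMeasurable, ?_⟩
  refine ae_of_ae_vol (fun p i => ?_) (hm.ae_eq_mk.trans (periodize_ae_eq _).symm)
  rw [hf, isPeriodic_periodize]

theorem exists_lintegral_closedBall_enorm_le (R : ℝ) :
    ∃ N : ℝ≥0, ∀ h : R3 → ℂ, AEStronglyMeasurable h vol → IsPeriodic h →
      ∫⁻ p in Metric.closedBall 0 R, ‖h p‖ₑ ≤ N * ∫⁻ p, ‖h p‖ₑ ∂vol := by
  obtain ⟨N, hN⟩ := exists_lintegral_closedBall_le R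
  refine ⟨N, fun h hm hp => ?_⟩
  have h0 : h =ᵐ[vol] periodize (hm.mk h) := hm.ae_eq_mk.trans (periodize_ae_eq _).symm
  have h1 : h =ᵐ[volume] periodize (hm.mk h) :=
    ae_of_ae_vol (fun p i => by rw [hp, isPeriodic_periodize]) h0
  have h2 := hN (fun p => ‖periodize (hm.mk h) p‖ₑ)
    (measurable_periodize hm.stronglyMeasurable_mk.measurable).enorm
    ((isPeriodic_periodize _).comp _)
  calc ∫⁻ p in Metric.closedBall 0 R, ‖h p‖ₑ
      = ∫⁻ p in Metric.closedBall 0 R, ‖periodize (hm.mk h) p‖ₑ :=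
        lintegral_congr_ae (ae_restrict_of_ae (h1.fun_comp fun x => ‖x‖ₑ))
    _ ≤ _ := h2
    _ = N * ∫⁻ p, ‖h p‖ₑ ∂vol := by
      congr 1
      exact (lintegral_congr_ae (h0.fun_comp fun x => ‖x‖ₑ)).symm

/-- L¹ convergence survives multiplication by a bounded function. Every weak identity below passes
to the limit through this statement. -/
theorem tendsto_integral_mul_of_bound {α : Type*} [MeasurableSpace α] {μ : Measure α}
    {a : ℕ → α → ℂ} {a' b : α → ℂ} (ha : ∀ n, Integrable (a n) μ) (ha' : Integrable a' μ)
    (hb : AEStronglyMeasurable b μ) {M : ℝ≥0} (hM : ∀ᵐ x ∂μ, ‖b x‖₊ ≤ M)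
    (h : Tendsto (fun n => ∫⁻ x, ‖a n x - a' x‖ₑ ∂μ) atTop (𝓝 0)) :
    Tendsto (fun n => ∫ x, a n x * b x ∂μ) atTop (𝓝 (∫ x, a' x * b x ∂μ)) := by
  refine tendsto_integral_of_L1 _ (ha'.mul_bdd (c := M) hb hM).aestronglyMeasurable
    (Eventually.of_forall fun n => (ha n).mul_bdd (c := M) hb hM) ?_
  have h0 : Tendsto (fun n => (M : ℝ≥0∞) * ∫⁻ x, ‖a n x - a' x‖ₑ ∂μ) atTop (𝓝 0) := by
    simpa using ENNReal.Tendsto.const_mul (a := (M : ℝ≥0∞)) h (Or.inr (by simp))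
  refine tendsto_of_tendsto_of_tendsto_of_le_of_le tendsto_const_nhds h0 (fun _ => zero_le)
    fun n => ?_
  simp only
  rw [← lintegral_const_mul' _ _ (by simp)]
  refine lintegral_mono_ae ?_
  filter_upwards [hM] with x hx
  rw [← sub_mul, enorm_mul, mul_comm]
  gcongr
  exact_mod_cast hx

/-- Integration by parts holds for the smooth approximants. A test function lives in a ball, which
meets finitely many cells, so convergence on one cell is enough to pass to the limit. Hence
membership in `H` needs no separate check of the weak gradient once a trace exists. -/
theorem hasWeakGrad_of_tendsto {f : R3 → ℂ} {G : R3 → Fin 3 → ℂ} (hf : MemLp f 2 vol)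
    (hG : MemLp G 2 vol) (hfp : IsPeriodic f) (hGp : IsPeriodic G) {φ : ℕ → R3 → ℂ}
    (hφ : ∀ n, IsSmoothPeriodic (φ n))
    (hc : Tendsto (fun n => sob2 (φ n - f) (cgrad (φ n) - G)) atTop (𝓝 0)) :
    HasWeakGrad f G := by
  have hc1 := tendsto_sob1_of_sob2 (fun n => ((hφ n).memLp.sub hf).aestronglyMeasurable)
      (fun n => ((hφ n).cgrad_memLp.sub hG).aestronglyMeasurable) hc
  intro η hη hηc j
  obtain ⟨R, hR⟩ := hηc.isCompact.isBounded.subset_closedBall 0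
  obtain ⟨N, hN⟩ := exists_lintegral_closedBall_enorm_le R
  set B := Metric.closedBall (0 : R3) R
  have hBm : MeasurableSet B := Metric.isClosed_closedBall.measurableSet
  have hη0 : ∀ p, p ∉ B → η p = 0 := fun p hp => image_eq_zero_of_notMem_tsupport fun h => hp (hR h)
  have hη0' : ∀ p, p ∉ B → fderiv ℝ η p (e j) = 0 := fun p hp => by
    have : fderiv ℝ η p = 0 := by
      refine image_eq_zero_of_notMem_tsupport fun h => hp (hR (tsupport_fderiv_subset ℝ h))
    rw [this]; rfl
  have hdc : Continuous fun p => fderiv ℝ η p (e j) :=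
    (hη.continuous_fderiv (by simp)).clm_apply continuous_const
  have hbd : ∀ b : R3 → ℝ, Continuous b → ∃ M : ℝ≥0, ∀ᵐ p ∂volume.restrict B, ‖(b p : ℂ)‖₊ ≤ M := by
    intro b hb
    obtain ⟨M, hM⟩ := (isCompact_closedBall (0 : R3) R).exists_bound_of_continuousOn hb.continuousOn
    refine ⟨M.toNNReal, ae_restrict_of_forall_mem hBm fun p hp => ?_⟩
    rw [← NNReal.coe_le_coe]
    simpa using Or.inl (hM p hp)
  have hconv : ∀ (a : ℕ → R3 → ℂ) (a' : R3 → ℂ) (b : R3 → ℝ), Continuous b →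
      (∀ n, MemLp (a n) 2 vol) → MemLp a' 2 vol → (∀ n, IsPeriodic (a n)) → IsPeriodic a' →
      (∀ n, ∫⁻ p, ‖a n p - a' p‖ₑ ∂vol ≤ sob1 (φ n - f) (cgrad (φ n) - G)) →
      Tendsto (fun n => ∫ p in B, a n p * (b p : ℂ)) atTop (𝓝 (∫ p in B, a' p * (b p : ℂ))) := by
    intro a a' b hb ha ha' hap hap' hle
    have hint : ∀ h : R3 → ℂ, MemLp h 2 vol → IsPeriodic h → IntegrableOn h B := fun h hm hp =>
      ⟨(hp.aestronglyMeasurable hm.aestronglyMeasurable).restrict,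
        (hN h hm.aestronglyMeasurable hp).trans_lt (ENNReal.mul_lt_top (by simp)
          (hm.integrable (by norm_num)).2)⟩
    obtain ⟨M, hM⟩ := hbd b hb
    refine tendsto_integral_mul_of_bound (fun n => hint _ (ha n) (hap n)) (hint _ ha' hap')
      (Complex.continuous_ofReal.comp hb).aestronglyMeasurable hM ?_
    have h0 : Tendsto (fun n => (N : ℝ≥0∞) * sob1 (φ n - f) (cgrad (φ n) - G)) atTop (𝓝 0) := by
      simpa using ENNReal.Tendsto.const_mul (a := (N : ℝ≥0∞)) hc1 (Or.inr (by simp))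
    refine tendsto_of_tendsto_of_tendsto_of_le_of_le tendsto_const_nhds h0 (fun _ => zero_le)
      fun n => ?_
    refine (hN (fun p => a n p - a' p) ((ha n).sub ha').aestronglyMeasurable
      (fun p i => by simp only [hap n p i, hap' p i])).trans ?_
    gcongr
    exact hle n
  have h1 := hconv φ f (fun p => fderiv ℝ η p (e j)) hdc (fun n => (hφ n).memLp) hf
    (fun n => (hφ n).2) hfp fun n => lintegral_mono fun p => le_self_add
  have h2 := hconv (fun n p => cgrad (φ n) p j) (fun p => G p j) η hη.continuous
    (fun n => (hφ n).cgrad_memLp.eval j) (hG.eval j)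
    (fun n => (hφ n).cgrad_periodic.comp fun v => v j) (hGp.comp fun v => v j)
    fun n => lintegral_mono fun p => by
      refine le_trans ?_ le_add_self
      exact Finset.single_le_sum (f := fun j => ‖(cgrad (φ n) - G) p j‖ₑ) (fun _ _ => zero_le)
        (Finset.mem_univ j)
  have hparts : ∀ n, ∫ p in B, φ n p * (fderiv ℝ η p (e j) : ℂ)
      = -∫ p in B, cgrad (φ n) p j * (η p : ℂ) := by
    intro n
    rw [setIntegral_eq_integral_of_forall_compl_eq_zero (fun p hp => by simp [hη0' p hp]),
      setIntegral_eq_integral_of_forall_compl_eq_zero (fun p hp => by simp [hη0 p hp])]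
    have hder : ∀ p, fderiv ℝ (fun p => (η p : ℂ)) p (e j) = (fderiv ℝ η p (e j) : ℂ) := fun p => by
      have := Complex.ofRealCLM.hasFDerivAt.comp p (hη.differentiable (by simp) p).hasFDerivAt
      rw [show (fun p => (η p : ℂ)) = Complex.ofRealCLM ∘ η from rfl, this.fderiv]
      simp
    have hηcC : HasCompactSupport fun p => (η p : ℂ) := hηc.comp_left (g := fun x : ℝ => (x : ℂ)) (by simp)
    have hdcC : HasCompactSupport fun p => (fderiv ℝ η p (e j) : ℂ) :=
      ((hηc.fderiv (𝕜 := ℝ)).comp_left (g := fun L : R3 →L[ℝ] ℝ => ((L (e j) : ℝ) : ℂ)) (by simp))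
    have hηC : Continuous fun p => (η p : ℂ) := Complex.continuous_ofReal.comp hη.continuous
    have hdC : Continuous fun p => (fderiv ℝ η p (e j) : ℂ) := Complex.continuous_ofReal.comp hdc
    have := integral_mul_fderiv_eq_neg_fderiv_mul_of_integrable (μ := (volume : Measure R3))
      (𝕜 := ℂ) (f := φ n) (g := fun p => (η p : ℂ)) (v := e j) ?_ ?_ ?_
      (fun p _ => (hφ n).differentiable p)
      (fun p _ => (Complex.ofRealCLM.differentiable.comp (hη.differentiable (by simp))) p)
    · simp only [hder] at this
      exact this
    · exact (((hφ n).continuous_fderiv (e j)).mul hηC).integrable_of_hasCompactSupport hηcC.mul_left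
    · simp only [hder]
      exact ((hφ n).continuous.mul hdC).integrable_of_hasCompactSupport hdcC.mul_left
    · exact ((hφ n).continuous.mul hηC).integrable_of_hasCompactSupport hηcC.mul_left
  have h3 := tendsto_nhds_unique h1 ((h2.neg).congr fun n => (hparts n).symm)
  rw [setIntegral_eq_integral_of_forall_compl_eq_zero (fun p hp => by simp [hη0' p hp]),
    setIntegral_eq_integral_of_forall_compl_eq_zero (fun p hp => by simp [hη0 p hp])] at h3
  exact h3


/-! ### The Poincaré inequality -/

theorem lintegral_sq_le {α : Type*} [MeasurableSpace α] {μ : Measure α} [IsProbabilityMeasure μ]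
    {f : α → ℝ≥0∞} (hf : AEMeasurable f μ) : (∫⁻ x, f x ∂μ) ^ 2 ≤ ∫⁻ x, f x ^ 2 ∂μ := by
  have h := ENNReal.lintegral_mul_le_Lp_mul_Lq μ Real.HolderConjugate.two_two hf
    (aemeasurable_const (b := 1))
  simp only [Pi.mul_apply, mul_one, ENNReal.one_rpow, lintegral_const, measure_univ] at h
  calc (∫⁻ x, f x ∂μ) ^ 2 ≤ ((∫⁻ x, f x ^ (2 : ℝ) ∂μ) ^ (1 / 2 : ℝ)) ^ 2 := by gcongr
    _ = ∫⁻ x, f x ^ 2 ∂μ := by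
      rw [← ENNReal.rpow_natCast, ← ENNReal.rpow_mul]
      simp

/-- The mean value formula along the segment is combined with Jensen's inequality on [0, 1]; the
factor 3 is Cauchy–Schwarz over the three partial derivatives. -/
theorem IsSmoothPeriodic.enorm_sub_sq_le {φ : R3 → ℂ} (hφ : IsSmoothPeriodic φ) (p h : R3) :
    ‖φ p - φ (p + h)‖ₑ ^ 2 ≤ 3 * ‖h‖ₑ ^ 2 *
      ∫⁻ t in Icc (0 : ℝ) 1, ∑ j, ‖cgrad φ (p + t • h) j‖ₑ ^ 2 := by
  have : IsProbabilityMeasure (volume.restrict (Icc (0 : ℝ) 1)) := ⟨by simp⟩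
  have hline : Continuous fun t : ℝ => p + t • h := by fun_prop
  have hd : ∀ t, HasDerivAt (fun t : ℝ => φ (p + t • h)) (fderiv ℝ φ (p + t • h) h) t := by
    intro t
    have h1 : HasDerivAt (fun t : ℝ => p + t • h) h t := by
      simpa using ((hasDerivAt_id t).smul_const h).const_add p
    exact (hφ.differentiable _).hasFDerivAt.comp_hasDerivAt t h1
  have hc : Continuous fun t : ℝ => fderiv ℝ φ (p + t • h) h := (hφ.continuous_fderiv h).comp hline
  have hint := intervalIntegral.integral_eq_sub_of_hasDerivAt (a := 0) (b := 1)
      (fun s _ => hd s) (hc.intervalIntegrable _ _)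
  have h0 : φ p - φ (p + h) = - ∫ s in (0 : ℝ)..1, fderiv ℝ φ (p + s • h) h := by
    rw [hint]; simp
  have hg : Measurable fun t : ℝ => ∑ j, ‖cgrad φ (p + t • h) j‖ₑ ^ 2 := by
    refine Finset.measurable_fun_sum _ fun j _ => ?_
    exact (((continuous_apply j).comp (hφ.continuous_cgrad)).comp hline).enorm.measurable.pow_const 2
  rw [h0, enorm_neg, intervalIntegral.integral_of_le zero_le_one, ← integral_Icc_eq_integral_Ioc]
  refine (pow_le_pow_left₀ zero_le (enorm_integral_le_lintegral_enorm _) 2).trans ?_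
  refine (lintegral_sq_le hc.enorm.measurable.aemeasurable).trans ?_
  rw [← lintegral_const_mul _ hg]
  refine lintegral_mono fun t => ?_
  refine (pow_le_pow_left₀ zero_le (enorm_fderiv_apply_le φ _ h) 2).trans ?_
  rw [mul_pow, mul_comm 3, mul_assoc]
  gcongr
  have key : (∑ j, ‖cgrad φ (p + t • h) j‖) ^ 2 ≤ 3 * ∑ j, ‖cgrad φ (p + t • h) j‖ ^ 2 := by
    have := sq_sum_le_card_mul_sum_sq (s := Finset.univ) (f := fun j => ‖cgrad φ (p + t • h) j‖)
    simpa using this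
  have := ENNReal.ofReal_le_ofReal key
  rw [ENNReal.ofReal_pow (by positivity), ENNReal.ofReal_mul (by positivity),
    ENNReal.ofReal_sum_of_nonneg fun _ _ => by positivity,
    ENNReal.ofReal_sum_of_nonneg fun _ _ => by positivity] at this
  simpa [ENNReal.ofReal_pow] using this

theorem enorm_sq_le_of_mem_cell {h : R3} (hh : h ∈ cell) : ‖h‖ₑ ^ 2 ≤ 3 := by
  have h1 : ‖h‖ ^ 2 ≤ 3 := by
    rw [EuclideanSpace.norm_sq_eq]
    calc ∑ i, ‖h i‖ ^ 2 ≤ ∑ _i : Fin 3, (1 : ℝ) := by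
          refine Finset.sum_le_sum fun i _ => ?_
          rw [Real.norm_eq_abs, sq_abs]
          have := hh i
          nlinarith [this.1, this.2]
      _ = 3 := by simp
  have := ENNReal.ofReal_le_ofReal h1
  simpa [ENNReal.ofReal_pow] using this

/-- The Poincaré inequality for smooth periodic functions. -/
theorem IsSmoothPeriodic.poincare {φ : R3 → ℂ} (hφ : IsSmoothPeriodic φ) :
    ∫⁻ p, ‖φ p - ∫ h, φ h ∂vol‖ₑ ^ 2 ∂vol ≤ 9 * ∫⁻ p, ∑ j, ‖cgrad φ p j‖ₑ ^ 2 ∂vol := by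
  set Q : R3 → ℝ≥0∞ := fun p => ∑ j, ‖cgrad φ p j‖ₑ ^ 2
  have hQm : Measurable Q := by
    refine Finset.measurable_fun_sum _ fun j _ => ?_
    exact ((continuous_apply j).comp (hφ.continuous_cgrad)).enorm.measurable.pow_const 2
  have hQp : IsPeriodic Q := hφ.cgrad_periodic.comp fun v => ∑ j, ‖v j‖ₑ ^ 2
  have hint : Integrable φ vol := hφ.memLp.integrable (by norm_num)
  have h1 : ∀ p, ‖φ p - ∫ h, φ h ∂vol‖ₑ ^ 2 ≤ 9 * ∫⁻ h, (∫⁻ t in Icc (0 : ℝ) 1, Q (p + t • h)) ∂vol := by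
    intro p
    -- The deviation from the mean is the mean of the differences, since the cell has measure one.
    have e1 : φ p - ∫ h, φ h ∂vol = ∫ h, (φ p - φ h) ∂vol := by
      rw [integral_sub (integrable_const _) hint]; simp
    rw [e1]
    refine (pow_le_pow_left₀ zero_le (enorm_integral_le_lintegral_enorm _) 2).trans ?_
    refine (lintegral_sq_le (continuous_const.sub hφ.continuous).enorm.measurable.aemeasurable).trans
      ?_
    have hper : IsPeriodic fun h => ‖φ p - φ h‖ₑ ^ 2 := hφ.2.comp fun x => ‖φ p - x‖ₑ ^ 2
    change ∫⁻ h, ‖φ p - φ h‖ₑ ^ 2 ∂vol ≤ _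
    -- Periodicity shifts the variable to `p + h` with `h` still ranging over the cell, where ‖h‖² ≤
    -- 3. This and the factor 3 of the difference estimate give 9.
    rw [← hper.lintegral_add p, ← lintegral_const_mul' _ _ (by simp)]
    refine setLIntegral_mono' measurableSet_cell fun h hh => ?_
    rw [add_comm h p]
    refine (hφ.enorm_sub_sq_le p h).trans ?_
    gcongr
    calc (3 : ℝ≥0∞) * ‖h‖ₑ ^ 2 ≤ 3 * 3 := by gcongr; exact enorm_sq_le_of_mem_cell hh
      _ = 9 := by norm_num
  have hm3 : Measurable fun x : R3 × R3 × ℝ => Q (x.1 + x.2.2 • x.2.1) :=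
    hQm.comp (by fun_prop)
  calc ∫⁻ p, ‖φ p - ∫ h, φ h ∂vol‖ₑ ^ 2 ∂vol
      ≤ ∫⁻ p, 9 * ∫⁻ h, (∫⁻ t in Icc (0 : ℝ) 1, Q (p + t • h)) ∂vol ∂vol := lintegral_mono h1
    _ = 9 * ∫⁻ p, ∫⁻ x : R3 × ℝ, Q (p + x.2 • x.1) ∂(vol.prod (volume.restrict (Icc (0 : ℝ) 1)))
        ∂vol := by
      rw [lintegral_const_mul' _ _ (by simp)]
      congr 1
      refine lintegral_congr fun p => ?_
      have hm : Measurable fun x : R3 × ℝ => Q (p + x.2 • x.1) := hQm.comp (by fun_prop)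
      rw [lintegral_prod _ hm.aemeasurable]
    _ = 9 * ∫⁻ x : R3 × ℝ, ∫⁻ p, Q (p + x.2 • x.1) ∂vol
        ∂(vol.prod (volume.restrict (Icc (0 : ℝ) 1))) := by
      rw [lintegral_lintegral_swap hm3.aemeasurable]
    -- For fixed `h` and `t` the inner integral does not depend on the shift `t • h`, again by
    -- periodicity, and the remaining measure has total mass one.
    _ = 9 * ∫⁻ p, Q p ∂vol := by
      simp only [hQp.lintegral_add]
      rw [lintegral_const, ← univ_prod_univ, Measure.prod_prod]
      simp

/-- The Poincaré inequality for `H¹` limits of smooth periodic functions. -/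
theorem poincare_of_tendsto {f : R3 → ℂ} {G : R3 → Fin 3 → ℂ} (hf : MemLp f 2 vol)
    (hG : MemLp G 2 vol) (h0 : ∫ p, f p ∂vol = 0) {φ : ℕ → R3 → ℂ}
    (hφ : ∀ n, IsSmoothPeriodic (φ n))
    (hc : Tendsto (fun n => sob2 (φ n - f) (cgrad (φ n) - G)) atTop (𝓝 0)) :
    ∫⁻ p, ‖f p‖ₑ ^ 2 ∂vol ≤ 72 * ∫⁻ p, ∑ j, ‖G p j‖ₑ ^ 2 ∂vol := by
  set m : ℕ → ℂ := fun n => ∫ h, φ n h ∂vol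
  have hsub : ∀ n, MemLp (φ n - f) 2 vol := fun n => (hφ n).memLp.sub hf
  have hsubG : ∀ n, MemLp (cgrad (φ n) - G) 2 vol := fun n => (hφ n).cgrad_memLp.sub hG
  -- Since `f` has mean zero, `m n` is also the mean of `φ n - f` and tends to 0.
  have hm : ∀ n, ‖m n‖ₑ ^ 2 ≤ sob2 (φ n - f) (cgrad (φ n) - G) := by
    intro n
    have : m n = ∫ p, (φ n - f) p ∂vol := by
      simp only [Pi.sub_apply]
      rw [integral_sub ((hφ n).memLp.integrable (by norm_num)) (hf.integrable (by norm_num)), h0,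
        sub_zero]
    rw [this]
    refine (pow_le_pow_left₀ zero_le (enorm_integral_le_lintegral_enorm _) 2).trans ?_
    refine (lintegral_sq_le (hsub n).aestronglyMeasurable.enorm).trans ?_
    exact lintegral_mono fun p => le_self_add
  have hGm : ∀ j, AEStronglyMeasurable (fun p => G p j) vol := fun j =>
    (hG.eval j).aestronglyMeasurable
  -- Split `f` into `f - φ n`, `φ n - m n` and `m n`, with weights 2, 4, 4. The smooth Poincaré
  -- constant 9 and the factor 2 from comparing gradients give 72 = 4·9·2, and 78 = 2 + 72 + 4
  -- collects the errors.
  have hbound : ∀ n, ∫⁻ p, ‖f p‖ₑ ^ 2 ∂vol ≤ 72 * ∫⁻ p, ∑ j, ‖G p j‖ₑ ^ 2 ∂vol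
      + 78 * sob2 (φ n - f) (cgrad (φ n) - G) := by
    intro n
    set s := sob2 (φ n - f) (cgrad (φ n) - G)
    have e1 : ∀ p, ‖f p‖ₑ ^ 2 ≤ 2 * ‖(φ n - f) p‖ₑ ^ 2 + (4 * ‖φ n p - m n‖ₑ ^ 2 + 4 * ‖m n‖ₑ ^ 2) := by
      intro p
      have a1 := enorm_add_sq_le (-(φ n - f) p) (φ n p)
      have a2 := enorm_add_sq_le (φ n p - m n) (m n)
      rw [enorm_neg] at a1
      simp only [Pi.sub_apply, neg_sub, sub_add_cancel] at a1 a2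
      refine a1.trans ?_
      simp only [Pi.sub_apply]
      gcongr
      calc 2 * ‖φ n p‖ₑ ^ 2 ≤ 2 * (2 * ‖φ n p - m n‖ₑ ^ 2 + 2 * ‖m n‖ₑ ^ 2) := by gcongr
        _ = _ := by ring
    have e2 : ∫⁻ p, ‖(φ n - f) p‖ₑ ^ 2 ∂vol ≤ s := lintegral_mono fun p => le_self_add
    have e3 : ∫⁻ p, ∑ j, ‖cgrad (φ n) p j‖ₑ ^ 2 ∂vol
        ≤ 2 * s + 2 * ∫⁻ p, ∑ j, ‖G p j‖ₑ ^ 2 ∂vol := by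
      have b1 : ∫⁻ p, ∑ j, ‖(cgrad (φ n) - G) p j‖ₑ ^ 2 ∂vol ≤ s :=
        lintegral_mono fun p => le_add_self
      refine le_trans ?_ (add_le_add_left (mul_le_mul_right b1 2) _)
      rw [← lintegral_const_mul' _ _ (by simp), ← lintegral_const_mul' _ _ (by simp),
        ← lintegral_add_right']
      · refine lintegral_mono fun p => ?_
        rw [Finset.mul_sum, Finset.mul_sum, ← Finset.sum_add_distrib]
        refine Finset.sum_le_sum fun j _ => ?_
        have := enorm_add_sq_le ((cgrad (φ n) - G) p j) (G p j)
        simpa using this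
      · exact (Finset.aemeasurable_fun_sum _ fun j _ => (hGm j).enorm.pow_const 2).const_mul _
    have e4 := (hφ n).poincare
    calc ∫⁻ p, ‖f p‖ₑ ^ 2 ∂vol
        ≤ ∫⁻ p, (2 * ‖(φ n - f) p‖ₑ ^ 2 + (4 * ‖φ n p - m n‖ₑ ^ 2 + 4 * ‖m n‖ₑ ^ 2)) ∂vol :=
          lintegral_mono e1
      _ = 2 * ∫⁻ p, ‖(φ n - f) p‖ₑ ^ 2 ∂vol
          + (4 * ∫⁻ p, ‖φ n p - m n‖ₑ ^ 2 ∂vol + 4 * ‖m n‖ₑ ^ 2) := by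
        rw [lintegral_add_left' ((hsub n).aestronglyMeasurable.enorm.pow_const 2 |>.const_mul _),
          lintegral_const_mul' _ _ (by simp), lintegral_add_right' _ aemeasurable_const,
          lintegral_const_mul' _ _ (by simp)]
        simp
      _ ≤ 2 * s + (4 * (9 * (2 * s + 2 * ∫⁻ p, ∑ j, ‖G p j‖ₑ ^ 2 ∂vol)) + 4 * s) := by
        gcongr
        · exact e4.trans (by gcongr)
        · exact hm n
      _ = _ := by ring
  have hlim : Tendsto (fun n => 72 * ∫⁻ p, ∑ j, ‖G p j‖ₑ ^ 2 ∂vol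
      + 78 * sob2 (φ n - f) (cgrad (φ n) - G)) atTop
      (𝓝 (72 * ∫⁻ p, ∑ j, ‖G p j‖ₑ ^ 2 ∂vol)) := by
    have := (ENNReal.Tendsto.const_mul (a := 78) hc (Or.inr (by simp))).const_add
      (72 * ∫⁻ p, ∑ j, ‖G p j‖ₑ ^ 2 ∂vol)
    simpa using this
  exact ge_of_tendsto' hlim hbound


/-! ### Weak tangential gradients -/

theorem IsSurface.isFiniteMeasure {S : Set R3} (hS : IsSurface S) : IsFiniteMeasure (area S) :=
  ⟨hS.finite_area⟩

/-- The weight against which the `k`-th tangential derivative is tested. -/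
noncomputable def testWeight (τ : Fin 2 → R3 → R3) (Φ : R2 → R3) (η : R2 → ℝ) (w : R2)
    (k : Fin 2) (z : R2) : ℂ :=
  (⟪τ k (Φ z), fderiv ℝ Φ z w⟫ : ℂ) * (η z : ℂ)

theorem IsChart.continuousOn_fderiv {S : Set R3} {U : Set R2} {Φ : R2 → R3}
    (hΦ : IsChart S U Φ) (w : R2) : ContinuousOn (fun z => fderiv ℝ Φ z w) U :=
  (hΦ.contDiffOn.continuousOn_fderiv_of_isOpen hΦ.isOpen (by simp)).clm_apply continuousOn_const

/-- The frame vectors have length one almost everywhere, so the weight is bounded by the continuous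
functions `DΦ w` and `η` on the compact support. -/
theorem IsTangentFrame.testWeight_bound {S : Set R3} {τ : Fin 2 → R3 → R3}
    (hτ : IsTangentFrame S τ) {U : Set R2} {Φ : R2 → R3} (hΦ : IsChart S U Φ) {η : R2 → ℝ}
    (hη : ContDiff ℝ ∞ η) (hηc : HasCompactSupport η) (hηU : tsupport η ⊆ U) (w : R2)
    (k : Fin 2) :
    AEStronglyMeasurable (testWeight τ Φ η w k) (volume.restrict (tsupport η)) ∧
    ∃ M : ℝ≥0, ∀ᵐ z ∂volume.restrict (tsupport η), ‖testWeight τ Φ η w k z‖₊ ≤ M := by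
  have hK : IsCompact (tsupport η) := hηc
  have hDc := (hΦ.continuousOn_fderiv w).mono hηU
  have hDm : AEStronglyMeasurable (fun z => fderiv ℝ Φ z w) (volume.restrict (tsupport η)) :=
    hDc.aestronglyMeasurable hK.measurableSet
  have hτm := hΦ.aestronglyMeasurable_comp hK hηU (hτ.aestronglyMeasurable k)
  refine ⟨?_, ?_⟩
  · exact (Complex.continuous_ofReal.comp_aestronglyMeasurable (hτm.inner hDm)).mul
      (Complex.continuous_ofReal.comp hη.continuous).aestronglyMeasurable
  · obtain ⟨M, hM⟩ := hK.exists_bound_of_continuousOn hDc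
    obtain ⟨M', hM'⟩ := hK.exists_bound_of_continuousOn hη.continuous.continuousOn
    refine ⟨M.toNNReal * M'.toNNReal, ?_⟩
    filter_upwards [hΦ.ae_comp hK hηU hτ.orthonormal, ae_restrict_mem hK.measurableSet]
      with z h1 h2
    rw [← NNReal.coe_le_coe]
    push_cast
    rw [testWeight, norm_mul, Complex.norm_real, Complex.norm_real]
    have h3 : ‖⟪τ k (Φ z), fderiv ℝ Φ z w⟫‖ ≤ ‖fderiv ℝ Φ z w‖ := by
      have := norm_inner_le_norm (𝕜 := ℝ) (τ k (Φ z)) (fderiv ℝ Φ z w)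
      rwa [h1.1 k, one_mul] at this
    exact mul_le_mul (h3.trans ((hM z h2).trans (Real.le_coe_toNNReal M)))
      ((hM' z h2).trans (Real.le_coe_toNNReal M')) (norm_nonneg _) (by positivity)

theorem IsSurface.integrableOn_comp {S : Set R3} (hS : IsSurface S) {U : Set R2} {Φ : R2 → R3}
    (hΦ : IsChart S U Φ) {K : Set R2} (hK : IsCompact K) (hKU : K ⊆ U) {g : R3 → Fin 2 → ℂ}
    (hg : MemLp g 2 (area S)) (k : Fin 2) : IntegrableOn (fun z => g (Φ z) k) K := by
  have := hS.isFiniteMeasure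
  have hgk : Integrable (fun p => g p k) (area S) := (hg.eval k).integrable (by norm_num)
  obtain ⟨C, hC⟩ := hΦ.exists_lintegral_le hK hKU
  exact ⟨hΦ.aestronglyMeasurable_comp hK hKU hgk.1,
    (hC _ hgk.1.enorm).trans_lt (ENNReal.mul_lt_top (by simp) hgk.2)⟩

/-- The defining identity of weak tangential derivatives, on the support of the test function. -/
theorem weakTangential_identity_iff {S : Set R3} (hS : IsSurface S) {τ : Fin 2 → R3 → R3}
    (hτ : IsTangentFrame S τ) {U : Set R2} {Φ : R2 → R3} (hΦ : IsChart S U Φ) {η : R2 → ℝ}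
    (hη : ContDiff ℝ ∞ η) (hηc : HasCompactSupport η) (hηU : tsupport η ⊆ U) (w : R2)
    {u : R3 → ℂ} {g : R3 → Fin 2 → ℂ} (hg : MemLp g 2 (area S)) :
    (∫ z in U, u (Φ z) * (fderiv ℝ η z w : ℂ)
        = -∫ z in U, (∑ k, g (Φ z) k * (⟪τ k (Φ z), fderiv ℝ Φ z w⟫ : ℂ)) * (η z : ℂ)) ↔
      ∫ z in tsupport η, u (Φ z) * (fderiv ℝ η z w : ℂ)
        = -∑ k, ∫ z in tsupport η, g (Φ z) k * testWeight τ Φ η w k z := by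
  have hK : IsCompact (tsupport η) := hηc
  rw [setIntegral_eq_of_subset_of_forall_sdiff_eq_zero hΦ.isOpen.measurableSet hηU (fun z hz => ?_),
    setIntegral_eq_of_subset_of_forall_sdiff_eq_zero hΦ.isOpen.measurableSet hηU (fun z hz => ?_),
    ← integral_finsetSum _ fun k _ => ?_]
  · simp only [Finset.sum_mul, testWeight, mul_assoc]
  · obtain ⟨h1, M, hM⟩ := hτ.testWeight_bound hΦ hη hηc hηU w k
    exact (hS.integrableOn_comp hΦ hK hηU hg k).mul_bdd (c := M) h1 hM
  · simp [image_eq_zero_of_notMem_tsupport hz.2]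
  · have : fderiv ℝ η z = 0 :=
      image_eq_zero_of_notMem_tsupport fun h => hz.2 (tsupport_fderiv_subset ℝ h)
    simp [this]

/-- For a trace the local integrability demanded by the definition is automatic from the trace
inequality. What remains is an identity over the compact support of `η`, where every factor is
integrable or bounded. -/
theorem hasWeakTangentialGrad_iff {S : Set R3} (hS : IsSurface S) {τ : Fin 2 → R3 → R3}
    (hτ : IsTangentFrame S τ) {f : R3 → ℂ} {G : R3 → Fin 3 → ℂ} (hf : MemLp f 2 vol)
    (hG : MemLp G 2 vol) {u : R3 → ℂ} (hu : IsTrace S f G u) {g : R3 → Fin 2 → ℂ}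
    (hg : MemLp g 2 (area S)) :
    HasWeakTangentialGrad S τ u g ↔ ∀ (U : Set R2) (Φ : R2 → R3), IsChart S U Φ →
      ∀ η : R2 → ℝ, ContDiff ℝ ∞ η → HasCompactSupport η → tsupport η ⊆ U → ∀ w : R2,
      ∫ z in tsupport η, u (Φ z) * (fderiv ℝ η z w : ℂ)
        = -∑ k, ∫ z in tsupport η, g (Φ z) k * testWeight τ Φ η w k z := by
  constructor
  · intro h U Φ hΦ η hη hηc hηU w
    exact (weakTangential_identity_iff hS hτ hΦ hη hηc hηU w hg).1 ((h U Φ hΦ).2 η hη hηc hηU w)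
  · intro h U Φ hΦ
    refine ⟨?_, fun η hη hηc hηU w =>
      (weakTangential_identity_iff hS hτ hΦ hη hηc hηU w hg).2 (h U Φ hΦ η hη hηc hηU w)⟩
    exact (locallyIntegrableOn_iff hΦ.isOpen.isLocallyClosed).2 fun K hKU hK =>
      hu.integrableOn hf hG hΦ hK hKU

theorem exists_bound_fderiv {η : R2 → ℝ} (hη : ContDiff ℝ ∞ η) (hηc : HasCompactSupport η)
    (w : R2) : AEStronglyMeasurable (fun z => (fderiv ℝ η z w : ℂ)) (volume.restrict (tsupport η)) ∧
      ∃ M : ℝ≥0, ∀ᵐ z ∂volume.restrict (tsupport η), ‖(fderiv ℝ η z w : ℂ)‖₊ ≤ M := by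
  have hdc : Continuous fun z => fderiv ℝ η z w :=
    (hη.continuous_fderiv (by simp)).clm_apply continuous_const
  have hK : IsCompact (tsupport η) := hηc
  refine ⟨(Complex.continuous_ofReal.comp hdc).aestronglyMeasurable, ?_⟩
  obtain ⟨M, hM⟩ := hK.exists_bound_of_continuousOn hdc.continuousOn
  refine ⟨M.toNNReal, ae_restrict_of_forall_mem hK.measurableSet fun p hp => ?_⟩
  rw [← NNReal.coe_le_coe]
  simpa using Or.inl (hM p hp)

/-! ### Vector space structure -/

/-- Constructor of elements of `H`; the weak gradient comes with the trace. -/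
noncomputable def H.ofTrace {S : Set R3} {τ : Fin 2 → R3 → R3} (f : R3 → ℂ) (G : R3 → Fin 3 → ℂ)
    (g : R3 → Fin 2 → ℂ) (hfp : IsPeriodic f) (hGp : IsPeriodic G) (hf : MemLp f 2 vol)
    (hG : MemLp G 2 vol) (hg : MemLp g 2 (area S))
    (h : ∃ u, IsTrace S f G u ∧ HasWeakTangentialGrad S τ u g) : H S τ where
  val := f
  grad := G
  tgrad := g
  val_periodic := hfp
  grad_periodic := hGp
  val_memLp := hf
  grad_memLp := hG
  hasWeakGrad := by
    obtain ⟨u, hu, -⟩ := h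
    obtain ⟨φ, hφ, hc, -⟩ := (isTrace_iff hf hG).1 hu
    exact hasWeakGrad_of_tendsto hf hG hfp hGp hφ hc
  tgrad_memLp := hg
  exists_trace := h

/-- Linear operations on `H` are expressed as existence statements on the data `val`, `grad` and
`tgrad`. The vector space structure is used only after passing to L² classes of the derivatives. -/
theorem H.exists_add {S : Set R3} (hS : IsSurface S) {τ : Fin 2 → R3 → R3}
    (hτ : IsTangentFrame S τ) (h h' : H S τ) :
    ∃ k : H S τ, k.val = h.val + h'.val ∧ k.grad = h.grad + h'.grad ∧
      k.tgrad = h.tgrad + h'.tgrad := by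
  refine ⟨H.ofTrace (h.val + h'.val) (h.grad + h'.grad) (h.tgrad + h'.tgrad)
    (fun p i => by simp [h.val_periodic p i, h'.val_periodic p i])
    (fun p i => by simp [h.grad_periodic p i, h'.grad_periodic p i])
    (h.val_memLp.add h'.val_memLp) (h.grad_memLp.add h'.grad_memLp)
    (h.tgrad_memLp.add h'.tgrad_memLp) ?_, rfl, rfl, rfl⟩
  obtain ⟨u, hu, hu'⟩ := h.exists_trace
  obtain ⟨v, hv, hv'⟩ := h'.exists_trace
  have huv := hu.add h.val_memLp h.grad_memLp h'.val_memLp h'.grad_memLp hv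
  refine ⟨u + v, huv, ?_⟩
  rw [hasWeakTangentialGrad_iff hS hτ h.val_memLp h.grad_memLp hu h.tgrad_memLp] at hu'
  rw [hasWeakTangentialGrad_iff hS hτ h'.val_memLp h'.grad_memLp hv h'.tgrad_memLp] at hv'
  rw [hasWeakTangentialGrad_iff hS hτ (h.val_memLp.add h'.val_memLp)
    (h.grad_memLp.add h'.grad_memLp) huv (h.tgrad_memLp.add h'.tgrad_memLp)]
  intro U Φ hΦ η hη hηc hηU w
  have hK : IsCompact (tsupport η) := hηc
  obtain ⟨hd1, M, hM⟩ := exists_bound_fderiv hη hηc w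
  simp only [Pi.add_apply, add_mul]
  rw [integral_add ((hu.integrableOn h.val_memLp h.grad_memLp hΦ hK hηU).mul_bdd (c := M) hd1 hM)
    ((hv.integrableOn h'.val_memLp h'.grad_memLp hΦ hK hηU).mul_bdd (c := M) hd1 hM),
    hu' U Φ hΦ η hη hηc hηU w, hv' U Φ hΦ η hη hηc hηU w, ← neg_add, ← Finset.sum_add_distrib]
  congr 1
  refine Finset.sum_congr rfl fun k _ => ?_
  obtain ⟨h1, M', hM'⟩ := hτ.testWeight_bound hΦ hη hηc hηU w k
  rw [integral_add ((hS.integrableOn_comp hΦ hK hηU h.tgrad_memLp k).mul_bdd (c := M') h1 hM')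
    ((hS.integrableOn_comp hΦ hK hηU h'.tgrad_memLp k).mul_bdd (c := M') h1 hM')]

theorem H.exists_smul {S : Set R3} (hS : IsSurface S) {τ : Fin 2 → R3 → R3}
    (hτ : IsTangentFrame S τ) (c : ℂ) (h : H S τ) :
    ∃ k : H S τ, k.val = c • h.val ∧ k.grad = c • h.grad ∧ k.tgrad = c • h.tgrad := by
  refine ⟨H.ofTrace (c • h.val) (c • h.grad) (c • h.tgrad)
    (fun p i => by simp [h.val_periodic p i]) (fun p i => by simp [h.grad_periodic p i])
    (h.val_memLp.const_smul c) (h.grad_memLp.const_smul c) (h.tgrad_memLp.const_smul c) ?_,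
    rfl, rfl, rfl⟩
  obtain ⟨u, hu, hu'⟩ := h.exists_trace
  have hcu := hu.const_smul h.val_memLp h.grad_memLp c
  refine ⟨c • u, hcu, ?_⟩
  rw [hasWeakTangentialGrad_iff hS hτ h.val_memLp h.grad_memLp hu h.tgrad_memLp] at hu'
  rw [hasWeakTangentialGrad_iff hS hτ (h.val_memLp.const_smul c) (h.grad_memLp.const_smul c) hcu
    (h.tgrad_memLp.const_smul c)]
  intro U Φ hΦ η hη hηc hηU w
  simp only [Pi.smul_apply, smul_eq_mul, mul_assoc]
  simp only [integral_const_mul]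
  rw [hu' U Φ hΦ η hη hηc hηU w, ← Finset.mul_sum, mul_neg]

theorem H.exists_const {S : Set R3} (hS : IsSurface S) {τ : Fin 2 → R3 → R3}
    (hτ : IsTangentFrame S τ) (c : ℂ) :
    ∃ k : H S τ, k.val = (fun _ => c) ∧ k.grad = 0 ∧ k.tgrad = 0 := by
  have hc := isSmoothPeriodic_const c
  have htr : IsTrace S (fun _ => c) 0 fun _ => c := by
    refine (isTrace_iff hc.memLp MemLp.zero).2 ⟨fun _ _ => c, fun _ => hc, ?_,
      Eventually.of_forall fun p => tendsto_const_nhds⟩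
    simp [sob2, cgrad_const]
  refine ⟨H.ofTrace (fun _ => c) 0 0 (fun _ _ => rfl) (fun _ _ => rfl) hc.memLp MemLp.zero
    MemLp.zero ⟨fun _ => c, htr, ?_⟩, rfl, rfl, rfl⟩
  rw [hasWeakTangentialGrad_iff hS hτ hc.memLp MemLp.zero htr MemLp.zero]
  intro U Φ hΦ η hη hηc hηU w
  have hsupp : tsupport (fun z => fderiv ℝ η z w) ⊆ tsupport η := by
    refine closure_minimal (fun z hz => tsupport_fderiv_subset ℝ (f := η) (subset_closure ?_))
      (isClosed_tsupport η)
    intro h0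
    exact hz (by simp [h0])
  -- Integration by parts against the constant 1.
  have h0 : ∫ z, fderiv ℝ η z w = 0 := by
    have := integral_mul_fderiv_eq_neg_fderiv_mul_of_integrable (μ := (volume : Measure R2))
      (𝕜 := ℝ) (f := fun _ => (1 : ℝ)) (g := η) (v := w) (by simp) ?_ ?_ (fun p _ => by simp)
      (fun p _ => hη.differentiable (by simp) p)
    · simpa using this
    · simp only [one_mul]
      exact ((hη.continuous_fderiv (by simp)).clm_apply continuous_const).integrable_of_hasCompactSupport
        (hηc.mono' ((subset_tsupport _).trans hsupp))
    · simpa using hη.continuous.integrable_of_hasCompactSupport hηc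
  have h1 : ∫ z in tsupport η, fderiv ℝ η z w = 0 := by
    rw [setIntegral_eq_integral_of_forall_compl_eq_zero, h0]
    exact fun z hz => image_eq_zero_of_notMem_tsupport (f := fun z => fderiv ℝ η z w)
      fun h => hz (hsupp h)
  rw [integral_const_mul, integral_complex_ofReal, h1]
  simp

/-! ### Completeness -/

theorem sob2_congr {f f' : R3 → ℂ} {G G' : R3 → Fin 3 → ℂ} (hf : f =ᵐ[vol] f')
    (hG : G =ᵐ[vol] G') : sob2 f G = sob2 f' G' := by
  refine lintegral_congr_ae ?_
  filter_upwards [hf, hG] with p h1 h2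
  rw [h1, h2]

/-- A diagonal sequence of smooth functions approximates the limit, so the limit has a trace. The
trace inequality applied to differences makes the given traces converge to it in L¹ of each chart,
and the tangential identity passes to the limit. For the tangential derivatives L¹ convergence
suffices. -/
theorem IsSurface.exists_H_of_tendsto {S : Set R3} (hS : IsSurface S) {τ : Fin 2 → R3 → R3}
    (hτ : IsTangentFrame S τ) (h : ℕ → H S τ) {f : R3 → ℂ} {G : R3 → Fin 3 → ℂ}
    {g : R3 → Fin 2 → ℂ} (hf : MemLp f 2 vol) (hG : MemLp G 2 vol) (hg : MemLp g 2 (area S))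
    (hc : Tendsto (fun n => sob2 ((h n).val - f) ((h n).grad - G)) atTop (𝓝 0))
    (hgc : ∀ k, Tendsto (fun n => ∫⁻ p, ‖(h n).tgrad p k - g p k‖ₑ ∂area S) atTop (𝓝 0)) :
    ∃ h' : H S τ, h'.val =ᵐ[vol] f ∧ h'.grad =ᵐ[vol] G ∧ h'.tgrad = g := by
  -- The limits are meaningful only almost everywhere on the cell; their periodic extensions are the
  -- exactly periodic representatives that `H` requires.
  have hfe := periodize_ae_eq f
  have hGe := periodize_ae_eq G
  set f₀ := periodize f
  set G₀ := periodize G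
  have hf₀ : MemLp f₀ 2 vol := hf.ae_eq hfe.symm
  have hG₀ : MemLp G₀ 2 vol := hG.ae_eq hGe.symm
  have hc₀ : Tendsto (fun n => sob2 ((h n).val - f₀) ((h n).grad - G₀)) atTop (𝓝 0) :=
    hc.congr fun n => sob2_congr ((ae_eq_refl _).sub hfe.symm) ((ae_eq_refl _).sub hGe.symm)
  choose u hu hu' using fun n => (h n).exists_trace
  -- One smooth function for each `h n`, close enough that the diagonal sequence has the same limit.
  have happ : ∀ n, ∃ φ, IsSmoothPeriodic φ ∧
      sob2 (φ - (h n).val) (cgrad φ - (h n).grad) < ((n : ℝ≥0∞) + 1)⁻¹ := by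
    intro n
    obtain ⟨φ, hφ, hφc, -⟩ := (isTrace_iff (h n).val_memLp (h n).grad_memLp).1 (hu n)
    obtain ⟨m, hm⟩ := (hφc.eventually_lt_const
      (ENNReal.inv_pos.2 (by finiteness) : (0 : ℝ≥0∞) < ((n : ℝ≥0∞) + 1)⁻¹)).exists
    exact ⟨φ m, hφ m, hm⟩
  choose φ hφ hφc using happ
  have hφ0 : Tendsto (fun n => sob2 (φ n - (h n).val) (cgrad (φ n) - (h n).grad)) atTop (𝓝 0) := by
    have h1 : Tendsto (fun n : ℕ => ((n : ℝ≥0∞) + 1)⁻¹) atTop (𝓝 0) := by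
      have := (ENNReal.tendsto_inv_nat_nhds_zero).comp (tendsto_add_atTop_nat 1)
      simpa [Function.comp_def] using this
    exact tendsto_of_tendsto_of_tendsto_of_le_of_le tendsto_const_nhds h1 (fun _ => zero_le)
      fun n => (hφc n).le
  have hφf : Tendsto (fun n => sob2 (φ n - f₀) (cgrad (φ n) - G₀)) atTop (𝓝 0) := by
    have h0 := (ENNReal.Tendsto.const_mul (a := 2) hφ0 (Or.inr (by simp))).add
        (ENNReal.Tendsto.const_mul (a := 2) hc₀ (Or.inr (by simp)))
    simp only [mul_zero, add_zero] at h0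
    refine tendsto_of_tendsto_of_tendsto_of_le_of_le tendsto_const_nhds h0 (fun _ => zero_le)
      fun n => ?_
    have := sob2_add_le (g := (h n).val - f₀) (G := (h n).grad - G₀)
      ((hφ n).memLp.sub (h n).val_memLp).aestronglyMeasurable
      ((hφ n).cgrad_memLp.sub (h n).grad_memLp).aestronglyMeasurable
    rwa [sub_add_sub_cancel, sub_add_sub_cancel] at this
  obtain ⟨v, hv⟩ := hS.exists_isTrace hf₀ hG₀ hφ hφf
  refine ⟨H.ofTrace f₀ G₀ g (isPeriodic_periodize _) (isPeriodic_periodize _) hf₀ hG₀ hg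
    ⟨v, hv, ?_⟩, hfe, hGe, rfl⟩
  rw [hasWeakTangentialGrad_iff hS hτ hf₀ hG₀ hv hg]
  intro U Φ hΦ η hη hηc hηU w
  have hK : IsCompact (tsupport η) := hηc
  have hc1 := tendsto_sob1_of_sob2 (fun n => ((h n).val_memLp.sub hf₀).aestronglyMeasurable)
      (fun n => ((h n).grad_memLp.sub hG₀).aestronglyMeasurable) hc₀
  -- The function `u n - v` is a trace of the difference between `h n` and the limit, so the trace
  -- inequality bounds its L¹ norm over the support of `η`.
  have hL : Tendsto (fun n => ∫ z in tsupport η, u n (Φ z) * (fderiv ℝ η z w : ℂ)) atTop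
      (𝓝 (∫ z in tsupport η, v (Φ z) * (fderiv ℝ η z w : ℂ))) := by
    obtain ⟨hd1, M, hM⟩ := exists_bound_fderiv hη hηc w
    refine tendsto_integral_mul_of_bound
      (fun n => (hu n).integrableOn (h n).val_memLp (h n).grad_memLp hΦ hK hηU)
      (hv.integrableOn hf₀ hG₀ hΦ hK hηU) hd1 hM ?_
    obtain ⟨C, hC⟩ := hΦ.exists_isTrace_le hK hηU
    have h0 : Tendsto (fun n => (C : ℝ≥0∞) * sob1 ((h n).val - f₀) ((h n).grad - G₀)) atTop
        (𝓝 0) := by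
      simpa using ENNReal.Tendsto.const_mul (a := (C : ℝ≥0∞)) hc1 (Or.inr (by simp))
    refine tendsto_of_tendsto_of_tendsto_of_le_of_le tendsto_const_nhds h0 (fun _ => zero_le)
      fun n => ?_
    have hneg := hv.const_smul hf₀ hG₀ (-1)
    have hsub := (hu n).add (h n).val_memLp (h n).grad_memLp (hf₀.const_smul (-1 : ℂ))
      (hG₀.const_smul (-1 : ℂ)) hneg
    simp only [neg_smul, one_smul, ← sub_eq_add_neg] at hsub
    exact hC _ _ _ ((h n).val_memLp.sub hf₀) ((h n).grad_memLp.sub hG₀) hsub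
  have hR : ∀ k, Tendsto (fun n => ∫ z in tsupport η, (h n).tgrad (Φ z) k * testWeight τ Φ η w k z)
      atTop (𝓝 (∫ z in tsupport η, g (Φ z) k * testWeight τ Φ η w k z)) := by
    intro k
    obtain ⟨h1, M, hM⟩ := hτ.testWeight_bound hΦ hη hηc hηU w k
    refine tendsto_integral_mul_of_bound
      (fun n => hS.integrableOn_comp hΦ hK hηU (h n).tgrad_memLp k)
      (hS.integrableOn_comp hΦ hK hηU hg k) h1 hM ?_
    obtain ⟨C, hC⟩ := hΦ.exists_lintegral_le hK hηU
    have h0 : Tendsto (fun n => (C : ℝ≥0∞) * ∫⁻ p, ‖(h n).tgrad p k - g p k‖ₑ ∂area S) atTop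
        (𝓝 0) := by
      simpa using ENNReal.Tendsto.const_mul (a := (C : ℝ≥0∞)) (hgc k) (Or.inr (by simp))
    refine tendsto_of_tendsto_of_tendsto_of_le_of_le tendsto_const_nhds h0 (fun _ => zero_le)
      fun n => ?_
    exact hC (fun p => ‖(h n).tgrad p k - g p k‖ₑ)
      (((h n).tgrad_memLp.eval k).sub (hg.eval k)).aestronglyMeasurable.enorm
  have hR' := (tendsto_finsetSum Finset.univ fun k _ => hR k).neg
  refine tendsto_nhds_unique hL (hR'.congr fun n => ?_)
  exact ((hasWeakTangentialGrad_iff hS hτ (h n).val_memLp (h n).grad_memLp (hu n)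
    (h n).tgrad_memLp).1 (hu' n) U Φ hΦ η hη hηc hηU w).symm


/-! ### The deformation is bi-Lipschitz -/

theorem MemD.exists_lipschitzOnWith_deform {S : Set R3} {q : R3 → R3} (hq : MemD S q) :
    ∃ K : ℝ≥0, 1 ≤ K ∧ LipschitzOnWith K (deform q) cell := by
  obtain ⟨L, hL⟩ := hq.lipschitz
  exact ⟨1 + L, le_self_add, (LipschitzWith.id.lipschitzOnWith (s := cell)).add hL⟩

theorem MemD.continuousOn_deform {S : Set R3} {q : R3 → R3} (hq : MemD S q) :
    ContinuousOn (deform q) cell := by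
  obtain ⟨K, -, hK⟩ := hq.exists_lipschitzOnWith_deform
  exact hK.continuousOn

theorem ae_mem_interior_cell : ∀ᵐ p ∂vol, p ∈ interior cell := by
  have h : ∀ᵐ p ∂vol, p ∉ frontier cell :=
    ae_restrict_of_ae (measure_eq_zero_iff_ae_notMem.1 (convex_cell.addHaar_frontier volume))
  filter_upwards [h, ae_restrict_mem measurableSet_cell] with p h1 h2
  by_contra h3
  exact h1 ⟨subset_closure h2, h3⟩

theorem MemD.ae_differentiableAt {S : Set R3} {q : R3 → R3} (hq : MemD S q) :
    ∀ᵐ p ∂vol, DifferentiableAt ℝ q p := by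
  obtain ⟨L, hL⟩ := hq.lipschitz
  filter_upwards [hL.ae_differentiableWithinAt measurableSet_cell (μ := volume),
    ae_mem_interior_cell] with p h1 h2
  exact h1.differentiableAt (mem_interior_iff_mem_nhds.1 h2)

theorem det_one_add_fderiv (q : R3 → R3) (p : R3) :
    (ContinuousLinearMap.id ℝ R3 + fderiv ℝ q p).det = J q p := by
  let b := (EuclideanSpace.basisFun (Fin 3) ℝ).toBasis
  have h : LinearMap.toMatrix b b
      ((ContinuousLinearMap.id ℝ R3 + fderiv ℝ q p : R3 →L[ℝ] R3) : R3 →ₗ[ℝ] R3) = F q p := by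
    ext i j
    simp [LinearMap.toMatrix_apply, b, F, e, Matrix.one_apply]
  rw [J, ← h, LinearMap.det_toMatrix]

theorem measurable_F (q : R3 → R3) (i j : Fin 3) : Measurable fun p => F q p i j := by
  have h : Measurable fun p => fderiv ℝ q p (e j) i :=
    (EuclideanSpace.proj i : R3 →L[ℝ] ℝ).continuous.measurable.comp
      (measurable_fderiv_apply_const ℝ q (e j))
  exact measurable_const.add h

theorem measurable_J (q : R3 → R3) : Measurable (J q) := by
  unfold J
  simp only [Matrix.det_fin_three]
  have h := measurable_F q
  fun_prop

theorem MemD.measurableSet_inter_preimage {S : Set R3} {q : R3 → R3} (hq : MemD S q)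
    {T : Set R3} (hT : MeasurableSet T) : MeasurableSet (cell ∩ deform q ⁻¹' T) := by
  have h1 : Measurable (cell.domRestrict (deform q)) :=
    hq.continuousOn_deform.domRestrict.measurable
  have h2 := measurableSet_cell.subtype_image (h1 hT)
  convert h2 using 1
  ext p
  simp [and_comm]

/-- Rademacher's theorem makes the deformation differentiable almost everywhere. The change of
variables formula for injective maps then shows that volumes of subsets of the cell shrink at most
by the factor δ. -/
theorem MemD.volume_preimage_le {S : Set R3} {q : R3 → R3} (hq : MemD S q)
    (hbij : BijOn (deform q) cell cell) {δ : ℝ} (hJ : ∀ᵐ p ∂vol, δ ≤ J q p)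
    {T : Set R3} (hT : MeasurableSet T) :
    ENNReal.ofReal δ * volume (cell ∩ deform q ⁻¹' T) ≤ volume T := by
  set D := {p | DifferentiableAt ℝ q p}
  set s := (cell ∩ deform q ⁻¹' T) ∩ (D ∩ {p | δ ≤ J q p})
  have hDm : MeasurableSet (D ∩ {p | δ ≤ J q p}) :=
    (measurableSet_of_differentiableAt ℝ q).inter
      (measurableSet_le measurable_const (measurable_J q))
  have hsm : MeasurableSet s := (hq.measurableSet_inter_preimage hT).inter hDm
  have hvs : volume (cell ∩ deform q ⁻¹' T) ≤ volume s := by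
    refine measure_mono_ae ?_
    have h1 := hq.ae_differentiableAt.and hJ
    rw [vol, ae_restrict_iff' measurableSet_cell] at h1
    filter_upwards [h1] with p hp hp2
    exact ⟨hp2, hp hp2.1⟩
  have hder : ∀ p ∈ s, HasFDerivWithinAt (deform q)
      (ContinuousLinearMap.id ℝ R3 + fderiv ℝ q p) s p := fun p hp =>
    ((hasFDerivAt_id p).add hp.2.1.hasFDerivAt).hasFDerivWithinAt
  have hinj : InjOn (deform q) s := hbij.injOn.mono fun p hp => hp.1.1
  have harea := lintegral_abs_det_fderiv_eq_addHaar_image volume hsm hder hinj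
  calc ENNReal.ofReal δ * volume (cell ∩ deform q ⁻¹' T)
      ≤ ENNReal.ofReal δ * volume s := by gcongr
    _ = ∫⁻ _ in s, ENNReal.ofReal δ := by simp
    _ ≤ ∫⁻ p in s, ENNReal.ofReal |(ContinuousLinearMap.id ℝ R3 + fderiv ℝ q p).det| := by
      refine setLIntegral_mono' hsm fun p hp => ?_
      rw [det_one_add_fderiv]
      exact ENNReal.ofReal_le_ofReal (le_trans hp.2.2 (le_abs_self _))
    _ = volume (deform q '' s) := harea
    _ ≤ volume T := by
      refine measure_mono ?_
      rintro _ ⟨p, hp, rfl⟩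
      exact hp.1.2

theorem dist_le_of_mem_cell {x y : R3} (hx : x ∈ cell) (hy : y ∈ cell) : dist x y < 2 := by
  have h : dist x y ^ 2 ≤ 3 := by
    rw [EuclideanSpace.dist_eq, Real.sq_sqrt (by positivity)]
    calc ∑ i, dist (x i) (y i) ^ 2 ≤ ∑ _i : Fin 3, (1 : ℝ) := by
          refine Finset.sum_le_sum fun i _ => ?_
          rw [Real.dist_eq, sq_abs]
          have h1 := hx i
          have h2 := hy i
          nlinarith [h1.1, h1.2, h2.1, h2.2]
      _ = 3 := by simp
  nlinarith [dist_nonneg (x := x) (y := y)]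

/-- The cell is convex with diameter less than 2, so its contraction by ρ/2 towards `x` stays in the
cell and inside the ball. This gives a uniform bound even at corners. -/
theorem volume_ball_inter_cell_ge {x : R3} (hx : x ∈ cell) {ρ : ℝ} (hρ : 0 < ρ) (hρ2 : ρ ≤ 2) :
    ENNReal.ofReal ((ρ / 2) ^ 3) ≤ volume (cell ∩ Metric.ball x ρ) := by
  have h := Measure.addHaar_image_homothety (volume : Measure R3) x (ρ / 2) cell
  rw [volume_cell, mul_one, finrank_euclideanSpace, Fintype.card_fin,
    abs_of_nonneg (by positivity)] at h
  rw [← h]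
  refine measure_mono ?_
  rintro _ ⟨p, hp, rfl⟩
  constructor
  · rw [AffineMap.homothety_eq_lineMap]
    exact convex_cell.lineMap_mem hx hp ⟨by positivity, by linarith⟩
  · rw [Metric.mem_ball, AffineMap.homothety_eq_lineMap, dist_lineMap_left, Real.norm_eq_abs,
      abs_of_pos (by positivity)]
    have := dist_le_of_mem_cell hx hp
    nlinarith

/-- Points on a curve in the cell. -/
theorem MemD.exists_dist_eq {S : Set R3} {q : R3 → R3} (hq : MemD S q)
    (hbij : BijOn (deform q) cell cell) {a b : R3} (ha : a ∈ cell) (hb : b ∈ cell) {t : ℝ}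
    (ht : t ∈ Icc 0 (dist a b)) : ∃ x ∈ cell, dist x a = t ∧
      dist (deform q x) (deform q a) ≤ dist (deform q a) (deform q b) := by
  -- A continuous bijection of the compact cell is a homeomorphism, so the segment between the two
  -- images has a preimage curve from `a` to `b`.
  have : CompactSpace cell := isCompact_iff_compactSpace.1 isCompact_cell
  let E : cell ≃ cell := hbij.equiv (deform q)
  have hE : Continuous E := (hq.continuousOn_deform.domRestrict).subtype_mk _
  let Hm : cell ≃ₜ cell := hE.homeoOfEquivCompactToT2
  have hHm : ∀ x : cell, ((Hm x : cell) : R3) = deform q x := fun x => rfl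
  let c : unitInterval → cell := fun s =>
    ⟨AffineMap.lineMap (deform q a) (deform q b) (s : ℝ),
      convex_cell.lineMap_mem (hbij.mapsTo ha) (hbij.mapsTo hb) s.2⟩
  have hc : Continuous c := by
    refine Continuous.subtype_mk ?_ _
    exact AffineMap.lineMap_continuous.comp continuous_subtype_val
  let γ : unitInterval → R3 := fun s => (Hm.symm (c s) : cell)
  have hγ : Continuous γ := continuous_subtype_val.comp (Hm.symm.continuous.comp hc)
  have hγd : ∀ s, deform q (γ s) = AffineMap.lineMap (deform q a) (deform q b) (s : ℝ) := by
    intro s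
    rw [← hHm, Hm.apply_symm_apply]
  have hγm : ∀ s, γ s ∈ cell := fun s => (Hm.symm (c s)).2
  have h0 : γ 0 = a := hbij.injOn (hγm 0) ha (by rw [hγd]; simp)
  have h1 : γ 1 = b := hbij.injOn (hγm 1) hb (by rw [hγd]; simp)
  -- The distance to `a` along the curve takes every value between 0 and `dist a b`.
  have hIVT := intermediate_value_univ 0 1 (hγ.dist (continuous_const (y := a)))
  rw [h0, h1, dist_self, dist_comm b a] at hIVT
  obtain ⟨s, hs⟩ := hIVT ht
  refine ⟨γ s, hγm s, hs, ?_⟩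
  rw [hγd, dist_lineMap_left, Real.norm_eq_abs, abs_of_nonneg s.2.1]
  exact mul_le_of_le_one_left dist_nonneg s.2.2

/-- This is a packing argument. If `a` and `b` were far apart compared with the distance `s` of
their images, the preimage curve of the segment joining the images would carry many well separated
points. Small disjoint balls around them map into a ball of radius 2s about the image of `a`, and by
the determinant bound the preimage of that ball has volume at most a multiple of s³. Hence the
number of points is bounded independently of `a` and `b`. -/
theorem MemD.exists_antilipschitz {S : Set R3} {q : R3 → R3} (hq : MemD S q)
    (hbij : BijOn (deform q) cell cell) {δ : ℝ} (hδ : 0 < δ) (hJ : ∀ᵐ p ∂vol, δ ≤ J q p) :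
    ∃ C : ℝ≥0, 0 < C ∧ ∀ a ∈ cell, ∀ b ∈ cell,
      dist a b ≤ C * dist (deform q a) (deform q b) := by
  obtain ⟨K, hK1, hK⟩ := hq.exists_lipschitzOnWith_deform
  have hK1' : (1 : ℝ) ≤ K := by exact_mod_cast hK1
  have hKpos : (0 : ℝ) < K := by linarith
  set κ : ℝ := (volume (Metric.ball (0 : R3) 1)).toReal
  have hκ : volume (Metric.ball (0 : R3) 1) = ENNReal.ofReal κ :=
    (ENNReal.ofReal_toReal measure_ball_lt_top.ne).symm
  have hκ0 : 0 ≤ κ := ENNReal.toReal_nonneg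
  -- Here 64κK³/δ bounds the number `n` of balls, and r < (n + 1)·2ρ with ρ = s/K.
  set c : ℝ := 2 / K * (64 * κ * K ^ 3 / δ + 1)
  have hc : 0 < c := by positivity
  refine ⟨⟨c, hc.le⟩, by exact_mod_cast hc, fun a ha b hb => ?_⟩
  change dist a b ≤ c * _
  set s := dist (deform q a) (deform q b)
  rcases eq_or_ne a b with rfl | hab
  · simp [s]
  have hs : 0 < s := dist_pos.2 fun h => hab (hbij.injOn ha hb h)
  have hs2 : s < 2 := dist_le_of_mem_cell (hbij.mapsTo ha) (hbij.mapsTo hb)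
  -- With this radius the `K`-Lipschitz deformation sends each ball into a ball of radius `s`.
  set ρ := s / K
  have hρ : 0 < ρ := by positivity
  have hρ2 : ρ ≤ 2 := (div_le_self hs.le hK1').trans hs2.le
  have hρs : K * ρ = s := by simp only [ρ]; field_simp
  set r := dist a b
  set n := ⌊r / (2 * ρ)⌋₊
  have hn : (n : ℝ) * (2 * ρ) ≤ r := by
    have := Nat.floor_le (a := r / (2 * ρ)) (by positivity)
    rwa [le_div_iff₀ (by positivity)] at this
  have hn' : r < (n + 1) * (2 * ρ) := by
    have := Nat.lt_floor_add_one (r / (2 * ρ))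
    rwa [div_lt_iff₀ (by positivity)] at this
  have hpts : ∀ k : Fin n, ∃ x ∈ cell, dist x a = k * (2 * ρ) ∧
      dist (deform q x) (deform q a) ≤ s := fun k => by
    refine hq.exists_dist_eq hbij ha hb ⟨by positivity, le_trans ?_ hn⟩
    have : ((k : ℕ) : ℝ) ≤ n := by exact_mod_cast k.2.le
    gcongr
  choose x hxm hxa hxs using hpts
  -- The distances of the centres to `a` differ by at least 2ρ, hence so do the centres from each
  -- other.
  have hdisj : Pairwise (Function.onFun Disjoint fun k => cell ∩ Metric.ball (x k) ρ) := by
    intro k l hkl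
    refine (Metric.ball_disjoint_ball ?_).mono inter_subset_right inter_subset_right
    have h1 : (1 : ℝ) ≤ |(k : ℝ) - l| := by
      have h2 : ((k : ℕ) : ℤ) - (l : ℕ) ≠ 0 := by
        intro h; apply hkl; ext; omega
      have := Int.one_le_abs h2
      exact_mod_cast this
    have h3 : |dist (x k) a - dist (x l) a| ≤ dist (x k) (x l) := abs_dist_sub_le _ _ _
    rw [hxa, hxa, ← sub_mul, abs_mul, abs_of_pos (by positivity : 0 < 2 * ρ)] at h3
    nlinarith
  have hsub : (⋃ k, cell ∩ Metric.ball (x k) ρ) ⊆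
      cell ∩ deform q ⁻¹' Metric.closedBall (deform q a) (2 * s) := by
    refine iUnion_subset fun k p hp => ⟨hp.1, ?_⟩
    rw [mem_preimage, Metric.mem_closedBall]
    have h1 := hK.dist_le_mul p hp.1 (x k) (hxm k)
    have h2 : K * dist p (x k) ≤ s := by
      rw [← hρs]
      exact mul_le_mul_of_nonneg_left (Metric.mem_ball.1 hp.2).le hKpos.le
    linarith [dist_triangle (deform q p) (deform q (x k)) (deform q a), hxs k]
  have hvol : (n : ℝ≥0∞) * ENNReal.ofReal ((ρ / 2) ^ 3)
      ≤ volume (cell ∩ deform q ⁻¹' Metric.closedBall (deform q a) (2 * s)) := by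
    refine le_trans ?_ (measure_mono hsub)
    rw [measure_iUnion hdisj fun k => measurableSet_cell.inter Metric.isOpen_ball.measurableSet,
      tsum_fintype]
    calc (n : ℝ≥0∞) * ENNReal.ofReal ((ρ / 2) ^ 3)
        = ∑ _k : Fin n, ENNReal.ofReal ((ρ / 2) ^ 3) := by simp
      _ ≤ _ := Finset.sum_le_sum fun k _ => volume_ball_inter_cell_ge (hxm k) hρ hρ2
  have hle := hq.volume_preimage_le hbij hJ (T := Metric.closedBall (deform q a) (2 * s))
    Metric.isClosed_closedBall.measurableSet
  rw [Measure.addHaar_closedBall _ _ (by positivity), finrank_euclideanSpace, Fintype.card_fin, hκ,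
    ← ENNReal.ofReal_mul (by positivity)] at hle
  have h1 : ENNReal.ofReal (δ * (n * (ρ / 2) ^ 3)) ≤ ENNReal.ofReal ((2 * s) ^ 3 * κ) := by
    rw [ENNReal.ofReal_mul hδ.le, ENNReal.ofReal_mul (by positivity), ENNReal.ofReal_natCast]
    exact (mul_le_mul_right hvol _).trans hle
  rw [ENNReal.ofReal_le_ofReal_iff (by positivity)] at h1
  -- The factor 64 is 8·8, from (2s)³ = 8K³ρ³ and (ρ/2)³ = ρ³/8.
  have h2 : (n : ℝ) ≤ 64 * κ * K ^ 3 / δ := by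
    rw [le_div_iff₀ hδ]
    rw [← hρs] at h1
    have h3 : (n * δ) * ρ ^ 3 ≤ (64 * κ * K ^ 3) * ρ ^ 3 := by nlinarith
    exact le_of_mul_le_mul_right h3 (by positivity)
  calc r ≤ (n + 1) * (2 * ρ) := hn'.le
    _ ≤ (64 * κ * K ^ 3 / δ + 1) * (2 * ρ) := by gcongr
    _ = c * s := by simp only [c, ρ]; ring

/-! ### Null sets under the deformation -/

theorem MemD.aemeasurable_deform {S : Set R3} {q : R3 → R3} (hq : MemD S q) :
    AEMeasurable (deform q) vol :=
  hq.continuousOn_deform.aemeasurable measurableSet_cell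

/-- Preimages of null sets are null by the volume bound. This is what allows almost everywhere
bounds on ε to be composed with the deformation. -/
theorem MemD.map_vol_absolutelyContinuous {S : Set R3} {q : R3 → R3} (hq : MemD S q)
    (hbij : BijOn (deform q) cell cell) {δ : ℝ} (hδ : 0 < δ) (hJ : ∀ᵐ p ∂vol, δ ≤ J q p) :
    vol.map (deform q) ≪ vol := by
  refine Measure.AbsolutelyContinuous.mk fun T hT h0 => ?_
  rw [Measure.map_apply_of_aemeasurable hq.aemeasurable_deform hT, vol,
    Measure.restrict_apply' measurableSet_cell, inter_comm]
  rw [vol, Measure.restrict_apply hT] at h0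
  have h1 := hq.volume_preimage_le hbij hJ (hT.inter measurableSet_cell)
  rw [h0, nonpos_iff_eq_zero, mul_eq_zero] at h1
  refine measure_mono_null ?_ (h1.resolve_left (by simpa using hδ))
  exact fun p hp => ⟨hp.1, hp.2, hbij.mapsTo hp.1⟩

theorem MemD.aemeasurable_deform_area {S : Set R3} (hS : IsSurface S) {q : R3 → R3}
    (hq : MemD S q) : AEMeasurable (deform q) (area S) :=
  (hq.continuousOn_deform.mono hS.subset_cell).aemeasurable hS.measurableSet

/-- A set of area zero in the deformed surface is carried back by the Lipschitz inverse, which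
preserves two-dimensional null sets. The volume bound alone would not see the surface. -/
theorem MemD.map_area_absolutelyContinuous {S : Set R3} (hS : IsSurface S) {q : R3 → R3}
    (hq : MemD S q) (hbij : BijOn (deform q) cell cell) {δ : ℝ} (hδ : 0 < δ)
    (hJ : ∀ᵐ p ∂vol, δ ≤ J q p) : (area S).map (deform q) ≪ area (deform q '' S) := by
  obtain ⟨C, -, hC⟩ := hq.exists_antilipschitz hbij hδ hJ
  refine Measure.AbsolutelyContinuous.mk fun T hT h0 => ?_
  rw [Measure.map_apply_of_aemeasurable (hq.aemeasurable_deform_area hS) hT, area,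
    Measure.restrict_apply' hS.measurableSet]
  rw [area, Measure.restrict_apply hT] at h0
  have hg : ∀ x ∈ cell, Function.invFunOn (deform q) cell (deform q x) = x :=
    fun x hx => hbij.injOn.leftInvOn_invFunOn hx
  have hL : LipschitzOnWith C (Function.invFunOn (deform q) cell) (T ∩ deform q '' S) := by
    refine LipschitzOnWith.of_dist_le_mul ?_
    rintro _ ⟨-, ⟨a, ha, rfl⟩⟩ _ ⟨-, ⟨b, hb, rfl⟩⟩
    rw [hg a (hS.subset_cell ha), hg b (hS.subset_cell hb)]
    exact hC a (hS.subset_cell ha) b (hS.subset_cell hb)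
  have h1 := euclideanHausdorffMeasure_image_le 2 hL
  rw [h0, mul_zero, nonpos_iff_eq_zero] at h1
  refine measure_mono_null ?_ h1
  rintro p ⟨hp1, hp2⟩
  exact ⟨deform q p, ⟨hp1, mem_image_of_mem _ hp2⟩, hg p (hS.subset_cell hp2)⟩


/-! ### Bounded matrix fields -/

/-- Essentially bounded measurable matrix fields. -/
structure IsBddMatrix {α ι κ : Type*} [MeasurableSpace α] (μ : Measure α)
    (M : α → Matrix ι κ ℂ) : Prop where
  aesm : ∀ i j, AEStronglyMeasurable (fun p => M p i j) μ
  bdd : ∃ C : ℝ, 0 ≤ C ∧ ∀ᵐ p ∂μ, ∀ i j, ‖M p i j‖ ≤ C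

section Matrix

variable {α ι κ l : Type*} [MeasurableSpace α] {μ : Measure α}

theorem IsBddMatrix.mul [Fintype κ] {M : α → Matrix ι κ ℂ} {N : α → Matrix κ l ℂ}
    (hM : IsBddMatrix μ M) (hN : IsBddMatrix μ N) : IsBddMatrix μ fun p => M p * N p := by
  obtain ⟨C, hC0, hC⟩ := hM.bdd
  obtain ⟨C', hC0', hC'⟩ := hN.bdd
  refine ⟨fun i j => ?_, Fintype.card κ * (C * C'), by positivity, ?_⟩
  · simp only [Matrix.mul_apply]
    exact Finset.aestronglyMeasurable_fun_sum _ fun k _ => (hM.aesm i k).mul (hN.aesm k j)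
  · filter_upwards [hC, hC'] with p h1 h2 i j
    rw [Matrix.mul_apply]
    refine (norm_sum_le _ _).trans ?_
    calc ∑ k, ‖M p i k * N p k j‖ ≤ ∑ _k : κ, C * C' := by
          refine Finset.sum_le_sum fun k _ => ?_
          rw [norm_mul]
          exact mul_le_mul (h1 i k) (h2 k j) (norm_nonneg _) hC0
      _ = _ := by simp

theorem IsBddMatrix.transpose {M : α → Matrix ι κ ℂ} (hM : IsBddMatrix μ M) :
    IsBddMatrix μ fun p => (M p).transpose :=
  ⟨fun i j => hM.aesm j i, hM.bdd.imp fun _ h => ⟨h.1, h.2.mono fun _ hp i j => hp j i⟩⟩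

theorem IsBddMatrix.smul {M : α → Matrix ι κ ℂ} (hM : IsBddMatrix μ M) {f : α → ℂ}
    (hf : AEStronglyMeasurable f μ) {C' : ℝ} (hC' : ∀ᵐ p ∂μ, ‖f p‖ ≤ C') :
    IsBddMatrix μ fun p => f p • M p := by
  obtain ⟨C, hC0, hC⟩ := hM.bdd
  refine ⟨fun i j => hf.mul (hM.aesm i j), |C'| * C, by positivity, ?_⟩
  filter_upwards [hC, hC'] with p h1 h2 i j
  rw [Matrix.smul_apply, smul_eq_mul, norm_mul]
  exact mul_le_mul (h2.trans (le_abs_self _)) (h1 i j) (norm_nonneg _) (abs_nonneg _)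

variable [Fintype ι] [Fintype κ]

theorem IsBddMatrix.exists_mulVec_le {M : α → Matrix ι κ ℂ} (hM : IsBddMatrix μ M) :
    ∃ C : ℝ, 0 ≤ C ∧ ∀ᵐ p ∂μ, ∀ v : κ → ℂ,
      ∑ i, ‖(M p).mulVec v i‖ ^ 2 ≤ C * ∑ j, ‖v j‖ ^ 2 := by
  obtain ⟨C, hC0, hC⟩ := hM.bdd
  refine ⟨Fintype.card ι * (C ^ 2 * Fintype.card κ), by positivity, ?_⟩
  filter_upwards [hC] with p hp v
  calc ∑ i, ‖(M p).mulVec v i‖ ^ 2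
      ≤ ∑ _i : ι, C ^ 2 * (Fintype.card κ * ∑ j, ‖v j‖ ^ 2) := by
        refine Finset.sum_le_sum fun i _ => ?_
        have h1 : ‖(M p).mulVec v i‖ ≤ C * ∑ j, ‖v j‖ := by
          rw [Matrix.mulVec, dotProduct, Finset.mul_sum]
          refine (norm_sum_le _ _).trans (Finset.sum_le_sum fun j _ => ?_)
          rw [norm_mul]
          exact mul_le_mul_of_nonneg_right (hp i j) (norm_nonneg _)
        have h2 : (∑ j, ‖v j‖) ^ 2 ≤ Fintype.card κ * ∑ j, ‖v j‖ ^ 2 := by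
          simpa using sq_sum_le_card_mul_sum_sq (s := Finset.univ) (f := fun j => ‖v j‖)
        calc ‖(M p).mulVec v i‖ ^ 2 ≤ (C * ∑ j, ‖v j‖) ^ 2 := by gcongr
          _ = C ^ 2 * (∑ j, ‖v j‖) ^ 2 := by ring
          _ ≤ _ := by gcongr
    _ = _ := by simp; ring

theorem IsBddMatrix.memLp_mulVec {M : α → Matrix ι κ ℂ} (hM : IsBddMatrix μ M) {f : α → κ → ℂ}
    (hf : MemLp f 2 μ) : MemLp (fun p => (M p).mulVec (f p)) 2 μ := by
  obtain ⟨C, hC0, hC⟩ := hM.bdd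
  refine MemLp.of_eval fun i => ?_
  simp only [Matrix.mulVec, dotProduct]
  refine memLp_finsetSum _ fun j _ => ?_
  refine (hf.eval j).of_le_mul (c := C) ((hM.aesm i j).mul (hf.eval j).aestronglyMeasurable) ?_
  filter_upwards [hC] with p hp
  rw [norm_mul]
  exact mul_le_mul_of_nonneg_right (hp i j) (norm_nonneg _)

theorem integrable_dotProduct_star {f g : α → ι → ℂ} (hf : MemLp f 2 μ) (hg : MemLp g 2 μ) :
    Integrable (fun p => dotProduct (f p) (star (g p))) μ := by
  simp only [dotProduct]
  refine integrable_finsetSum _ fun i _ => ?_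
  exact (hf.eval i).integrable_mul (hg.eval i).star

theorem integrable_sum_norm_sq {f : α → ι → ℂ} (hf : MemLp f 2 μ) :
    Integrable (fun p => ∑ i, ‖f p i‖ ^ 2) μ :=
  integrable_finsetSum _ fun i _ => (hf.eval i).integrable_norm_pow two_ne_zero

theorem IsBddMatrix.exists_integral_mulVec_le {M : α → Matrix ι κ ℂ} (hM : IsBddMatrix μ M) :
    ∃ C : ℝ, 0 ≤ C ∧ ∀ f : α → κ → ℂ, MemLp f 2 μ →
      ∫ p, ∑ i, ‖(M p).mulVec (f p) i‖ ^ 2 ∂μ ≤ C * ∫ p, ∑ j, ‖f p j‖ ^ 2 ∂μ := by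
  obtain ⟨C, hC0, hC⟩ := hM.exists_mulVec_le
  refine ⟨C, hC0, fun f hf => ?_⟩
  rw [← integral_const_mul]
  refine integral_mono_ae (integrable_sum_norm_sq (hM.memLp_mulVec hf))
    ((integrable_sum_norm_sq hf).const_mul _) ?_
  filter_upwards [hC] with p hp using hp _

/-! ### Square integrable fields as elements of a Hilbert space -/

/-- Square integrable `ℂ^ι`-valued fields. -/
noncomputable abbrev L2Field (ι : Type*) [Fintype ι] (μ : Measure α) := Lp (EuclideanSpace ℂ ι) 2 μ

theorem memLp_toLp2 {f : α → ι → ℂ} (hf : MemLp f 2 μ) :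
    MemLp (fun p => (WithLp.toLp 2 (f p) : EuclideanSpace ℂ ι)) 2 μ :=
  ContinuousLinearMap.comp_memLp'
    ((PiLp.continuousLinearEquiv 2 ℂ fun _ : ι => ℂ).symm : (ι → ℂ) →L[ℂ] EuclideanSpace ℂ ι) hf

theorem memLp_ofLp2 {f : α → EuclideanSpace ℂ ι} (hf : MemLp f 2 μ) :
    MemLp (fun p => (f p).ofLp) 2 μ :=
  ContinuousLinearMap.comp_memLp'
    ((PiLp.continuousLinearEquiv 2 ℂ fun _ : ι => ℂ) : EuclideanSpace ℂ ι →L[ℂ] (ι → ℂ)) hf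

/-- The class of a square integrable field. -/
noncomputable def toL2 {f : α → ι → ℂ} (hf : MemLp f 2 μ) : L2Field ι μ :=
  (memLp_toLp2 hf).toLp _

theorem toL2_ae {f : α → ι → ℂ} (hf : MemLp f 2 μ) : ∀ᵐ p ∂μ, (toL2 hf p).ofLp = f p := by
  filter_upwards [(memLp_toLp2 hf).coeFn_toLp] with p hp
  rw [toL2, hp]

theorem memLp_coe (x : L2Field ι μ) : MemLp (fun p => (x p).ofLp) 2 μ := memLp_ofLp2 (Lp.memLp x)

theorem toL2_eq {f : α → ι → ℂ} (hf : MemLp f 2 μ) {x : L2Field ι μ}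
    (h : ∀ᵐ p ∂μ, f p = (x p).ofLp) : toL2 hf = x := by
  refine Lp.ext ?_
  filter_upwards [toL2_ae hf, h] with p h1 h2
  ext i
  rw [h1, h2]

/-- The fields are treated as a real Hilbert space, so only the real part of the sesquilinear
pairing appears. This suits coercivity, which is a statement about real parts. -/
theorem inner_L2Field (x y : L2Field ι μ) :
    ⟪x, y⟫ = ∫ p, (dotProduct (x p).ofLp (star (y p).ofLp)).re ∂μ := by
  rw [real_inner_comm, L2.inner_def]
  refine integral_congr_ae (Eventually.of_forall fun p => ?_)
  simp [PiLp.inner_apply, dotProduct]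

theorem norm_sq_L2Field (x : L2Field ι μ) : ‖x‖ ^ 2 = ∫ p, ∑ i, ‖(x p).ofLp i‖ ^ 2 ∂μ := by
  rw [← real_inner_self_eq_norm_sq, inner_L2Field]
  refine integral_congr_ae (Eventually.of_forall fun p => ?_)
  simp only [dotProduct, Pi.star_apply, Complex.re_sum, RCLike.star_def, Complex.mul_conj]
  refine Finset.sum_congr rfl fun i _ => ?_
  rw [Complex.ofReal_re, Complex.normSq_eq_norm_sq]

/-- Multiplication by a bounded matrix field. -/
noncomputable def mulL2 {M : α → Matrix ι ι ℂ} (hM : IsBddMatrix μ M) :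
    L2Field ι μ →L[ℝ] L2Field ι μ :=
  LinearMap.mkContinuousOfExistsBound
    { toFun := fun x => toL2 (hM.memLp_mulVec (memLp_coe x))
      map_add' := fun x y => by
        refine toL2_eq _ ?_
        filter_upwards [toL2_ae (hM.memLp_mulVec (memLp_coe x)),
          toL2_ae (hM.memLp_mulVec (memLp_coe y)), Lp.coeFn_add x y,
          Lp.coeFn_add (toL2 (hM.memLp_mulVec (memLp_coe x)))
            (toL2 (hM.memLp_mulVec (memLp_coe y)))] with p h1 h2 h3 h4
        rw [h3, h4, Pi.add_apply, Pi.add_apply, WithLp.ofLp_add, WithLp.ofLp_add, h1, h2,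
          Matrix.mulVec_add]
      map_smul' := fun c x => by
        refine toL2_eq _ ?_
        filter_upwards [toL2_ae (hM.memLp_mulVec (memLp_coe x)), Lp.coeFn_smul c x,
          Lp.coeFn_smul c (toL2 (hM.memLp_mulVec (memLp_coe x)))] with p h1 h2 h3
        rw [RingHom.id_apply, h2, h3, Pi.smul_apply, Pi.smul_apply, WithLp.ofLp_smul,
          WithLp.ofLp_smul, h1, Matrix.mulVec_smul] }
    (by
      obtain ⟨C, hC0, hC⟩ := hM.exists_mulVec_le
      refine ⟨Real.sqrt C, fun x => ?_⟩
      refine Lp.norm_le_mul_norm_of_ae_le_mul ?_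
      filter_upwards [toL2_ae (hM.memLp_mulVec (memLp_coe x)), hC] with p h1 h2
      refine le_of_sq_le_sq ?_ (by positivity)
      rw [mul_pow, Real.sq_sqrt hC0, EuclideanSpace.norm_sq_eq, EuclideanSpace.norm_sq_eq]
      have := h2 (x p).ofLp
      rw [← h1] at this
      exact this)

theorem mulL2_ae {M : α → Matrix ι ι ℂ} (hM : IsBddMatrix μ M) (x : L2Field ι μ) :
    ∀ᵐ p ∂μ, (mulL2 hM x p).ofLp = (M p).mulVec (x p).ofLp :=
  toL2_ae (hM.memLp_mulVec (memLp_coe x))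

theorem inner_mulL2_ge {M : α → Matrix ι ι ℂ} (hM : IsBddMatrix μ M) {c : ℝ}
    (hc : ∀ᵐ p ∂μ, ∀ v : ι → ℂ, c * ∑ i, ‖v i‖ ^ 2 ≤ (dotProduct ((M p).mulVec v) (star v)).re)
    (x : L2Field ι μ) : c * ‖x‖ ^ 2 ≤ ⟪mulL2 hM x, x⟫ := by
  rw [norm_sq_L2Field, inner_L2Field, ← integral_const_mul]
  refine integral_mono_ae ((integrable_sum_norm_sq (memLp_coe x)).const_mul _)
    (integrable_dotProduct_star (memLp_coe _) (memLp_coe x)).re ?_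
  filter_upwards [hc, mulL2_ae hM x] with p h1 h2
  rw [h2]
  exact h1 _

end Matrix

/-- The Lax-Milgram theorem with an estimate, on a closed subspace. -/
theorem exists_laxMilgram {X : Type*} [NormedAddCommGroup X] [InnerProductSpace ℝ X]
    [CompleteSpace X] (T : X →L[ℝ] X) {c : ℝ} (hc : 0 < c)
    (hT : ∀ x, c * ‖x‖ ^ 2 ≤ ⟪T x, x⟫) (V : Submodule ℝ X) (hV : IsClosed (V : Set X)) (ρ : X) :
    ∃ v ∈ V, (∀ w ∈ V, ⟪T v + ρ, w⟫ = 0) ∧ c * ‖v‖ ≤ ‖ρ‖ := by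
  have : CompleteSpace V := hV.completeSpace_coe
  let B : V →L[ℝ] V →L[ℝ] ℝ := ((innerSL ℝ).comp T).bilinearComp V.subtypeL V.subtypeL
  have hB : ∀ v w : V, B v w = ⟪T v, (w : X)⟫ := fun v w => rfl
  have hco : IsCoercive B := ⟨c, hc, fun v => by
    rw [hB, mul_assoc, ← sq]; exact hT v⟩
  let ℓ : V →L[ℝ] ℝ := -((innerSL ℝ ρ).comp V.subtypeL)
  let f : V := (InnerProductSpace.toDual ℝ V).symm ℓ
  let v : V := hco.continuousLinearEquivOfBilin.symm f
  have hv : ∀ w : V, ⟪T v + ρ, (w : X)⟫ = 0 := by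
    intro w
    have h1 := hco.continuousLinearEquivOfBilin_apply v w
    rw [ContinuousLinearEquiv.apply_symm_apply, hB] at h1
    have h2 : ⟪f, w⟫ = ℓ w := InnerProductSpace.toDual_symm_apply
    have h3 : ℓ w = -⟪ρ, (w : X)⟫ := rfl
    rw [inner_add_left, ← h1, h2, h3, neg_add_cancel]
  refine ⟨v, v.2, fun w hw => hv ⟨w, hw⟩, ?_⟩
  have h1 := hv v
  have h2 := hT v
  rw [inner_add_left] at h1
  have h3 : -⟪ρ, (v : X)⟫ ≤ ‖ρ‖ * ‖(v : X)‖ := by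
    have := neg_abs_le ⟪ρ, (v : X)⟫
    have := abs_real_inner_le_norm ρ (v : X)
    linarith
  -- Testing with `v` itself gives c‖v‖² ≤ ‖ρ‖‖v‖; one factor cancels unless `v` is zero.
  rcases (norm_nonneg (v : X)).eq_or_lt with h0 | h0
  · rw [← h0, mul_zero]; exact norm_nonneg _
  · have h4 : (c * ‖(v : X)‖) * ‖(v : X)‖ ≤ ‖ρ‖ * ‖(v : X)‖ := by nlinarith
    exact le_of_mul_le_mul_right h4 h0


/-! ### The weak problem on `H` -/

theorem H.exists_mean_zero {S : Set R3} (hS : IsSurface S) {τ : Fin 2 → R3 → R3}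
    (hτ : IsTangentFrame S τ) (h : H S τ) :
    ∃ k : H S τ, (∫ p, k.val p ∂vol) = 0 ∧ k.val = (fun p => h.val p - ∫ p, h.val p ∂vol) ∧
      k.grad = h.grad ∧ k.tgrad = h.tgrad := by
  obtain ⟨c, hc1, hc2, hc3⟩ := H.exists_const hS hτ (-∫ p, h.val p ∂vol)
  obtain ⟨k, hk1, hk2, hk3⟩ := H.exists_add hS hτ h c
  have hk : k.val = fun p => h.val p - ∫ p, h.val p ∂vol := by
    rw [hk1, hc1]; funext p; simp [sub_eq_add_neg]
  refine ⟨k, ?_, hk, by rw [hk2, hc2, add_zero], by rw [hk3, hc3, add_zero]⟩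
  rw [hk, integral_sub (h.val_memLp.integrable (by norm_num)) (integrable_const _)]
  simp

theorem H.exists_sub {S : Set R3} (hS : IsSurface S) {τ : Fin 2 → R3 → R3}
    (hτ : IsTangentFrame S τ) (h h' : H S τ) :
    ∃ k : H S τ, k.val = h.val - h'.val ∧ k.grad = h.grad - h'.grad ∧
      k.tgrad = h.tgrad - h'.tgrad := by
  obtain ⟨c, hc1, hc2, hc3⟩ := H.exists_smul hS hτ (-1) h'
  obtain ⟨k, hk1, hk2, hk3⟩ := H.exists_add hS hτ h c
  refine ⟨k, ?_, ?_, ?_⟩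
  · rw [hk1, hc1, neg_one_smul, sub_eq_add_neg]
  · rw [hk2, hc2, neg_one_smul, sub_eq_add_neg]
  · rw [hk3, hc3, neg_one_smul, sub_eq_add_neg]

theorem ofReal_integral_sum_norm_sq {α ι : Type*} [MeasurableSpace α] {μ : Measure α} [Fintype ι]
    {f : α → ι → ℂ} (hf : MemLp f 2 μ) :
    ENNReal.ofReal (∫ p, ∑ i, ‖f p i‖ ^ 2 ∂μ) = ∫⁻ p, ∑ i, ‖f p i‖ₑ ^ 2 ∂μ := by
  rw [ofReal_integral_eq_lintegral_ofReal (integrable_sum_norm_sq hf)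
    (Eventually.of_forall fun p => by positivity)]
  refine lintegral_congr fun p => ?_
  rw [ENNReal.ofReal_sum_of_nonneg fun _ _ => by positivity]
  simp [ENNReal.ofReal_pow]

theorem memLp_unit {α : Type*} [MeasurableSpace α] {μ : Measure α} {f : α → ℂ} (hf : MemLp f 2 μ) :
    MemLp (fun p (_ : Unit) => f p) 2 μ := MemLp.of_eval fun _ => hf

/-- The Poincaré inequality on `H`. -/
theorem H.poincare {S : Set R3} {τ : Fin 2 → R3 → R3} (h : H S τ) (h0 : ∫ p, h.val p ∂vol = 0) :
    ∫ p, ‖h.val p‖ ^ 2 ∂vol ≤ 72 * ∫ p, ∑ j, ‖h.grad p j‖ ^ 2 ∂vol := by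
  obtain ⟨u, hu, -⟩ := h.exists_trace
  obtain ⟨φ, hφ, hc, -⟩ := (isTrace_iff h.val_memLp h.grad_memLp).1 hu
  have h1 := poincare_of_tendsto h.val_memLp h.grad_memLp h0 hφ hc
  have h2 := ofReal_integral_sum_norm_sq (memLp_unit h.val_memLp)
  simp only [Finset.univ_unique, Finset.sum_singleton] at h2
  have h3 : (72 : ℝ≥0∞) = ENNReal.ofReal 72 := by simp
  rw [← h2, ← ofReal_integral_sum_norm_sq h.grad_memLp, h3,
    ← ENNReal.ofReal_mul (by norm_num), ENNReal.ofReal_le_ofReal_iff] at h1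
  · exact h1
  · exact mul_nonneg (by norm_num) (integral_nonneg fun p => by positivity)

/-! ### Gradient fields as a closed subspace of a Hilbert space. -/

theorem norm_toL2_sub_sq {α ι : Type*} [MeasurableSpace α] {μ : Measure α} [Fintype ι]
    {f : α → ι → ℂ} (hf : MemLp f 2 μ) (x : L2Field ι μ) :
    ‖toL2 hf - x‖ ^ 2 = ∫ p, ∑ i, ‖f p i - (x p).ofLp i‖ ^ 2 ∂μ := by
  rw [norm_sq_L2Field]
  refine integral_congr_ae ?_
  filter_upwards [toL2_ae hf, Lp.coeFn_sub (toL2 hf) x] with p h1 h2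
  rw [h2, Pi.sub_apply, WithLp.ofLp_sub, h1]
  rfl

theorem norm_toL2_sq {α ι : Type*} [MeasurableSpace α] {μ : Measure α} [Fintype ι]
    {f : α → ι → ℂ} (hf : MemLp f 2 μ) :
    ‖toL2 hf‖ ^ 2 = ∫ p, ∑ i, ‖f p i‖ ^ 2 ∂μ := by
  rw [norm_sq_L2Field]
  refine integral_congr_ae ?_
  filter_upwards [toL2_ae hf] with p h1
  rw [h1]

theorem lintegral_enorm_apply_le {α ι : Type*} [MeasurableSpace α] {μ : Measure α} [Fintype ι]
    (x : L2Field ι μ) (i : ι) :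
    ∫⁻ p, ‖(x p).ofLp i‖ₑ ∂μ ≤ ‖x‖ₑ * μ univ ^ (1 / 2 : ℝ) := by
  have h := eLpNorm_le_eLpNorm_mul_rpow_measure_univ (μ := μ) (f := x) (p := 1) (q := 2)
    (by norm_num) (Lp.aestronglyMeasurable x)
  rw [eLpNorm_one_eq_lintegral_enorm, ← Lp.enorm_def] at h
  norm_num at h ⊢
  refine le_trans (lintegral_mono fun p => ?_) h
  exact enorm_le_iff_norm_le.2 (PiLp.norm_apply_le (x p) i)

/-- The Hilbert space of pairs of square integrable fields. -/
noncomputable abbrev FieldPair (S : Set R3) :=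
  WithLp 2 (L2Field (Fin 3) vol × L2Field (Fin 2) (area S))

/-- `x` consists of the gradient and the tangential derivatives of `h`. -/
def Represents {S : Set R3} {τ : Fin 2 → R3 → R3} (h : H S τ) (x : FieldPair S) : Prop :=
  (∀ᵐ p ∂vol, h.grad p = (x.fst p).ofLp) ∧ ∀ᵐ p ∂area S, h.tgrad p = (x.snd p).ofLp

/-- The pair of fields given by an element of `H`. -/
noncomputable def H.pair {S : Set R3} {τ : Fin 2 → R3 → R3} (h : H S τ) : FieldPair S :=
  WithLp.toLp 2 (toL2 h.grad_memLp, toL2 h.tgrad_memLp)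

theorem represents_iff {S : Set R3} {τ : Fin 2 → R3 → R3} {h : H S τ} {x : FieldPair S} :
    Represents h x ↔ h.pair = x := by
  constructor
  · rintro ⟨h1, h2⟩
    have e1 := toL2_eq h.grad_memLp h1
    have e2 := toL2_eq h.tgrad_memLp h2
    unfold H.pair
    rw [e1, e2]
    rfl
  · rintro rfl
    refine ⟨?_, ?_⟩
    · filter_upwards [toL2_ae h.grad_memLp] with p hp using hp.symm
    · filter_upwards [toL2_ae h.tgrad_memLp] with p hp using hp.symm

/-- The space of gradients of elements of `H`. -/
noncomputable def gradSpace {S : Set R3} (hS : IsSurface S) {τ : Fin 2 → R3 → R3}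
    (hτ : IsTangentFrame S τ) : Submodule ℝ (FieldPair S) where
  carrier := {x | ∃ h : H S τ, Represents h x}
  zero_mem' := by
    obtain ⟨c, -, hc2, hc3⟩ := H.exists_const hS hτ 0
    refine ⟨c, ?_, ?_⟩
    · filter_upwards [Lp.coeFn_zero (EuclideanSpace ℂ (Fin 3)) 2 vol] with p hp
      change _ = ((0 : L2Field (Fin 3) vol) p).ofLp
      rw [hp, hc2]; rfl
    · filter_upwards [Lp.coeFn_zero (EuclideanSpace ℂ (Fin 2)) 2 (area S)] with p hp
      change _ = ((0 : L2Field (Fin 2) (area S)) p).ofLp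
      rw [hp, hc3]; rfl
  add_mem' := by
    rintro x y ⟨h, hx1, hx2⟩ ⟨k, hy1, hy2⟩
    obtain ⟨l, -, hl2, hl3⟩ := H.exists_add hS hτ h k
    refine ⟨l, ?_, ?_⟩
    · filter_upwards [Lp.coeFn_add x.fst y.fst, hx1, hy1] with p hp h1 h2
      change _ = ((x.fst + y.fst) p).ofLp
      rw [hp, hl2, Pi.add_apply, h1, h2]; rfl
    · filter_upwards [Lp.coeFn_add x.snd y.snd, hx2, hy2] with p hp h1 h2
      change _ = ((x.snd + y.snd) p).ofLp
      rw [hp, hl3, Pi.add_apply, h1, h2]; rfl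
  smul_mem' := by
    rintro c x ⟨h, hx1, hx2⟩
    obtain ⟨l, -, hl2, hl3⟩ := H.exists_smul hS hτ (c : ℂ) h
    refine ⟨l, ?_, ?_⟩
    · filter_upwards [Lp.coeFn_smul c x.fst, hx1] with p hp h1
      change _ = ((c • x.fst) p).ofLp
      rw [hp, hl2, Pi.smul_apply, h1]
      ext i
      simp
    · filter_upwards [Lp.coeFn_smul c x.snd, hx2] with p hp h1
      change _ = ((c • x.snd) p).ofLp
      rw [hp, hl3, Pi.smul_apply, h1]
      ext i
      simp

/-- Representatives are normalised to mean zero. The Poincaré inequality then turns a convergent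
sequence of gradients into a Cauchy sequence of values, and the completeness statement for `H`
supplies an element with the limiting derivatives. -/
theorem isClosed_gradSpace {S : Set R3} (hS : IsSurface S) {τ : Fin 2 → R3 → R3}
    (hτ : IsTangentFrame S τ) : IsClosed (gradSpace hS hτ : Set (FieldPair S)) := by
  refine IsSeqClosed.isClosed fun x a hx hxa => ?_
  have hmz : ∀ n, ∃ h : H S τ, (∫ p, h.val p ∂vol) = 0 ∧ Represents h (x n) := by
    intro n
    obtain ⟨h, hh⟩ := hx n
    obtain ⟨k, hk0, -, hk2, hk3⟩ := h.exists_mean_zero hS hτ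
    exact ⟨k, hk0, by rw [Represents, hk2, hk3]; exact hh⟩
  choose h hh0 hhx using hmz
  have hpair : ∀ n, (h n).pair = x n := fun n => represents_iff.1 (hhx n)
  let f : ℕ → L2Field Unit vol := fun n => toL2 (memLp_unit (h n).val_memLp)
  have hfx : ∀ n m, ‖f n - f m‖ ^ 2 ≤ 72 * ‖x n - x m‖ ^ 2 := by
    intro n m
    obtain ⟨k, hk1, hk2, -⟩ := (h n).exists_sub hS hτ (h m)
    have hk0 : ∫ p, k.val p ∂vol = 0 := by
      rw [hk1]
      simp only [Pi.sub_apply]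
      rw [integral_sub ((h n).val_memLp.integrable (by norm_num))
        ((h m).val_memLp.integrable (by norm_num)), hh0, hh0, sub_zero]
    have e1 : ‖f n - f m‖ ^ 2 = ∫ p, ‖k.val p‖ ^ 2 ∂vol := by
      simp only [f]
      rw [norm_toL2_sub_sq]
      refine integral_congr_ae ?_
      filter_upwards [toL2_ae (memLp_unit (h m).val_memLp)] with p hp
      rw [hp, hk1]
      simp
    have e2 : ‖(x n).fst - (x m).fst‖ ^ 2 = ∫ p, ∑ j, ‖k.grad p j‖ ^ 2 ∂vol := by
      rw [← hpair n, ← hpair m]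
      change ‖toL2 (h n).grad_memLp - toL2 (h m).grad_memLp‖ ^ 2 = _
      rw [norm_toL2_sub_sq]
      refine integral_congr_ae ?_
      filter_upwards [toL2_ae (h m).grad_memLp] with p hp
      rw [hp, hk2]
      rfl
    have e3 := WithLp.prod_norm_sq_eq_of_L2 (x n - x m)
    have e4 : ‖(x n - x m).fst‖ ^ 2 = ‖(x n).fst - (x m).fst‖ ^ 2 := rfl
    have := k.poincare hk0
    rw [← e1, ← e2] at this
    nlinarith [sq_nonneg ‖(x n - x m).snd‖]
  -- The factor 9 is used because 9² = 81 ≥ 72.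
  have hfx' : ∀ n m, dist (f n) (f m) ≤ 9 * dist (x n) (x m) := by
    intro n m
    rw [dist_eq_norm, dist_eq_norm]
    refine le_of_sq_le_sq ?_ (by positivity)
    nlinarith [hfx n m, sq_nonneg ‖x n - x m‖]
  have hfc : CauchySeq f := by
    have hxc := hxa.cauchySeq
    rw [Metric.cauchySeq_iff] at hxc ⊢
    intro ε hε
    obtain ⟨N, hN⟩ := hxc (ε / 9) (by positivity)
    refine ⟨N, fun n hn m hm => ?_⟩
    have := hN n hn m hm
    have := hfx' n m
    linarith
  obtain ⟨F, hF⟩ := cauchySeq_tendsto_of_complete hfc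
  have hFm : MemLp (fun p => (F p).ofLp ()) 2 vol := (memLp_coe F).eval ()
  have hsob : ∀ n, sob2 ((h n).val - fun p => (F p).ofLp ()) ((h n).grad - fun p => (a.fst p).ofLp)
      = ENNReal.ofReal (‖f n - F‖ ^ 2 + ‖(x n).fst - a.fst‖ ^ 2) := by
    intro n
    rw [← ofReal_integral_eq_sob2 ((h n).val_memLp.sub hFm)
      ((h n).grad_memLp.sub (memLp_coe a.fst)), integral_add
        (((h n).val_memLp.sub hFm).integrable_norm_pow two_ne_zero)
        (integrable_sum_norm_sq ((h n).grad_memLp.sub (memLp_coe a.fst)))]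
    congr 2
    · simp only [f]
      rw [norm_toL2_sub_sq]
      simp
    · rw [← hpair n]
      change _ = ‖toL2 (h n).grad_memLp - a.fst‖ ^ 2
      rw [norm_toL2_sub_sq]
      rfl
  have hfst : Tendsto (fun n => ‖(x n).fst - a.fst‖) atTop (𝓝 0) := by
    have h1 : Tendsto (fun n => ‖x n - a‖) atTop (𝓝 0) := tendsto_iff_norm_sub_tendsto_zero.1 hxa
    refine squeeze_zero (fun _ => norm_nonneg _) (fun n => ?_) h1
    exact WithLp.norm_fst_le _ (x n - a)
  have hsnd : Tendsto (fun n => ‖(x n).snd - a.snd‖) atTop (𝓝 0) := by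
    have h1 : Tendsto (fun n => ‖x n - a‖) atTop (𝓝 0) := tendsto_iff_norm_sub_tendsto_zero.1 hxa
    refine squeeze_zero (fun _ => norm_nonneg _) (fun n => ?_) h1
    exact WithLp.norm_snd_le _ (x n - a)
  suffices hex : ∃ k : H S τ, k.val =ᵐ[vol] (fun p => (F p).ofLp ()) ∧
      k.grad =ᵐ[vol] (fun p => (a.fst p).ofLp) ∧ k.tgrad = fun p => (a.snd p).ofLp by
    obtain ⟨k, -, hk2, hk3⟩ := hex
    refine ⟨k, hk2, ?_⟩
    rw [hk3]
    exact Eventually.of_forall fun p => rfl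
  refine hS.exists_H_of_tendsto hτ h hFm (memLp_coe a.fst) (memLp_coe a.snd) ?_ ?_
  · have h1 := ((tendsto_iff_norm_sub_tendsto_zero.1 hF).pow 2).add (hfst.pow 2)
    have h2 := ENNReal.tendsto_ofReal h1
    simp only [hsob]
    simpa using h2
  · intro i
    have := hS.isFiniteMeasure
    have hbd : ∀ n, ∫⁻ p, ‖(h n).tgrad p i - (a.snd p).ofLp i‖ₑ ∂area S
        ≤ ‖(x n).snd - a.snd‖ₑ * area S univ ^ (1 / 2 : ℝ) := by
      intro n
      refine le_trans (le_of_eq (lintegral_congr_ae ?_))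
        (lintegral_enorm_apply_le ((x n).snd - a.snd) i)
      filter_upwards [(hhx n).2, Lp.coeFn_sub (x n).snd a.snd] with p h1 h2
      rw [h2, h1]
      rfl
    have hlim : Tendsto (fun n => ‖(x n).snd - a.snd‖ₑ * area S univ ^ (1 / 2 : ℝ)) atTop
        (𝓝 0) := by
      have h1 := ENNReal.tendsto_ofReal hsnd
      simp only [ofReal_norm, ENNReal.ofReal_zero] at h1
      have h2 := ENNReal.Tendsto.mul_const (b := area S univ ^ (1 / 2 : ℝ)) h1
        (Or.inr (ENNReal.rpow_ne_top_of_nonneg (by norm_num) (measure_ne_top _ _)))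
      simpa using h2
    exact tendsto_of_tendsto_of_tendsto_of_le_of_le tendsto_const_nhds hlim (fun _ => zero_le) hbd

/-- The weak form with coefficients `N₁`, `N₂` and forcing `r₁`, `r₂`. -/
noncomputable def weakForm {S : Set R3} {τ : Fin 2 → R3 → R3}
    (N₁ : R3 → Matrix (Fin 3) (Fin 3) ℂ) (N₂ : R3 → Matrix (Fin 2) (Fin 2) ℂ)
    (r₁ : R3 → Fin 3 → ℂ) (r₂ : R3 → Fin 2 → ℂ) (h k : H S τ) : ℂ :=
  (∫ p, dotProduct ((N₁ p).mulVec (h.grad p) + r₁ p) (star (k.grad p)) ∂vol)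
    + ∫ p, dotProduct ((N₂ p).mulVec (h.tgrad p) + r₂ p) (star (k.tgrad p)) ∂area S

/-- Lax–Milgram is applied over the reals to the closed space of gradient pairs, where the form is
coercive without any normalisation of constants. The solution is then lifted to an element of `H`
with mean zero. -/
theorem exists_weakForm_eq_zero {S : Set R3} (hS : IsSurface S) {τ : Fin 2 → R3 → R3}
    (hτ : IsTangentFrame S τ) {N₁ : R3 → Matrix (Fin 3) (Fin 3) ℂ}
    {N₂ : R3 → Matrix (Fin 2) (Fin 2) ℂ} (hN₁ : IsBddMatrix vol N₁)
    (hN₂ : IsBddMatrix (area S) N₂) {c : ℝ} (hc : 0 < c)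
    (hc₁ : ∀ᵐ p ∂vol, ∀ v : Fin 3 → ℂ,
      c * ∑ i, ‖v i‖ ^ 2 ≤ (dotProduct ((N₁ p).mulVec v) (star v)).re)
    (hc₂ : ∀ᵐ p ∂area S, ∀ v : Fin 2 → ℂ,
      c * ∑ i, ‖v i‖ ^ 2 ≤ (dotProduct ((N₂ p).mulVec v) (star v)).re) :
    ∃ C : ℝ, 0 ≤ C ∧ ∀ (r₁ : R3 → Fin 3 → ℂ) (r₂ : R3 → Fin 2 → ℂ), MemLp r₁ 2 vol →
      MemLp r₂ 2 (area S) → ∃ h : H S τ, (∫ p, h.val p ∂vol) = 0 ∧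
        (∀ k : H S τ, weakForm N₁ N₂ r₁ r₂ h k = 0) ∧
        (∫ p, (‖h.val p‖ ^ 2 + ∑ j, ‖h.grad p j‖ ^ 2) ∂vol)
          + (∫ p, (∑ k, ‖h.tgrad p k‖ ^ 2) ∂area S)
          ≤ C * ((∫ p, (∑ i, ‖r₁ p i‖ ^ 2) ∂vol) + ∫ p, (∑ i, ‖r₂ p i‖ ^ 2) ∂area S) := by
  let ev := WithLp.prodContinuousLinearEquiv 2 ℝ (L2Field (Fin 3) vol) (L2Field (Fin 2) (area S))
  let T : FieldPair S →L[ℝ] FieldPair S :=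
    (ev.symm : _ →L[ℝ] FieldPair S).comp (((mulL2 hN₁).prodMap (mulL2 hN₂)).comp
      (ev : FieldPair S →L[ℝ] _))
  have hTin : ∀ x ρ y : FieldPair S, ⟪T x + ρ, y⟫ = ⟪mulL2 hN₁ x.fst + ρ.fst, y.fst⟫
      + ⟪mulL2 hN₂ x.snd + ρ.snd, y.snd⟫ := fun x ρ y => WithLp.prod_inner_apply _ _
  have hTin' : ∀ x y : FieldPair S, ⟪T x, y⟫ = ⟪mulL2 hN₁ x.fst, y.fst⟫
      + ⟪mulL2 hN₂ x.snd, y.snd⟫ := fun x y => WithLp.prod_inner_apply _ _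
  have hT : ∀ x, c * ‖x‖ ^ 2 ≤ ⟪T x, x⟫ := by
    intro x
    rw [hTin', WithLp.prod_norm_sq_eq_of_L2, mul_add]
    exact add_le_add (inner_mulL2_ge hN₁ hc₁ _) (inner_mulL2_ge hN₂ hc₂ _)
  -- 73 = 72 + 1: the Poincaré constant for the values and 1 for the gradient; c⁻² comes from c‖x‖ ≤
  -- ‖ρ‖.
  refine ⟨73 / c ^ 2, by positivity, fun r₁ r₂ hr₁ hr₂ => ?_⟩
  let ρ : FieldPair S := WithLp.toLp 2 (toL2 hr₁, toL2 hr₂)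
  obtain ⟨x, hx, hxV, hxn⟩ := exists_laxMilgram T hc hT (gradSpace hS hτ)
    (isClosed_gradSpace hS hτ) ρ
  obtain ⟨h', hh'⟩ := hx
  obtain ⟨h, hh0, -, hh2, hh3⟩ := h'.exists_mean_zero hS hτ
  have hhx : Represents h x := by rw [Represents, hh2, hh3]; exact hh'
  have hpair := represents_iff.1 hhx
  have hre : ∀ k : H S τ, (weakForm N₁ N₂ r₁ r₂ h k).re = 0 := by
    intro k
    have h1 := hxV k.pair ⟨k, represents_iff.2 rfl⟩
    rw [hTin, inner_L2Field, inner_L2Field] at h1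
    rw [← h1, weakForm, Complex.add_re]
    have i1 := integral_re (𝕜 := ℂ) (integrable_dotProduct_star
      ((hN₁.memLp_mulVec h.grad_memLp).add hr₁) k.grad_memLp)
    have i2 := integral_re (𝕜 := ℂ) (integrable_dotProduct_star
      ((hN₂.memLp_mulVec h.tgrad_memLp).add hr₂) k.tgrad_memLp)
    simp only [RCLike.re_to_complex] at i1 i2
    refine congrArg₂ (· + ·) (i1.symm.trans ?_) (i2.symm.trans ?_)
    · refine integral_congr_ae ?_
      filter_upwards [hhx.1, mulL2_ae hN₁ x.fst, toL2_ae hr₁, toL2_ae k.grad_memLp,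
        Lp.coeFn_add (mulL2 hN₁ x.fst) ρ.fst] with p a1 a2 a3 a4 a5
      have a4' : (k.pair.fst p).ofLp = k.grad p := a4
      have a3' : (ρ.fst p).ofLp = r₁ p := a3
      have a6 : ((mulL2 hN₁ x.fst + ρ.fst) p).ofLp = (N₁ p).mulVec (h.grad p) + r₁ p := by
        rw [a5]
        change ((mulL2 hN₁ x.fst) p).ofLp + (ρ.fst p).ofLp = _
        rw [a2, a3', a1]
      rw [a6, a4']
      rfl
    · refine integral_congr_ae ?_
      filter_upwards [hhx.2, mulL2_ae hN₂ x.snd, toL2_ae hr₂, toL2_ae k.tgrad_memLp,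
        Lp.coeFn_add (mulL2 hN₂ x.snd) ρ.snd] with p a1 a2 a3 a4 a5
      have a4' : (k.pair.snd p).ofLp = k.tgrad p := a4
      have a3' : (ρ.snd p).ofLp = r₂ p := a3
      have a6 : ((mulL2 hN₂ x.snd + ρ.snd) p).ofLp = (N₂ p).mulVec (h.tgrad p) + r₂ p := by
        rw [a5]
        change ((mulL2 hN₂ x.snd) p).ofLp + (ρ.snd p).ofLp = _
        rw [a2, a3', a1]
      rw [a6, a4']
      rfl
  refine ⟨h, hh0, fun k => Complex.ext (hre k) ?_, ?_⟩
  -- The real problem only makes the real part vanish. Testing with `i k` multiplies the form by −i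
  -- and so exposes the imaginary part.
  · obtain ⟨l, -, hl2, hl3⟩ := H.exists_smul hS hτ Complex.I k
    have h1 := hre l
    have h2 : weakForm N₁ N₂ r₁ r₂ h l = -Complex.I * weakForm N₁ N₂ r₁ r₂ h k := by
      unfold weakForm
      rw [hl2, hl3, mul_add, ← integral_const_mul, ← integral_const_mul]
      simp [dotProduct_smul]
    rw [h2] at h1
    simpa using h1
  · have e1 : ‖x‖ ^ 2
        = (∫ p, ∑ j, ‖h.grad p j‖ ^ 2 ∂vol) + ∫ p, ∑ k, ‖h.tgrad p k‖ ^ 2 ∂area S := by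
      rw [← hpair, WithLp.prod_norm_sq_eq_of_L2, ← norm_toL2_sq h.grad_memLp,
        ← norm_toL2_sq h.tgrad_memLp]
      rfl
    have e2 : ‖ρ‖ ^ 2 = (∫ p, ∑ j, ‖r₁ p j‖ ^ 2 ∂vol) + ∫ p, ∑ k, ‖r₂ p k‖ ^ 2 ∂area S := by
      rw [WithLp.prod_norm_sq_eq_of_L2, ← norm_toL2_sq hr₁, ← norm_toL2_sq hr₂]
      rfl
    rw [← e2, integral_add (h.val_memLp.integrable_norm_pow two_ne_zero)
      (integrable_sum_norm_sq h.grad_memLp)]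
    have e3 := h.poincare hh0
    have e4 : c ^ 2 * ‖x‖ ^ 2 ≤ ‖ρ‖ ^ 2 := by
      rw [← mul_pow]
      exact pow_le_pow_left₀ (by positivity) hxn 2
    have e5 : 0 ≤ ∫ p, ∑ k, ‖h.tgrad p k‖ ^ 2 ∂area S := integral_nonneg fun p => by positivity
    rw [div_mul_eq_mul_div, le_div_iff₀ (by positivity)]
    nlinarith [sq_nonneg c, mul_nonneg (sq_nonneg c) e5]


/-! ### Coefficient matrices -/

section Coefficients

variable {α ι κ : Type*} [MeasurableSpace α] {μ : Measure α}

theorem IsBddMatrix.det [Fintype ι] [DecidableEq ι] {M : α → Matrix ι ι ℂ}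
    (hM : IsBddMatrix μ M) : AEStronglyMeasurable (fun p => (M p).det) μ ∧
      ∃ C : ℝ, 0 ≤ C ∧ ∀ᵐ p ∂μ, ‖(M p).det‖ ≤ C := by
  constructor
  · simp only [Matrix.det_apply']
    exact Finset.aestronglyMeasurable_fun_sum _ fun s _ => aestronglyMeasurable_const.mul
      (Finset.aestronglyMeasurable_fun_prod _ fun i _ => hM.aesm _ _)
  · obtain ⟨C, hC0, hC⟩ := hM.bdd
    refine ⟨∑ _s : Equiv.Perm ι, ∏ _i : ι, C, by positivity, ?_⟩
    filter_upwards [hC] with p hp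
    rw [Matrix.det_apply']
    refine (norm_sum_le _ _).trans (Finset.sum_le_sum fun s _ => ?_)
    rw [norm_mul, norm_prod]
    have h1 : ‖((Equiv.Perm.sign s : ℤ) : ℂ)‖ = 1 := by
      rcases Int.units_eq_one_or (Equiv.Perm.sign s) with h | h <;> simp [h]
    rw [h1, one_mul]
    exact Finset.prod_le_prod (fun _ _ => norm_nonneg _) fun i _ => hp _ _

theorem IsBddMatrix.updateRow [Fintype ι] [DecidableEq ι] {M : α → Matrix ι ι ℂ}
    (hM : IsBddMatrix μ M) (j : ι) (v : ι → ℂ) :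
    IsBddMatrix μ fun p => (M p).updateRow j v := by
  obtain ⟨C, hC0, hC⟩ := hM.bdd
  refine ⟨fun i k => ?_, C + ∑ k, ‖v k‖, by positivity, ?_⟩
  · simp only [Matrix.updateRow_apply]
    split_ifs
    · exact aestronglyMeasurable_const
    · exact hM.aesm i k
  · filter_upwards [hC] with p hp i k
    have h1 : ‖v k‖ ≤ ∑ k, ‖v k‖ := Finset.single_le_sum (f := fun k => ‖v k‖)
      (fun _ _ => norm_nonneg _) (Finset.mem_univ k)
    have h2 : 0 ≤ ∑ k, ‖v k‖ := by positivity
    rw [Matrix.updateRow_apply]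
    split_ifs
    · linarith
    · linarith [hp i k]

/-- By Cramer's rule the inverse is the adjugate over the determinant; the adjugate entries are
determinants of matrices with one row replaced by a unit vector. -/
theorem IsBddMatrix.inv [Fintype ι] [DecidableEq ι] {M : α → Matrix ι ι ℂ}
    (hM : IsBddMatrix μ M) {c : ℝ} (hc : 0 < c) (hdet : ∀ᵐ p ∂μ, c ≤ ‖(M p).det‖) :
    IsBddMatrix μ fun p => (M p)⁻¹ := by
  have hadj : IsBddMatrix μ fun p => (M p).adjugate := by
    have h := fun i j => (hM.updateRow j (Pi.single i 1)).det
    choose h1 C hC0 hC using h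
    refine ⟨fun i j => ?_, ∑ i, ∑ j, C i j, Finset.sum_nonneg fun i _ =>
      Finset.sum_nonneg fun j _ => hC0 i j, ?_⟩
    · simp only [Matrix.adjugate_apply]
      exact h1 i j
    · filter_upwards [ae_all_iff.2 fun i => ae_all_iff.2 fun j => hC i j] with p hp i j
      rw [Matrix.adjugate_apply]
      exact (hp i j).trans ((Finset.single_le_sum (f := fun j => C i j) (fun j _ => hC0 i j)
        (Finset.mem_univ j)).trans (Finset.single_le_sum (f := fun i => ∑ j, C i j)
          (fun i _ => Finset.sum_nonneg fun j _ => hC0 i j) (Finset.mem_univ i)))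
  simp only [Matrix.inv_def]
  refine hadj.smul (C' := c⁻¹) ?_ ?_
  · simp only [Ring.inverse_eq_inv']
    exact hM.det.1.aemeasurable.inv.aestronglyMeasurable
  · filter_upwards [hdet] with p hp
    rw [Ring.inverse_eq_inv', norm_inv]
    exact inv_anti₀ hc hp

/-- Complexification of a real matrix. -/
noncomputable abbrev cplx (M : Matrix ι κ ℝ) : Matrix ι κ ℂ := M.map fun x => (x : ℂ)

theorem cplx_mul {l : Type*} [Fintype κ] (M : Matrix ι κ ℝ) (N : Matrix κ l ℝ) :
    cplx (M * N) = cplx M * cplx N := Matrix.map_mul (f := Complex.ofRealHom)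

theorem cplx_det [Fintype ι] [DecidableEq ι] (M : Matrix ι ι ℝ) :
    (cplx M).det = (M.det : ℂ) := (RingHom.map_det Complex.ofRealHom M).symm

theorem cplx_one [DecidableEq ι] : cplx (1 : Matrix ι ι ℝ) = 1 :=
  Matrix.map_one _ Complex.ofReal_zero Complex.ofReal_one

theorem cplx_inv [Fintype ι] [DecidableEq ι] (M : Matrix ι ι ℝ) : cplx M⁻¹ = (cplx M)⁻¹ := by
  rw [Matrix.inv_def, Matrix.inv_def, cplx_det, Ring.inverse_eq_inv', Ring.inverse_eq_inv']
  have h : cplx M.adjugate = (cplx M).adjugate := RingHom.map_adjugate Complex.ofRealHom M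
  rw [← h]
  ext i j
  simp

theorem cplx_mulVec [Fintype κ] (M : Matrix ι κ ℝ) (v : κ → ℂ) (i : ι) :
    ((cplx M).mulVec v i).re = M.mulVec (fun j => (v j).re) i ∧
      ((cplx M).mulVec v i).im = M.mulVec (fun j => (v j).im) i := by
  simp [Matrix.mulVec, dotProduct, Complex.re_sum, Complex.im_sum]

theorem star_cplx_mulVec [Fintype κ] (M : Matrix ι κ ℝ) (v : κ → ℂ) :
    star ((cplx M).mulVec v) = (cplx M).mulVec (star v) := by
  ext i
  simp [Matrix.mulVec, dotProduct]

theorem dotProduct_conj_congr [Fintype ι] [Fintype κ] (M : Matrix ι ι ℂ) (G : Matrix ι κ ℝ)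
    (u : ι → ℂ) (w : κ → ℂ) (s : ℂ) :
    dotProduct (M.mulVec u) (star ((cplx G).mulVec w)) * s
      = dotProduct ((s • ((cplx G).transpose * M)).mulVec u) (star w) := by
  rw [star_cplx_mulVec, Matrix.dotProduct_mulVec, ← Matrix.mulVec_transpose, Matrix.mulVec_mulVec,
    Matrix.smul_mulVec, smul_dotProduct, smul_eq_mul, mul_comm]

/-- With u = x + iy, the cross terms `M i j` x_i y_j enter with opposite signs and cancel by
symmetry of `M`. The remaining weights are real, so taking real parts just replaces `M` by Re M. -/
theorem dotProduct_mulVec_star_self [Fintype ι] {M : Matrix ι ι ℂ} (hM : M.IsSymm) (u : ι → ℂ) :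
    dotProduct (M.mulVec u) (star u)
      = ∑ i, ∑ j, M i j * (((u j).re * (u i).re + (u j).im * (u i).im : ℝ) : ℂ) := by
  have h1 : ∑ i, ∑ j, M i j * (((u j).im * (u i).re : ℝ) : ℂ)
      = ∑ i, ∑ j, M i j * (((u j).re * (u i).im : ℝ) : ℂ) := by
    rw [Finset.sum_comm]
    refine Finset.sum_congr rfl fun i _ => Finset.sum_congr rfl fun j _ => ?_
    rw [hM.apply i j, mul_comm (u i).im]
  have h2 : ∀ i j, M i j * u j * star (u i)
      = M i j * (((u j).re * (u i).re + (u j).im * (u i).im : ℝ) : ℂ)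
        + Complex.I * (M i j * (((u j).im * (u i).re : ℝ) : ℂ))
        - Complex.I * (M i j * (((u j).re * (u i).im : ℝ) : ℂ)) := by
    intro i j
    have e1 : star (u i) = (u i).re - (u i).im * Complex.I := by
      apply Complex.ext <;> simp
    have e2 : u j = (u j).re + (u j).im * Complex.I := (Complex.re_add_im _).symm
    rw [e1]
    nth_rewrite 1 [e2]
    push_cast
    ring_nf
    rw [Complex.I_sq]
    ring
  simp only [dotProduct, Matrix.mulVec, Finset.sum_mul, Pi.star_apply]
  simp_rw [h2, Finset.sum_sub_distrib, Finset.sum_add_distrib, ← Finset.mul_sum]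
  rw [h1]
  ring

theorem sum_norm_sq_eq [Fintype ι] (u : ι → ℂ) :
    ∑ i, ‖u i‖ ^ 2 = ∑ i, (u i).re ^ 2 + ∑ i, (u i).im ^ 2 := by
  rw [← Finset.sum_add_distrib]
  refine Finset.sum_congr rfl fun i _ => ?_
  rw [← Complex.normSq_eq_norm_sq, Complex.normSq_apply]
  ring

/-- Ellipticity on complex vectors whose real and imaginary parts are admissible. -/
theorem le_re_dotProduct_star {M : Matrix (Fin 3) (Fin 3) ℂ} (hM : M.IsSymm) {c : ℝ}
    {V : Submodule ℝ R3}
    (h : ∀ ξ ∈ V, c * ‖ξ‖ ^ 2 ≤ ∑ i, ∑ j, (M i j).re * ξ j * ξ i) {u : Fin 3 → ℂ}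
    (hre : (WithLp.toLp 2 fun i => (u i).re) ∈ V) (him : (WithLp.toLp 2 fun i => (u i).im) ∈ V) :
    c * ∑ i, ‖u i‖ ^ 2 ≤ (dotProduct (M.mulVec u) (star u)).re := by
  have h1 := h _ hre
  have h2 := h _ him
  rw [EuclideanSpace.norm_sq_eq] at h1 h2
  simp only [Real.norm_eq_abs, sq_abs] at h1 h2
  rw [sum_norm_sq_eq, mul_add, dotProduct_mulVec_star_self hM]
  refine (add_le_add h1 h2).trans (le_of_eq ?_)
  simp only [Complex.re_sum, Complex.re_mul_ofReal, ← Finset.sum_add_distrib]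
  refine Finset.sum_congr rfl fun i _ => Finset.sum_congr rfl fun j _ => ?_
  ring

/-- The matrix acting on the forcing in the transformed equation. -/
noncomputable def pullForce (M : α → Matrix ι ι ℂ) (G : α → Matrix ι κ ℝ) (s : α → ℝ) [Fintype ι]
    (p : α) : Matrix κ ι ℂ := (s p : ℂ) • ((cplx (G p)).transpose * M p)

theorem isBddMatrix_pullForce [Fintype ι] {M : α → Matrix ι ι ℂ} {G : α → Matrix ι κ ℝ}
    {s : α → ℝ} (hM : IsBddMatrix μ M) (hG : IsBddMatrix μ fun p => cplx (G p))
    (hs : AEStronglyMeasurable s μ) {C : ℝ} (hC : ∀ᵐ p ∂μ, |s p| ≤ C) :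
    IsBddMatrix μ (pullForce M G s) := by
  refine (hG.transpose.mul hM).smul (C' := C)
    (Complex.continuous_ofReal.comp_aestronglyMeasurable hs) ?_
  filter_upwards [hC] with p hp
  rwa [Complex.norm_real]

/-- Ellipticity is available only on the range of `G`. A bounded left inverse `L` bounds |v|² by a
multiple of |Gv|² and transfers it to all `v`; this also covers the nonsquare `G` of the surface. -/
theorem exists_pullForce_coercive [Fintype ι] [Fintype κ] [DecidableEq κ] {M : α → Matrix ι ι ℂ}
    {G : α → Matrix ι κ ℝ} {s : α → ℝ} {L : α → Matrix κ ι ℂ} (hL : IsBddMatrix μ L)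
    (hLG : ∀ᵐ p ∂μ, L p * cplx (G p) = 1) {s₀ c : ℝ} (hs₀ : 0 < s₀) (hs : ∀ᵐ p ∂μ, s₀ ≤ s p)
    (hc : 0 < c) (hMc : ∀ᵐ p ∂μ, ∀ v : κ → ℂ, c * ∑ i, ‖(cplx (G p)).mulVec v i‖ ^ 2 ≤
      (dotProduct ((M p).mulVec ((cplx (G p)).mulVec v)) (star ((cplx (G p)).mulVec v))).re) :
    ∃ c' : ℝ, 0 < c' ∧ ∀ᵐ p ∂μ, ∀ v : κ → ℂ, c' * ∑ i, ‖v i‖ ^ 2 ≤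
      (dotProduct ((pullForce M G s p * cplx (G p)).mulVec v) (star v)).re := by
  obtain ⟨C, hC0, hC⟩ := hL.exists_mulVec_le
  -- Adding 1 keeps the denominator positive, as `C` may vanish.
  refine ⟨s₀ * c / (C + 1), by positivity, ?_⟩
  filter_upwards [hC, hLG, hs, hMc] with p h1 h2 h3 h4 v
  have h5 := h1 ((cplx (G p)).mulVec v)
  rw [Matrix.mulVec_mulVec, h2, Matrix.one_mulVec] at h5
  have h6 := h4 v
  rw [← Matrix.mulVec_mulVec, pullForce, ← dotProduct_conj_congr, Complex.re_mul_ofReal]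
  set X := ∑ i, ‖(cplx (G p)).mulVec v i‖ ^ 2
  have hX : 0 ≤ X := by positivity
  rw [div_mul_eq_mul_div, div_le_iff₀ (by positivity)]
  calc s₀ * c * ∑ i, ‖v i‖ ^ 2 ≤ s₀ * c * ((C + 1) * X) := by gcongr; linarith
    _ = (c * X) * s₀ * (C + 1) := by ring
    _ ≤ _ := by
      refine mul_le_mul_of_nonneg_right ?_ (by positivity)
      exact mul_le_mul h6 h3 hs₀.le ((by positivity : 0 ≤ c * X).trans h6)

end Coefficients

/-! ### The volume coefficient -/

theorem fderiv_apply_e_norm_le {q : R3 → R3} {L : ℝ≥0} (hL : LipschitzOnWith L q cell) {p : R3}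
    (hp : p ∈ interior cell) (i j : Fin 3) : |fderiv ℝ q p (e j) i| ≤ L := by
  have h1 : ‖fderiv ℝ q p‖ ≤ L :=
    norm_fderiv_le_of_lipschitzOn ℝ (mem_interior_iff_mem_nhds.1 hp) hL
  have h2 : ‖e j‖ = 1 := by simp [e]
  calc |fderiv ℝ q p (e j) i| ≤ ‖fderiv ℝ q p (e j)‖ :=
        PiLp.norm_apply_le (fderiv ℝ q p (e j)) i
    _ ≤ ‖fderiv ℝ q p‖ * ‖e j‖ := ContinuousLinearMap.le_opNorm _ _
    _ ≤ L := by rwa [h2, mul_one]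

theorem MemD.isBddMatrix_F {S : Set R3} {q : R3 → R3} (hq : MemD S q) :
    IsBddMatrix vol fun p => cplx (F q p) := by
  obtain ⟨L, hL⟩ := hq.lipschitz
  refine ⟨fun i j => ?_, 1 + L, by positivity, ?_⟩
  · exact (Complex.measurable_ofReal.comp (measurable_F q i j)).aestronglyMeasurable
  · filter_upwards [ae_mem_interior_cell] with p hp i j
    have h1 := fderiv_apply_e_norm_le hL hp i j
    change ‖((F q p i j : ℝ) : ℂ)‖ ≤ _
    rw [Complex.norm_real, F, Matrix.add_apply, Matrix.of_apply]
    refine (norm_add_le _ _).trans (add_le_add ?_ h1)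
    rw [Matrix.one_apply]
    split_ifs <;> simp

theorem MemD.isBddMatrix_F_inv {S : Set R3} {q : R3 → R3} (hq : MemD S q) {δ : ℝ} (hδ : 0 < δ)
    (hJ : ∀ᵐ p ∂vol, δ ≤ J q p) : IsBddMatrix vol fun p => cplx ((F q p)⁻¹.transpose) := by
  have h : IsBddMatrix vol fun p => (cplx (F q p))⁻¹ := by
    refine hq.isBddMatrix_F.inv hδ ?_
    filter_upwards [hJ] with p hp
    rw [cplx_det, Complex.norm_real]
    exact hp.trans (le_abs_self _)
  have h2 := h.transpose
  simp only [← cplx_inv] at h2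
  exact h2

/-- A bounded measurable tensor field pulled back by the deformation. -/
theorem isBddMatrix_comp {α β ι : Type*} [MeasurableSpace α] [MeasurableSpace β]
    {μ : Measure α} {ν : Measure β} [Countable ι] {y : α → β} {M : β → Matrix ι ι ℂ}
    (hy : AEMeasurable y μ) (hac : μ.map y ≪ ν)
    (hM : ∀ i j, AEStronglyMeasurable (fun p => M p i j) ν)
    (hb : ∃ C : ℝ, ∀ᵐ p ∂ν, ∀ i j, ‖M p i j‖ ≤ C) : IsBddMatrix μ fun p => M (y p) := by
  obtain ⟨C, hC⟩ := hb
  refine ⟨fun i j => ((hM i j).mono_ac hac).comp_aemeasurable hy, |C|, abs_nonneg _, ?_⟩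
  filter_upwards [ae_of_ae_map hy (hac.ae_le hC)] with p hp i j
  exact (hp i j).trans (le_abs_self _)

/-- The tensor of the volume term. -/
noncomputable def volTensor (q : R3 → R3) (ε : R3 → Matrix (Fin 3) (Fin 3) ℂ) (p : R3) :
    Matrix (Fin 3) (Fin 3) ℂ := (-Complex.I) • ε (deform q p)

/-- The inverse transpose of the deformation gradient. -/
noncomputable def volPull (q : R3 → R3) (p : R3) : Matrix (Fin 3) (Fin 3) ℝ :=
  (F q p)⁻¹.transpose

section Volume

variable {S : Set R3} {q : R3 → R3}

theorem MemD.isBddMatrix_volTensor (hq : MemD S q) (hbij : BijOn (deform q) cell cell) {δ : ℝ}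
    (hδ : 0 < δ) (hJ : ∀ᵐ p ∂vol, δ ≤ J q p) {ε : R3 → Matrix (Fin 3) (Fin 3) ℂ}
    (hε : IsPermittivity ε) : IsBddMatrix vol (volTensor q ε) :=
  (isBddMatrix_comp hq.aemeasurable_deform (hq.map_vol_absolutelyContinuous hbij hδ hJ)
    hε.aestronglyMeasurable hε.bounded).smul (C' := 1) aestronglyMeasurable_const
      (Eventually.of_forall fun p => by simp)

theorem MemD.isBddMatrix_volForce (hq : MemD S q) (hbij : BijOn (deform q) cell cell) {δ : ℝ}
    (hδ : 0 < δ) (hJ : ∀ᵐ p ∂vol, δ ≤ J q p) {ε : R3 → Matrix (Fin 3) (Fin 3) ℂ}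
    (hε : IsPermittivity ε) :
    IsBddMatrix vol (pullForce (volTensor q ε) (volPull q) (J q)) := by
  obtain ⟨C, -, hC⟩ := hq.isBddMatrix_F.det.2
  refine isBddMatrix_pullForce (hq.isBddMatrix_volTensor hbij hδ hJ hε)
    (hq.isBddMatrix_F_inv hδ hJ) (measurable_J q).aestronglyMeasurable (C := C) ?_
  filter_upwards [hC] with p hp
  rwa [cplx_det, Complex.norm_real] at hp

/-- The real part of −iε is Im ε, which is the elliptic one, and the bounded left inverse of F⁻ᵀ is
Fᵀ. -/
theorem MemD.exists_volForce_coercive (hq : MemD S q) (hbij : BijOn (deform q) cell cell) {δ : ℝ}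
    (hδ : 0 < δ) (hJ : ∀ᵐ p ∂vol, δ ≤ J q p) {ε : R3 → Matrix (Fin 3) (Fin 3) ℂ}
    (hε : IsPermittivity ε) :
    ∃ c : ℝ, 0 < c ∧ ∀ᵐ p ∂vol, ∀ v : Fin 3 → ℂ, c * ∑ i, ‖v i‖ ^ 2 ≤
      (dotProduct ((pullForce (volTensor q ε) (volPull q) (J q) p * cplx (volPull q p)).mulVec v)
        (star v)).re := by
  obtain ⟨c, hc, hell⟩ := hε.elliptic
  refine exists_pullForce_coercive hq.isBddMatrix_F.transpose ?_ hδ hJ hc ?_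
  · filter_upwards [hJ] with p hp
    have hdet : IsUnit (F q p).det := (lt_of_lt_of_le hδ hp).ne'.isUnit
    change cplx (F q p).transpose * cplx (volPull q p) = 1
    rw [← cplx_mul, volPull, ← Matrix.transpose_mul, Matrix.nonsing_inv_mul _ hdet,
      Matrix.transpose_one, cplx_one]
  · have h := ae_of_ae_map hq.aemeasurable_deform
      ((hq.map_vol_absolutelyContinuous hbij hδ hJ).ae_le (hell.and hε.symm))
    filter_upwards [h] with p hp v
    refine le_re_dotProduct_star (V := ⊤) ?_ (fun ξ _ => ?_) trivial trivial
    · exact hp.2.smul _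
    · refine (hp.1 ξ).trans (le_of_eq ?_)
      simp [volTensor]

end Volume


/-! ### Measurability on the surface, tested in charts -/

/-- Near a regular point `f` is `f ∘ Φ` composed with the Lipschitz inverse of the chart, and
countably many such neighbourhoods cover the regular points. This is needed for derivatives along
`S`, whose measurability is visible only in charts. -/
theorem IsSurface.aestronglyMeasurable_of_chart {S : Set R3} (hS : IsSurface S) {β : Type*}
    [TopologicalSpace β] [TopologicalSpace.PseudoMetrizableSpace β] {f : R3 → β}
    (hf : ∀ U Φ, IsChart S U Φ → ∀ z₀ ∈ U, ∃ r > 0, Metric.closedBall z₀ r ⊆ U ∧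
      AEStronglyMeasurable (fun z => f (Φ z)) (volume.restrict (Metric.closedBall z₀ r))) :
    AEStronglyMeasurable f (area S) := by
  have hSm := hS.measurableSet
  have hloc : ∀ p ∈ regularPoints S, ∃ O : Set R3, IsOpen O ∧ p ∈ O ∧
      AEStronglyMeasurable f ((Measure.euclideanHausdorffMeasure 2 : Measure R3).restrict
        (S ∩ O)) := by
    rintro p ⟨U, Φ, hΦ, z₀, hz₀, rfl⟩
    obtain ⟨r, hr, hrU, hfm⟩ := hf U Φ hΦ z₀ hz₀
    obtain ⟨K, K', r', hr', hrU', hL, hA⟩ := hΦ.exists_bilipschitz_ball hz₀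
    set ρ := min r r'
    have hρ : 0 < ρ := lt_min hr hr'
    have hsub : Metric.ball z₀ ρ ⊆ Metric.closedBall z₀ r :=
      Metric.ball_subset_closedBall.trans (Metric.closedBall_subset_closedBall (min_le_left _ _))
    have hsub' : Metric.ball z₀ ρ ⊆ Metric.closedBall z₀ r' :=
      Metric.ball_subset_closedBall.trans (Metric.closedBall_subset_closedBall (min_le_right _ _))
    obtain ⟨O, hO, hSO⟩ := hΦ.exists_isOpen_image Metric.isOpen_ball (hsub.trans hrU)
    have hpO : Φ z₀ ∈ O := (hSO ▸ mem_image_of_mem Φ (Metric.mem_ball_self hρ) : _ ∈ S ∩ O).2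
    refine ⟨O, hO, hpO, ?_⟩
    have hSOm : MeasurableSet (S ∩ O) := hSm.inter hO.measurableSet
    set g := Function.invFunOn Φ (Metric.ball z₀ ρ)
    have hg : ∀ p ∈ S ∩ O, g p ∈ Metric.ball z₀ ρ ∧ Φ (g p) = p := by
      intro p hp
      rw [← hSO] at hp
      exact ⟨Function.invFunOn_mem hp, Function.invFunOn_eq hp⟩
    have hgL : LipschitzOnWith K' g (S ∩ O) := by
      refine LipschitzOnWith.of_dist_le_mul fun x hx y hy => ?_
      have := hA _ (hsub' (hg x hx).1) _ (hsub' (hg y hy).1)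
      rwa [(hg x hx).2, (hg y hy).2] at this
    have hgm : AEMeasurable g ((Measure.euclideanHausdorffMeasure 2 : Measure R3).restrict
        (S ∩ O)) := hgL.continuousOn.aemeasurable hSOm
    -- `f ∘ Φ` is measurable only up to null sets, so composing it with `g` requires that `g` pull
    -- null sets back to null sets; this holds because `Φ` is Lipschitz.
    have hac : ((Measure.euclideanHausdorffMeasure 2 : Measure R3).restrict (S ∩ O)).map g ≪
        volume.restrict (Metric.closedBall z₀ r) := by
      refine Measure.AbsolutelyContinuous.mk fun T hT h0 => ?_
      rw [Measure.map_apply_of_aemeasurable hgm hT, Measure.restrict_apply' hSOm]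
      rw [Measure.restrict_apply hT] at h0
      have himg := euclideanHausdorffMeasure_image_le 2
        (hL.mono (fun z hz => hsub' hz.2 : T ∩ Metric.ball z₀ ρ ⊆ _))
      rw [EuclideanSpace.euclideanHausdorffMeasure_eq_volume,
        measure_mono_null (inter_subset_inter_right T hsub) h0, mul_zero] at himg
      refine measure_mono_null ?_ (le_antisymm himg zero_le)
      rintro p ⟨hp1, hp2⟩
      exact ⟨g p, ⟨hp1, (hg p hp2).1⟩, (hg p hp2).2⟩
    refine ((hfm.mono_ac hac).comp_aemeasurable hgm).congr ?_
    filter_upwards [ae_restrict_mem hSOm] with p hp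
    simp only [Function.comp_apply, (hg p hp).2]
  choose! O hO hpO hfO using hloc
  obtain ⟨t, htc, htR, hcov⟩ : ∃ t : Set R3, t.Countable ∧ t ⊆ regularPoints S ∧
      regularPoints S ⊆ ⋃ p ∈ t, O p := by
    obtain ⟨t, ht, htc, hcov⟩ := TopologicalSpace.countable_cover_nhdsWithin
      (f := O) (s := regularPoints S) fun p hp =>
        mem_nhdsWithin_of_mem_nhds ((hO p hp).mem_nhds (hpO p hp))
    exact ⟨t, htc, ht, hcov⟩
  have : Countable t := htc.to_subtype
  have hU : AEStronglyMeasurable f ((Measure.euclideanHausdorffMeasure 2 : Measure R3).restrict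
      (⋃ p : t, S ∩ O p)) :=
    aestronglyMeasurable_iUnion_iff.2 fun p => hfO p (htR p.2)
  refine hU.mono_measure ?_
  have hmem : ∀ᵐ p ∂area S, p ∈ ⋃ p : t, S ∩ O p := by
    filter_upwards [hS.ae_regular, ae_restrict_mem hSm] with p h1 h2
    obtain ⟨x, hx, hpx⟩ := mem_iUnion₂.1 (hcov h1)
    exact mem_iUnion.2 ⟨⟨x, hx⟩, h2, hpx⟩
  rw [← Measure.restrict_eq_self_of_ae_mem hmem, area]
  exact Measure.restrict_mono_measure Measure.restrict_le_self _

/-! ### Gram matrices -/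

theorem gram_eq (a : Fin 2 → R3) : gram a = Matrix.gram ℝ a := rfl

theorem coe_gram_inv (a : Fin 2 → R3) (k l : Fin 2) : (gram a)⁻¹ k l =
    (⟪a 0, a 0⟫ * ⟪a 1, a 1⟫ - ⟪a 0, a 1⟫ * ⟪a 1, a 0⟫)⁻¹
      * !![⟪a 1, a 1⟫, -⟪a 0, a 1⟫; -⟪a 1, a 0⟫, ⟪a 0, a 0⟫] k l := by
  rw [Matrix.inv_def, Matrix.det_fin_two, Matrix.adjugate_fin_two, Ring.inverse_eq_inv']
  rfl

theorem aestronglyMeasurable_gram_inv {α : Type*} [MeasurableSpace α] {μ : Measure α}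
    {b : Fin 2 → α → R3} (hb : ∀ k, AEStronglyMeasurable (b k) μ) (k l : Fin 2) :
    AEStronglyMeasurable (fun p => (gram fun m => b m p)⁻¹ k l) μ := by
  have h : ∀ m n, AEStronglyMeasurable (fun p => (⟪b m p, b n p⟫ : ℝ)) μ :=
    fun m n => (hb m).inner (hb n)
  simp only [coe_gram_inv]
  refine ((((h 0 0).mul (h 1 1)).sub ((h 0 1).mul (h 1 0))).aemeasurable.inv.aestronglyMeasurable
    ).mul ?_
  fin_cases k <;> fin_cases l
  · exact h 1 1
  · exact (h 0 1).neg
  · exact (h 1 0).neg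
  · exact h 0 0

/-- Coordinates with respect to two linearly independent vectors. -/
theorem sum_gram_inv_smul {b : Fin 2 → R3} (hb : LinearIndependent ℝ b) (c : Fin 2 → ℝ)
    (k : Fin 2) :
    ∑ l, (gram b)⁻¹ k l * ⟪b l, ∑ m, c m • b m⟫ = c k := by
  have hdet : IsUnit (gram b).det :=
    (gram_eq b ▸ (Matrix.posDef_gram_of_linearIndependent hb).det_pos).ne'.isUnit
  have h1 : ∀ l, ⟪b l, ∑ m, c m • b m⟫ = (gram b).mulVec c l := by
    intro l
    simp [inner_add_right, inner_smul_right, Matrix.mulVec, dotProduct, gram, mul_comm]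
  simp only [h1]
  change ((gram b)⁻¹.mulVec ((gram b).mulVec c)) k = _
  rw [Matrix.mulVec_mulVec, Matrix.nonsing_inv_mul _ hdet, Matrix.one_mulVec]

/-- A quantitative lower bound for the Gram determinant. -/
theorem pow_le_det_gram {a : Fin 2 → R3} {c : ℝ} (hc : 0 ≤ c)
    (h : ∀ v : Fin 2 → ℝ, c * (v 0 ^ 2 + v 1 ^ 2) ≤ ‖v 0 • a 0 + v 1 • a 1‖ ^ 2) :
    c ^ 2 ≤ (gram a).det := by
  have hq : ∀ v : Fin 2 → ℝ, ‖v 0 • a 0 + v 1 • a 1‖ ^ 2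
      = v 0 ^ 2 * ⟪a 0, a 0⟫ + 2 * (v 0 * v 1) * ⟪a 0, a 1⟫ + v 1 ^ 2 * ⟪a 1, a 1⟫ := by
    intro v
    rw [norm_add_sq_real, norm_smul, norm_smul, mul_pow, mul_pow, Real.norm_eq_abs,
      Real.norm_eq_abs, sq_abs, sq_abs, real_inner_smul_left, real_inner_smul_right,
      real_inner_self_eq_norm_sq, real_inner_self_eq_norm_sq]
    ring
  have h0 := h ![1, 0]
  have h1 := h ![0, 1]
  -- This vector is orthogonal to `a 0` after combination: the quadratic form equals ‖a 0‖² times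
  -- the Gram determinant, while the lower bound is at least c‖a 0‖⁴.
  have h2 := h ![-⟪a 0, a 1⟫, ⟪a 0, a 0⟫]
  rw [hq] at h0 h1 h2
  simp only [Matrix.cons_val_zero, Matrix.cons_val_one] at h0 h1 h2
  have hdet : (gram a).det = ⟪a 0, a 0⟫ * ⟪a 1, a 1⟫ - ⟪a 0, a 1⟫ * ⟪a 0, a 1⟫ := by
    rw [Matrix.det_fin_two]
    simp only [gram, Matrix.of_apply]
    rw [real_inner_comm (a 0) (a 1)]
  rw [hdet]
  set x := (⟪a 0, a 0⟫ : ℝ)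
  set y := (⟪a 0, a 1⟫ : ℝ)
  set w := (⟪a 1, a 1⟫ : ℝ)
  have hx : c ≤ x := by linarith
  rcases hc.eq_or_lt with rfl | hc'
  · have := real_inner_mul_inner_self_le (a 0) (a 1)
    simp only [x, y, w]
    nlinarith
  · have hx0 : 0 < x := hc'.trans_le hx
    have h3 : (c * x) * x ≤ (x * w - y * y) * x := by nlinarith [mul_nonneg hc (sq_nonneg y)]
    have h4 := le_of_mul_le_mul_right h3 hx0
    nlinarith

/-! ### The push-forward of the tangent frame -/

theorem coe_tangentPlane {S : Set R3} {U : Set R2} {Φ : R2 → R3} (h : IsChart S U Φ) {z : R2}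
    (hz : z ∈ U) : tangentPlane S (Φ z) = (fderiv ℝ Φ z).range := by
  rw [tangentPlane, h.tangentConeAt_eq hz]
  exact Submodule.span_eq (fderiv ℝ Φ z).range

theorem mem_tangentConeAt_of_mem_regularPoints {S : Set R3} {p v : R3} (hp : p ∈ regularPoints S)
    (hv : v ∈ tangentPlane S p) : v ∈ tangentConeAt ℝ S p := by
  obtain ⟨U, Φ, hΦ, z, hz, rfl⟩ := hp
  rw [coe_tangentPlane hΦ hz] at hv
  rw [hΦ.tangentConeAt_eq hz]
  exact hv

theorem hasFDerivWithinAt_deform {S : Set R3} {q : R3 → R3} {p : R3}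
    (h : DifferentiableWithinAt ℝ q S p) :
    HasFDerivWithinAt (deform q) (ContinuousLinearMap.id ℝ R3 + fderivWithin ℝ q S p) S p :=
  (hasFDerivWithinAt_id p S).add h.hasFDerivWithinAt

/-- The lower Lipschitz bound holds for the secants of `S`, and both sides pass to the limit along a
sequence of rescaled secants converging to `v`. -/
theorem norm_le_of_mem_tangentConeAt {S : Set R3} {f : R3 → R3} {f' : R3 →L[ℝ] R3} {p : R3}
    (hpS : p ∈ S) {C : ℝ} (hC : ∀ a ∈ S, ∀ b ∈ S, dist a b ≤ C * dist (f a) (f b))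
    (h : HasFDerivWithinAt f f' S p) {v : R3} (hv : v ∈ tangentConeAt ℝ S p) :
    ‖v‖ ≤ C * ‖f' v‖ := by
  obtain ⟨α, l, hl, c, d, hd, hdS, hcd⟩ := exists_fun_of_mem_tangentConeAt hv
  have h1 := h.lim hd hdS hcd
  refine le_of_tendsto_of_tendsto hcd.norm (h1.norm.const_mul C) ?_
  filter_upwards [hdS] with n hn
  have h2 := hC _ hn _ hpS
  rw [dist_eq_norm, dist_eq_norm, add_sub_cancel_left] at h2
  rw [norm_smul, norm_smul]
  nlinarith [norm_nonneg (c n)]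

/-- The derivative within `S` is not unique in normal directions. On tangent vectors the chain rule
determines it through `q ∘ Φ`. -/
theorem IsChart.fderivWithin_apply {S : Set R3} {U : Set R2} {Φ : R2 → R3} (h : IsChart S U Φ)
    {z : R2} (hz : z ∈ U) {q : R3 → R3} (hq : DifferentiableWithinAt ℝ q S (Φ z)) (w : R2) :
    fderivWithin ℝ q S (Φ z) (fderiv ℝ Φ z w) = fderiv ℝ (fun z => q (Φ z)) z w := by
  have h1 := hq.hasFDerivWithinAt.comp_hasFDerivAt z (h.hasFDerivAt hz)
    (by filter_upwards [h.isOpen.mem_nhds hz] with x hx using h.mem hx)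
  have h2 := h1.fderiv
  change _ = fderiv ℝ (q ∘ Φ) z w
  rw [h2]
  rfl

/-- In a chart, τ is a combination of the coordinate vectors with coefficients given by the inverse
Gram matrix. Its image under the derivative of `q` is the same combination of the partial
derivatives of `q ∘ Φ`, which are measurable for any function. -/
theorem IsSurface.aestronglyMeasurable_pushFrame {S : Set R3} (hS : IsSurface S)
    {τ : Fin 2 → R3 → R3} (hτ : IsTangentFrame S τ) {q : R3 → R3} (hq : MemD S q) (k : Fin 2) :
    AEStronglyMeasurable (fun p => pushFrame S τ q p k) (area S) := by
  refine hS.aestronglyMeasurable_of_chart fun U Φ hΦ z₀ hz₀ => ?_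
  obtain ⟨r, hr, hrU⟩ := Metric.nhds_basis_closedBall.mem_iff.1 (hΦ.isOpen.mem_nhds hz₀)
  have hK : IsCompact (Metric.closedBall z₀ r) := isCompact_closedBall _ _
  refine ⟨r, hr, hrU, ?_⟩
  let e' : Fin 2 → R2 := fun m => EuclideanSpace.single m 1
  let b : Fin 2 → R2 → R3 := fun m z => fderiv ℝ Φ z (e' m)
  have hb : ∀ m, AEStronglyMeasurable (b m) (volume.restrict (Metric.closedBall z₀ r)) :=
    fun m => (measurable_fderiv_apply_const ℝ Φ (e' m)).aestronglyMeasurable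
  have hτm := hΦ.aestronglyMeasurable_comp hK hrU (hτ.aestronglyMeasurable k)
  obtain ⟨C, hC⟩ := hq.tangential
  have hae := hΦ.ae_comp hK hrU (hτ.tangent.and hC)
  refine AEStronglyMeasurable.congr (f := fun z => τ k (Φ z) + ∑ l, (∑ m,
    (gram fun m => b m z)⁻¹ l m * ⟪b m z, τ k (Φ z)⟫) • fderiv ℝ (fun z => q (Φ z)) z (e' l)) ?_ ?_
  · refine hτm.add (Finset.aestronglyMeasurable_fun_sum _ fun l _ => AEStronglyMeasurable.fun_smul ?_
      (measurable_fderiv_apply_const ℝ _ (e' l)).aestronglyMeasurable)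
    exact Finset.aestronglyMeasurable_fun_sum _ fun m _ =>
      (aestronglyMeasurable_gram_inv hb l m).mul ((hb m).inner hτm)
  · filter_upwards [hae, ae_restrict_mem hK.measurableSet] with z hz hzK
    have hzU := hrU hzK
    have ht := hz.1 k
    rw [coe_tangentPlane hΦ hzU] at ht
    obtain ⟨w, hw⟩ := ht
    have hwe : w = ∑ m, w m • e' m := by
      ext i
      fin_cases i <;> simp [e']
    have hτw : τ k (Φ z) = ∑ m, w m • b m z := by
      have h1 : fderiv ℝ Φ z w = τ k (Φ z) := hw
      rw [← h1]
      conv_lhs => rw [hwe]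
      simp [b]
    have hli : LinearIndependent ℝ fun m => b m z := by
      have h1 : LinearIndependent ℝ e' :=
        (EuclideanSpace.orthonormal_single (𝕜 := ℝ) (ι := Fin 2)).linearIndependent
      exact h1.map' (fderiv ℝ Φ z).toLinearMap (LinearMap.ker_eq_bot.2 (hΦ.immersion z hzU))
    have hco : ∀ l, ∑ m, (gram fun m => b m z)⁻¹ l m * ⟪b m z, τ k (Φ z)⟫ = w l := by
      intro l
      rw [hτw]
      exact sum_gram_inv_smul hli _ l
    simp only [hco, pushFrame]
    congr 1
    rw [hτw, map_sum]
    refine Finset.sum_congr rfl fun l _ => ?_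
    rw [map_smul, hΦ.fderivWithin_apply hzU hz.2.1]


/-! ### The surface coefficient -/

/-- The matrix with columns `a 0`, `a 1`. -/
noncomputable def frameMatrix (a : Fin 2 → R3) : Matrix (Fin 3) (Fin 2) ℝ :=
  Matrix.of fun j k => a k j

theorem gram_eq_transpose_mul (a : Fin 2 → R3) :
    gram a = (frameMatrix a).transpose * frameMatrix a := by
  ext k l
  simp only [gram, frameMatrix, Matrix.mul_apply, Matrix.of_apply, Matrix.transpose_apply,
    PiLp.inner_apply]
  refine Finset.sum_congr rfl fun j _ => ?_
  simp [mul_comm]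

theorem frameMatrix_mulVec (a : Fin 2 → R3) (v : Fin 2 → ℝ) :
    (frameMatrix a).mulVec v = (v 0 • a 0 + v 1 • a 1).ofLp := by
  ext j
  simp [frameMatrix, Matrix.mulVec, dotProduct, mul_comm]

theorem tangentialPart_eq (M : Matrix (Fin 2) (Fin 2) ℝ) (a : Fin 2 → R3) (b : Fin 2 → ℂ) :
    tangentialPart M a b = (cplx (frameMatrix a * M)).mulVec b := by
  ext j
  rw [cplx_mul, ← Matrix.mulVec_mulVec]
  simp only [tangentialPart, Matrix.mulVec, dotProduct, frameMatrix]
  refine Finset.sum_congr rfl fun k _ => ?_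
  rw [← Finset.sum_mul, mul_comm]
  rfl

section Surface

variable {S : Set R3} {τ : Fin 2 → R3 → R3} {q : R3 → R3}

/-- The upper bound is the tangential bound in the definition of `D`. The lower bound is the
infinitesimal form of the Lipschitz estimate for the inverse deformation, applied to tangent vectors
at regular points. Tangency holds because a derivative maps the tangent cone of `S` into that of the
image. -/
theorem exists_pushFrame_bounds (hS : IsSurface S) (hτ : IsTangentFrame S τ) (hq : MemD S q)
    (hbij : BijOn (deform q) cell cell) {δ : ℝ} (hδ : 0 < δ) (hJ : ∀ᵐ p ∂vol, δ ≤ J q p) :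
    ∃ c C : ℝ, 0 < c ∧ 0 ≤ C ∧ ∀ᵐ p ∂area S, (∀ k, ‖pushFrame S τ q p k‖ ≤ C) ∧
      ∀ v : Fin 2 → ℝ,
        c * (v 0 ^ 2 + v 1 ^ 2)
          ≤ ‖v 0 • pushFrame S τ q p 0 + v 1 • pushFrame S τ q p 1‖ ^ 2 ∧
        v 0 • pushFrame S τ q p 0 + v 1 • pushFrame S τ q p 1
          ∈ tangentPlane (deform q '' S) (deform q p) := by
  obtain ⟨K, hK0, hK⟩ := hq.exists_antilipschitz hbij hδ hJ
  obtain ⟨C, hC⟩ := hq.tangential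
  have hK0' : (0 : ℝ) < K := hK0
  refine ⟨((K : ℝ) ^ 2)⁻¹, 1 + |C|, by positivity, by positivity, ?_⟩
  filter_upwards [hC, hτ.tangent, hτ.orthonormal, hS.ae_regular, ae_restrict_mem hS.measurableSet]
    with p h1 h2 h3 h4 h5
  have hder := hasFDerivWithinAt_deform h1.1
  refine ⟨fun k => ?_, fun v => ?_⟩
  · refine (norm_add_le _ _).trans ?_
    have e1 := h1.2 _ (h2 k)
    have e2 : ‖τ k p‖ = 1 := h3.1 k
    rw [e2, mul_one] at e1
    rw [e2]
    linarith [le_abs_self C]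
  · set w := v 0 • τ 0 p + v 1 • τ 1 p
    have hw : v 0 • pushFrame S τ q p 0 + v 1 • pushFrame S τ q p 1
        = (ContinuousLinearMap.id ℝ R3 + fderivWithin ℝ q S p) w := by
      simp only [pushFrame, w, map_add, map_smul, add_apply, ContinuousLinearMap.id_apply]
    have hwt : w ∈ tangentPlane S p :=
      add_mem (Submodule.smul_mem _ _ (h2 0)) (Submodule.smul_mem _ _ (h2 1))
    have hwc := mem_tangentConeAt_of_mem_regularPoints h4 hwt
    have hwn : ‖w‖ ^ 2 = v 0 ^ 2 + v 1 ^ 2 := by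
      have e0 : ‖τ 0 p‖ = 1 := h3.1 0
      have e1 : ‖τ 1 p‖ = 1 := h3.1 1
      have e2 : (⟪τ 0 p, τ 1 p⟫ : ℝ) = 0 := h3.2 (by decide)
      simp only [w]
      rw [norm_add_sq_real, norm_smul, norm_smul, real_inner_smul_left, real_inner_smul_right, e0,
        e1, e2]
      simp
    have hle := norm_le_of_mem_tangentConeAt h5
      (fun a ha b hb => hK a (hS.subset_cell ha) b (hS.subset_cell hb)) hder hwc
    rw [hw]
    refine ⟨?_, Submodule.subset_span (hder.mapsTo_tangent_cone hwc)⟩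
    rw [← hwn, inv_mul_le_iff₀ (by positivity), ← mul_pow]
    exact pow_le_pow_left₀ (norm_nonneg _) hle 2

theorem isBddMatrix_frameMatrix (hS : IsSurface S) (hτ : IsTangentFrame S τ) (hq : MemD S q)
    {C : ℝ} (hC0 : 0 ≤ C) (hC : ∀ᵐ p ∂area S, ∀ k, ‖pushFrame S τ q p k‖ ≤ C) :
    IsBddMatrix (area S) fun p => cplx (frameMatrix (pushFrame S τ q p)) := by
  refine ⟨fun j k => ?_, C, hC0, ?_⟩
  · have h1 := hS.aestronglyMeasurable_pushFrame hτ hq k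
    exact Complex.continuous_ofReal.comp_aestronglyMeasurable
      ((EuclideanSpace.proj j : R3 →L[ℝ] ℝ).continuous.comp_aestronglyMeasurable h1)
  · filter_upwards [hC] with p hp j k
    change ‖((pushFrame S τ q p k j : ℝ) : ℂ)‖ ≤ _
    rw [Complex.norm_real]
    exact (PiLp.norm_apply_le (pushFrame S τ q p k) j).trans (hp k)

/-- The tensor of the surface term. -/
noncomputable def surfTensor (q : R3 → R3) (σ : R3 → Matrix (Fin 3) (Fin 3) ℂ) (freq : ℝ)
    (p : R3) : Matrix (Fin 3) (Fin 3) ℂ := ((freq⁻¹ : ℝ) : ℂ) • σ (deform q p)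

/-- The matrix of the tangential operator. -/
noncomputable def surfPull (S : Set R3) (τ : Fin 2 → R3 → R3) (q : R3 → R3)
    (coeff : (Fin 2 → R3) → Matrix (Fin 2) (Fin 2) ℝ) (p : R3) : Matrix (Fin 3) (Fin 2) ℝ :=
  frameMatrix (pushFrame S τ q p) * coeff (pushFrame S τ q p)

theorem isBddMatrix_gram {C : ℝ} (hC0 : 0 ≤ C) (hS : IsSurface S) (hτ : IsTangentFrame S τ)
    (hq : MemD S q) (hC : ∀ᵐ p ∂area S, ∀ k, ‖pushFrame S τ q p k‖ ≤ C) :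
    IsBddMatrix (area S) fun p => cplx (gram (pushFrame S τ q p)) := by
  have h := isBddMatrix_frameMatrix hS hτ hq hC0 hC
  have h2 := h.transpose.mul h
  simp only [gram_eq_transpose_mul, cplx_mul]
  exact h2

/-- The surface term is bounded and coercive, provided that the matrices `coeff` are bounded with
bounded inverses. -/
theorem exists_surfForce_coercive (hS : IsSurface S) (hτ : IsTangentFrame S τ) (hq : MemD S q)
    (hbij : BijOn (deform q) cell cell) {δ : ℝ} (hδ : 0 < δ) (hJ : ∀ᵐ p ∂vol, δ ≤ J q p)
    {σ : R3 → Matrix (Fin 3) (Fin 3) ℂ} (hσ : IsConductivity (deform q '' S) σ) {freq : ℝ}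
    (hfreq : 0 < freq) {coeff : (Fin 2 → R3) → Matrix (Fin 2) (Fin 2) ℝ}
    (hcoeff : IsBddMatrix (area S) fun p => cplx (coeff (pushFrame S τ q p)))
    {N : R3 → Matrix (Fin 2) (Fin 2) ℂ} (hN : IsBddMatrix (area S) N)
    (hNc : ∀ᵐ p ∂area S, N p * cplx (coeff (pushFrame S τ q p)) = 1) :
    IsBddMatrix (area S) (pullForce (surfTensor q σ freq) (surfPull S τ q coeff)
        fun p => surfaceElement (pushFrame S τ q p)) ∧
      IsBddMatrix (area S) (fun p => cplx (surfPull S τ q coeff p)) ∧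
      ∃ c : ℝ, 0 < c ∧ ∀ᵐ p ∂area S, ∀ v : Fin 2 → ℂ, c * ∑ i, ‖v i‖ ^ 2 ≤
        (dotProduct ((pullForce (surfTensor q σ freq) (surfPull S τ q coeff)
          (fun p => surfaceElement (pushFrame S τ q p)) p
            * cplx (surfPull S τ q coeff p)).mulVec v) (star v)).re := by
  obtain ⟨c, C, hc, hC0, hae⟩ := exists_pushFrame_bounds hS hτ hq hbij hδ hJ
  have hC : ∀ᵐ p ∂area S, ∀ k, ‖pushFrame S τ q p k‖ ≤ C := hae.mono fun p hp => hp.1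
  have hfr := isBddMatrix_frameMatrix hS hτ hq hC0 hC
  have hgr := isBddMatrix_gram hC0 hS hτ hq hC
  have hdet : ∀ᵐ p ∂area S, c ^ 2 ≤ (gram (pushFrame S τ q p)).det :=
    hae.mono fun p hp => pow_le_det_gram hc.le fun v => (hp.2 v).1
  have hgi : IsBddMatrix (area S) fun p => cplx (gram (pushFrame S τ q p))⁻¹ := by
    simp only [cplx_inv]
    refine hgr.inv (pow_pos hc 2) ?_
    filter_upwards [hdet] with p hp
    rw [cplx_det, Complex.norm_real]
    exact hp.trans (le_abs_self _)
  have hpull : IsBddMatrix (area S) fun p => cplx (surfPull S τ q coeff p) := by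
    have h := hfr.mul hcoeff
    simp only [← cplx_mul] at h
    exact h
  have hdac := hq.map_area_absolutelyContinuous hS hbij hδ hJ
  have hdm := hq.aemeasurable_deform_area hS
  have hM : IsBddMatrix (area S) (surfTensor q σ freq) :=
    (isBddMatrix_comp hdm hdac hσ.aestronglyMeasurable hσ.bounded).smul (C' := freq⁻¹)
      aestronglyMeasurable_const (Eventually.of_forall fun p => by
        rw [Complex.norm_real, Real.norm_eq_abs, abs_of_pos (by positivity)])
  obtain ⟨hd1, D, -, hD⟩ := hgr.det
  refine ⟨?_, hpull, ?_⟩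
  · refine isBddMatrix_pullForce hM hpull (C := √D) ?_ ?_
    · refine Real.continuous_sqrt.comp_aestronglyMeasurable ?_
      have h := Complex.continuous_re.comp_aestronglyMeasurable hd1
      simpa only [cplx_det, Complex.ofReal_re] using h
    · filter_upwards [hD] with p hp
      rw [cplx_det, Complex.norm_real] at hp
      rw [surfaceElement, abs_of_nonneg (Real.sqrt_nonneg _)]
      exact Real.sqrt_le_sqrt ((le_abs_self _).trans hp)
  · obtain ⟨c', hc', hell⟩ := hσ.elliptic
    -- The operator is the frame matrix A times `coeff`. Since AᵀA is the Gram matrix, N (AᵀA)⁻¹ Aᵀ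
    -- is a left inverse, bounded in each factor.
    refine exists_pullForce_coercive ((hN.mul hgi).mul hfr.transpose) ?_ hc ?_
      (c := freq⁻¹ * c') (by positivity) ?_
    · filter_upwards [hdet, hNc] with p hp hNp
      have hu : IsUnit (gram (pushFrame S τ q p)).det :=
        (lt_of_lt_of_le (pow_pos hc 2) hp).ne'.isUnit
      have h1 : cplx (gram (pushFrame S τ q p))⁻¹
          * (cplx (frameMatrix (pushFrame S τ q p))).transpose
          * cplx (frameMatrix (pushFrame S τ q p)) = 1 := by
        have h0 : (cplx (frameMatrix (pushFrame S τ q p))).transpose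
          = cplx (frameMatrix (pushFrame S τ q p)).transpose := rfl
        rw [h0, Matrix.mul_assoc, ← cplx_mul, ← gram_eq_transpose_mul, ← cplx_mul,
          Matrix.nonsing_inv_mul _ hu, cplx_one]
      rw [surfPull, cplx_mul, Matrix.mul_assoc (N p), Matrix.mul_assoc (N p),
        ← Matrix.mul_assoc (_ * _) (cplx (frameMatrix _)), h1, Matrix.one_mul, hNp]
    -- The Gram determinant is at least c², so the surface element is at least c.
    · filter_upwards [hdet] with p hp
      rw [surfaceElement]
      exact Real.le_sqrt_of_sq_le hp
    · have h := ae_of_ae_map hdm (hdac.ae_le (hell.and hσ.symm))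
      filter_upwards [h, hae] with p hp hpt v
      -- Ellipticity of σ is known only on tangent vectors; the range of the operator lies in the
      -- span of the pushed-forward frame, hence in the tangent plane of the deformed surface.
      have hmem : ∀ w : Fin 2 → ℝ, WithLp.toLp 2 ((surfPull S τ q coeff p).mulVec w)
          ∈ tangentPlane (deform q '' S) (deform q p) := by
        intro w
        rw [surfPull, ← Matrix.mulVec_mulVec, frameMatrix_mulVec]
        exact (hpt.2 _).2
      refine le_re_dotProduct_star (V := tangentPlane (deform q '' S) (deform q p)) ?_
        (fun ξ hξ => ?_) ?_ ?_
      · exact hp.2.smul _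
      · have h1 := mul_le_mul_of_nonneg_left (hp.1 ξ hξ) (inv_pos.2 hfreq).le
        rw [mul_assoc]
        refine h1.trans (le_of_eq ?_)
        simp only [Finset.mul_sum, surfTensor, Matrix.smul_apply, smul_eq_mul,
          Complex.re_ofReal_mul]
        refine Finset.sum_congr rfl fun i _ => Finset.sum_congr rfl fun j _ => ?_
        ring
      · simp only [(cplx_mulVec _ _ _).1]
        exact hmem _
      · simp only [(cplx_mulVec _ _ _).2]
        exact hmem _

/-- The coefficient is the inverse Gram matrix, so the Gram matrix itself serves as `N`; its
determinant is bounded below by the stretching bound. -/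
theorem exists_projCoeff_inverse (hS : IsSurface S) (hτ : IsTangentFrame S τ) (hq : MemD S q)
    (hbij : BijOn (deform q) cell cell) {δ : ℝ} (hδ : 0 < δ) (hJ : ∀ᵐ p ∂vol, δ ≤ J q p) :
    IsBddMatrix (area S) (fun p => cplx (projCoeff (pushFrame S τ q p))) ∧
      ∃ N : R3 → Matrix (Fin 2) (Fin 2) ℂ, IsBddMatrix (area S) N ∧
        ∀ᵐ p ∂area S, N p * cplx (projCoeff (pushFrame S τ q p)) = 1 := by
  obtain ⟨c, C, hc, hC0, hae⟩ := exists_pushFrame_bounds hS hτ hq hbij hδ hJ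
  have hgr := isBddMatrix_gram hC0 hS hτ hq (hae.mono fun p hp => hp.1)
  have hdet : ∀ᵐ p ∂area S, c ^ 2 ≤ (gram (pushFrame S τ q p)).det :=
    hae.mono fun p hp => pow_le_det_gram hc.le fun v => (hp.2 v).1
  refine ⟨?_, _, hgr, ?_⟩
  · simp only [projCoeff, cplx_inv]
    refine hgr.inv (pow_pos hc 2) ?_
    filter_upwards [hdet] with p hp
    rw [cplx_det, Complex.norm_real]
    exact hp.trans (le_abs_self _)
  · filter_upwards [hdet] with p hp
    rw [projCoeff, ← cplx_mul, Matrix.mul_nonsing_inv _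
      (lt_of_lt_of_le (pow_pos hc 2) hp).ne'.isUnit, cplx_one]

theorem isBddMatrix_diagonal {α ι : Type*} [MeasurableSpace α] {μ : Measure α} [DecidableEq ι]
    {f : α → ι → ℝ} (hf : ∀ k, AEStronglyMeasurable (fun p => f p k) μ) {C : ℝ} (hC0 : 0 ≤ C)
    (hC : ∀ᵐ p ∂μ, ∀ k, |f p k| ≤ C) : IsBddMatrix μ fun p => cplx (Matrix.diagonal (f p)) := by
  refine ⟨fun k l => ?_, C, hC0, ?_⟩
  · refine Complex.continuous_ofReal.comp_aestronglyMeasurable ?_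
    simp only [Matrix.diagonal_apply]
    split_ifs
    · exact hf k
    · exact aestronglyMeasurable_const
  · filter_upwards [hC] with p hp k l
    change ‖((Matrix.diagonal (f p) k l : ℝ) : ℂ)‖ ≤ _
    rw [Complex.norm_real, Matrix.diagonal_apply]
    split_ifs
    · exact hp k
    · simpa using hC0

/-- A diagonal matrix is controlled in both directions once the lengths of the pushed-forward
vectors are bounded above and away from zero. Their orthogonality plays no role. -/
theorem exists_frameCoeff_inverse (hS : IsSurface S) (hτ : IsTangentFrame S τ) (hq : MemD S q)
    (hbij : BijOn (deform q) cell cell) {δ : ℝ} (hδ : 0 < δ) (hJ : ∀ᵐ p ∂vol, δ ≤ J q p) :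
    IsBddMatrix (area S) (fun p => cplx (frameCoeff (pushFrame S τ q p))) ∧
      ∃ N : R3 → Matrix (Fin 2) (Fin 2) ℂ, IsBddMatrix (area S) N ∧
        ∀ᵐ p ∂area S, N p * cplx (frameCoeff (pushFrame S τ q p)) = 1 := by
  obtain ⟨c, C, hc, hC0, hae⟩ := exists_pushFrame_bounds hS hτ hq hbij hδ hJ
  have hm : ∀ k, AEStronglyMeasurable (fun p => ‖pushFrame S τ q p k‖ ^ 2) (area S) :=
    fun k => (hS.aestronglyMeasurable_pushFrame hτ hq k).norm.pow 2
  have hlow : ∀ᵐ p ∂area S, ∀ k, c ≤ ‖pushFrame S τ q p k‖ ^ 2 := by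
    filter_upwards [hae] with p hp k
    have h0 := (hp.2 ![1, 0]).1
    have h1 := (hp.2 ![0, 1]).1
    simp at h0 h1
    fin_cases k
    · exact h0
    · exact h1
  refine ⟨?_, fun p => cplx (Matrix.diagonal fun k => ‖pushFrame S τ q p k‖ ^ 2), ?_, ?_⟩
  · refine isBddMatrix_diagonal (fun k => (hm k).aemeasurable.inv.aestronglyMeasurable)
      (C := c⁻¹) (by positivity) ?_
    filter_upwards [hlow] with p hp k
    rw [abs_of_nonneg (by positivity)]
    exact inv_anti₀ hc (hp k)
  · refine isBddMatrix_diagonal hm (C := C ^ 2) (by positivity) ?_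
    filter_upwards [hae] with p hp k
    rw [abs_of_nonneg (by positivity)]
    exact pow_le_pow_left₀ (norm_nonneg _) (hp.1 k) 2
  · filter_upwards [hlow] with p hp
    rw [frameCoeff, ← cplx_mul, Matrix.diagonal_mul_diagonal, ← cplx_one, ← Matrix.diagonal_one]
    congr 2
    funext k
    exact mul_inv_cancel₀ (hc.trans_le (hp k)).ne'

end Surface


/-! ### Well-posedness -/

section WellPosed

variable {S : Set R3} {τ : Fin 2 → R3 → R3}

theorem integrable_weakForm {N₁ : R3 → Matrix (Fin 3) (Fin 3) ℂ}
    {N₂ : R3 → Matrix (Fin 2) (Fin 2) ℂ} (hN₁ : IsBddMatrix vol N₁)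
    (hN₂ : IsBddMatrix (area S) N₂) {r₁ : R3 → Fin 3 → ℂ} {r₂ : R3 → Fin 2 → ℂ}
    (hr₁ : MemLp r₁ 2 vol) (hr₂ : MemLp r₂ 2 (area S)) (h k : H S τ) :
    Integrable (fun p => dotProduct ((N₁ p).mulVec (h.grad p) + r₁ p) (star (k.grad p))) vol ∧
      Integrable (fun p => dotProduct ((N₂ p).mulVec (h.tgrad p) + r₂ p) (star (k.tgrad p)))
        (area S) :=
  ⟨integrable_dotProduct_star ((hN₁.memLp_mulVec h.grad_memLp).add hr₁) k.grad_memLp,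
    integrable_dotProduct_star ((hN₂.memLp_mulVec h.tgrad_memLp).add hr₂) k.tgrad_memLp⟩

theorem weakForm_sub {N₁ : R3 → Matrix (Fin 3) (Fin 3) ℂ}
    {N₂ : R3 → Matrix (Fin 2) (Fin 2) ℂ} (hN₁ : IsBddMatrix vol N₁)
    (hN₂ : IsBddMatrix (area S) N₂) {r₁ : R3 → Fin 3 → ℂ} {r₂ : R3 → Fin 2 → ℂ}
    (hr₁ : MemLp r₁ 2 vol) (hr₂ : MemLp r₂ 2 (area S)) {h h' k : H S τ}
    (hk : k.grad = h.grad - h'.grad) (hk' : k.tgrad = h.tgrad - h'.tgrad) (l : H S τ) :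
    weakForm N₁ N₂ r₁ r₂ h l - weakForm N₁ N₂ r₁ r₂ h' l = weakForm N₁ N₂ 0 0 k l := by
  obtain ⟨i1, i2⟩ := integrable_weakForm hN₁ hN₂ hr₁ hr₂ h l
  obtain ⟨j1, j2⟩ := integrable_weakForm hN₁ hN₂ hr₁ hr₂ h' l
  unfold weakForm
  rw [add_sub_add_comm, ← integral_sub i1 j1, ← integral_sub i2 j2]
  congr 1
  · refine integral_congr_ae (Eventually.of_forall fun p => ?_)
    simp only [hk, Pi.sub_apply, Pi.zero_apply, Matrix.mulVec_sub, ← sub_dotProduct]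
    congr 1
    abel
  · refine integral_congr_ae (Eventually.of_forall fun p => ?_)
    simp only [hk', Pi.sub_apply, Pi.zero_apply, Matrix.mulVec_sub, ← sub_dotProduct]
    congr 1
    abel

theorem le_re_weakForm_self {N₁ : R3 → Matrix (Fin 3) (Fin 3) ℂ}
    {N₂ : R3 → Matrix (Fin 2) (Fin 2) ℂ} (hN₁ : IsBddMatrix vol N₁)
    (hN₂ : IsBddMatrix (area S) N₂) {c : ℝ} (hc : 0 < c)
    (hc₁ : ∀ᵐ p ∂vol, ∀ v : Fin 3 → ℂ,
      c * ∑ i, ‖v i‖ ^ 2 ≤ (dotProduct ((N₁ p).mulVec v) (star v)).re)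
    (hc₂ : ∀ᵐ p ∂area S, ∀ v : Fin 2 → ℂ,
      c * ∑ i, ‖v i‖ ^ 2 ≤ (dotProduct ((N₂ p).mulVec v) (star v)).re) (k : H S τ) :
    c * ∫ p, ∑ j, ‖k.grad p j‖ ^ 2 ∂vol ≤ (weakForm N₁ N₂ 0 0 k k).re := by
  obtain ⟨i1, i2⟩ := integrable_weakForm hN₁ hN₂ (MemLp.zero' (p := 2))
    (MemLp.zero' (p := 2)) k k
  have e1 := integral_re (𝕜 := ℂ) i1
  have e2 := integral_re (𝕜 := ℂ) i2
  simp only [RCLike.re_to_complex] at e1 e2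
  have h1 : c * ∫ p, ∑ j, ‖k.grad p j‖ ^ 2 ∂vol
      ≤ ∫ p, (dotProduct ((N₁ p).mulVec (k.grad p) + 0) (star (k.grad p))).re ∂vol := by
    rw [← integral_const_mul]
    refine integral_mono_ae ((integrable_sum_norm_sq k.grad_memLp).const_mul _) i1.re ?_
    filter_upwards [hc₁] with p hp
    simpa using hp (k.grad p)
  have h2 : 0 ≤ ∫ p, (dotProduct ((N₂ p).mulVec (k.tgrad p) + 0) (star (k.tgrad p))).re
      ∂area S := by
    refine integral_nonneg_of_ae ?_
    filter_upwards [hc₂] with p hp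
    have := hp (k.tgrad p)
    rw [add_zero]
    exact le_trans (by positivity) this
  rw [weakForm, Complex.add_re]
  simp only [Pi.zero_apply]
  rw [← e1, ← e2]
  linarith

/-- The Poincaré inequality forces the mean-free part of the difference to vanish on the cell, and
periodicity extends this to all of space. -/
theorem H.val_ae_eq_of_grad_eq_zero (hS : IsSurface S) (hτ : IsTangentFrame S τ) {h h' k : H S τ}
    (hk : k.val = h'.val - h.val) (hk0 : ∫ p, ∑ j, ‖k.grad p j‖ ^ 2 ∂vol ≤ 0) :
    ∃ c : ℂ, ∀ᵐ p, h'.val p = h.val p + c := by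
  obtain ⟨l, hl0, hl1, hl2, -⟩ := k.exists_mean_zero hS hτ
  set c := ∫ p, k.val p ∂vol
  refine ⟨c, ae_of_ae_vol ?_ ?_⟩
  · intro p i
    simp only [h'.val_periodic p i, h.val_periodic p i]
  · have h1 := l.poincare hl0
    rw [hl2] at h1
    have h2 : ∫ p, ‖l.val p‖ ^ 2 ∂vol = 0 :=
      le_antisymm (h1.trans (by linarith)) (integral_nonneg fun p => by positivity)
    rw [integral_eq_zero_iff_of_nonneg (fun p => by positivity)
      (l.val_memLp.integrable_norm_pow two_ne_zero)] at h2
    filter_upwards [h2] with p hp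
    have h3 : l.val p = 0 := by simpa using hp
    rw [hl1, hk] at h3
    simp only [Pi.sub_apply] at h3
    linear_combination h3

/-- The volume coefficient. -/
noncomputable def volForce (q : R3 → R3) (ε : R3 → Matrix (Fin 3) (Fin 3) ℂ) :
    R3 → Matrix (Fin 3) (Fin 3) ℂ := pullForce (volTensor q ε) (volPull q) (J q)

/-- The surface coefficient. -/
noncomputable def surfForce (S : Set R3) (τ : Fin 2 → R3 → R3) (q : R3 → R3)
    (coeff : (Fin 2 → R3) → Matrix (Fin 2) (Fin 2) ℝ) (σ : R3 → Matrix (Fin 3) (Fin 3) ℂ)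
    (freq : ℝ) : R3 → Matrix (Fin 2) (Fin 3) ℂ :=
  pullForce (surfTensor q σ freq) (surfPull S τ q coeff)
    fun p => surfaceElement (pushFrame S τ q p)

/-- The factor `i` in front compensates the −i in `volTensor`. The outer F⁻ᵀ and the determinant are
moved into the coefficient, leaving the plain gradient of φ as test field. -/
theorem volumeIntegrand_eq (q : R3 → R3) (ε : R3 → Matrix (Fin 3) (Fin 3) ℂ)
    (A : R3 → Fin 3 → Fin 3 → ℂ) (χ φ : Fin 3 → H S τ) (p : R3) :
    volumeIntegrand q ε A χ φ p = Complex.I * ∑ i, dotProduct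
      ((volForce q ε p * cplx (volPull q p)).mulVec ((χ i).grad p)
        + (volForce q ε p).mulVec (A p i)) (star ((φ i).grad p)) := by
  rw [volumeIntegrand, Finset.mul_sum]
  refine Finset.sum_congr rfl fun i _ => ?_
  have h1 : ∀ w, invTransposeMul q p w = (cplx (volPull q p)).mulVec w := fun w => rfl
  rw [h1, h1, ← Matrix.mulVec_mulVec, ← Matrix.mulVec_add, volForce, pullForce,
    ← dotProduct_conj_congr, volTensor, Matrix.smul_mulVec, smul_dotProduct, smul_eq_mul, add_comm]
  linear_combination (dotProduct (Matrix.mulVec (ε (deform q p))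
    ((cplx (volPull q p)).mulVec ((χ i).grad p) + A p i))
      (star ((cplx (volPull q p)).mulVec ((φ i).grad p))) * (J q p : ℂ)) * Complex.I_sq

/-- The frequency in front cancels the one in `surfTensor`. The forcing enters only through its
products with the frame vectors, that is, through the transposed frame matrix. -/
theorem surfaceIntegrand_eq (q : R3 → R3) (coeff : (Fin 2 → R3) → Matrix (Fin 2) (Fin 2) ℝ)
    (σ : R3 → Matrix (Fin 3) (Fin 3) ℂ) {freq : ℝ} (hfreq : 0 < freq)
    (B : R3 → Fin 3 → Fin 3 → ℂ) (χ φ : Fin 3 → H S τ) (p : R3) :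
    surfaceIntegrand q coeff σ B χ φ p = freq * ∑ i, dotProduct
      ((surfForce S τ q coeff σ freq p * cplx (surfPull S τ q coeff p)).mulVec ((χ i).tgrad p)
        + (surfForce S τ q coeff σ freq p * cplx (surfPull S τ q coeff p)
          * (cplx (frameMatrix (pushFrame S τ q p))).transpose).mulVec (B p i))
      (star ((φ i).tgrad p)) := by
  rw [surfaceIntegrand, Finset.mul_sum]
  refine Finset.sum_congr rfl fun i _ => ?_
  have h1 : (fun l => (∑ j, (pushFrame S τ q p l j : ℂ) * B p i j) + (χ i).tgrad p l)
      = (χ i).tgrad p + (cplx (frameMatrix (pushFrame S τ q p))).transpose.mulVec (B p i) := by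
    rw [add_comm]
    rfl
  rw [h1, tangentialPart_eq, tangentialPart_eq, ← Matrix.mulVec_mulVec _ _ (cplx _).transpose,
    ← Matrix.mulVec_add, ← Matrix.mulVec_mulVec, surfForce, pullForce, ← dotProduct_conj_congr,
    surfTensor, Matrix.smul_mulVec, smul_dotProduct, smul_eq_mul, surfPull, ← mul_assoc,
    ← mul_assoc, ← Complex.ofReal_mul, mul_inv_cancel₀ hfreq.ne', Complex.ofReal_one, one_mul]

/-- The three components decouple: after division by `i` the form is a sum of scalar weak forms with
common coefficients `N₁`, `N₂`, each solvable by the coercive theory. -/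
theorem isWellPosed_of_coeff (hS : IsSurface S) (hτ : IsTangentFrame S τ) {q : R3 → R3}
    (hq : MemD S q) (hbij : BijOn (deform q) cell cell) {δ : ℝ} (hδ : 0 < δ)
    (hJ : ∀ᵐ p ∂vol, δ ≤ J q p) {freq : ℝ} (hfreq : 0 < freq)
    {ε : R3 → Matrix (Fin 3) (Fin 3) ℂ} (hε : IsPermittivity ε)
    {σ : R3 → Matrix (Fin 3) (Fin 3) ℂ} (hσ : IsConductivity (deform q '' S) σ)
    {coeff : (Fin 2 → R3) → Matrix (Fin 2) (Fin 2) ℝ}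
    (hcoeff : IsBddMatrix (area S) (fun p => cplx (coeff (pushFrame S τ q p))) ∧
      ∃ N : R3 → Matrix (Fin 2) (Fin 2) ℂ, IsBddMatrix (area S) N ∧
        ∀ᵐ p ∂area S, N p * cplx (coeff (pushFrame S τ q p)) = 1) :
    IsWellPosed S τ q coeff freq ε σ := by
  obtain ⟨hco, N, hN, hNc⟩ := hcoeff
  have hR₁ : IsBddMatrix vol (volForce q ε) := hq.isBddMatrix_volForce hbij hδ hJ hε
  obtain ⟨c₁, hc₁, hcv⟩ := hq.exists_volForce_coercive hbij hδ hJ hε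
  obtain ⟨hR₂, hG₂, c₂, hc₂, hcs⟩ :=
    exists_surfForce_coercive hS hτ hq hbij hδ hJ hσ hfreq hco hN hNc
  change IsBddMatrix (area S) (surfForce S τ q coeff σ freq) at hR₂
  obtain ⟨c₀, C₀, -, hC₀, hae⟩ := exists_pushFrame_bounds hS hτ hq hbij hδ hJ
  have hfr := isBddMatrix_frameMatrix hS hτ hq hC₀ (hae.mono fun p hp => hp.1)
  set N₁ : R3 → Matrix (Fin 3) (Fin 3) ℂ := fun p => volForce q ε p * cplx (volPull q p)
  set N₂ : R3 → Matrix (Fin 2) (Fin 2) ℂ :=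
    fun p => surfForce S τ q coeff σ freq p * cplx (surfPull S τ q coeff p)
  set R₂ : R3 → Matrix (Fin 2) (Fin 3) ℂ :=
    fun p => N₂ p * (cplx (frameMatrix (pushFrame S τ q p))).transpose
  have hN₁ : IsBddMatrix vol N₁ := hR₁.mul (hq.isBddMatrix_F_inv hδ hJ)
  have hN₂ : IsBddMatrix (area S) N₂ := hR₂.mul hG₂
  have hR₂' : IsBddMatrix (area S) R₂ := hN₂.mul hfr.transpose
  have hc : 0 < min c₁ c₂ := lt_min hc₁ hc₂
  have hcv' : ∀ᵐ p ∂vol, ∀ v : Fin 3 → ℂ,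
      min c₁ c₂ * ∑ i, ‖v i‖ ^ 2 ≤ (dotProduct ((N₁ p).mulVec v) (star v)).re :=
    hcv.mono fun p hp v =>
      (mul_le_mul_of_nonneg_right (min_le_left _ _) (by positivity)).trans (hp v)
  have hcs' : ∀ᵐ p ∂area S, ∀ v : Fin 2 → ℂ,
      min c₁ c₂ * ∑ i, ‖v i‖ ^ 2 ≤ (dotProduct ((N₂ p).mulVec v) (star v)).re :=
    hcs.mono fun p hp v =>
      (mul_le_mul_of_nonneg_right (min_le_right _ _) (by positivity)).trans (hp v)
  obtain ⟨C, hC, hsol⟩ := exists_weakForm_eq_zero hS hτ hN₁ hN₂ hc hcv' hcs'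
  obtain ⟨C₁, hC₁, hest₁⟩ := hR₁.exists_integral_mulVec_le
  obtain ⟨C₂, hC₂, hest₂⟩ := hR₂'.exists_integral_mulVec_le
  have hsecond : ∃ C : ℝ, ∀ A B : R3 → Fin 3 → Fin 3 → ℂ, MemLp A 2 vol → MemLp B 2 (area S) →
    (∀ χ φ : Fin 3 → H S τ, Integrable (volumeIntegrand q ε A χ φ) vol ∧
      Integrable (surfaceIntegrand q coeff σ B χ φ) (area S)) ∧
    ∃ χ : Fin 3 → H S τ, IsUniqueSolution q coeff freq ε σ A B χ ∧
      normSq χ ≤ C * ((∫ p, (∑ i, ∑ j, ‖A p i j‖ ^ 2) ∂vol)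
        + (∫ p, (∑ i, ∑ j, ‖B p i j‖ ^ 2) ∂area S)) := by
    -- `C` estimates the solution by the transformed forcings, and `C₁`, `C₂` bound these by `A` and
    -- `B`.
    refine ⟨C * (C₁ + C₂), fun A B hA hB => ?_⟩
    have hr₁ : ∀ i, MemLp (fun p => (volForce q ε p).mulVec (A p i)) 2 vol :=
      fun i => hR₁.memLp_mulVec (hA.eval i)
    have hr₂ : ∀ i, MemLp (fun p => (R₂ p).mulVec (B p i)) 2 (area S) :=
      fun i => hR₂'.memLp_mulVec (hB.eval i)
    have hint := fun (χ φ : Fin 3 → H S τ) i =>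
      integrable_weakForm hN₁ hN₂ (hr₁ i) (hr₂ i) (χ i) (φ i)
    have hvI : ∀ χ φ : Fin 3 → H S τ, volumeIntegrand q ε A χ φ = fun p => Complex.I *
        ∑ i, dotProduct ((N₁ p).mulVec ((χ i).grad p) + (volForce q ε p).mulVec (A p i))
          (star ((φ i).grad p)) :=
      fun χ φ => funext fun p => volumeIntegrand_eq q ε A χ φ p
    have hsI : ∀ χ φ : Fin 3 → H S τ, surfaceIntegrand q coeff σ B χ φ = fun p => freq *
        ∑ i, dotProduct ((N₂ p).mulVec ((χ i).tgrad p) + (R₂ p).mulVec (B p i))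
          (star ((φ i).tgrad p)) :=
      fun χ φ => funext fun p => surfaceIntegrand_eq q coeff σ hfreq B χ φ p
    -- Since −1/(iω)·ω = i, the surface term acquires the same factor `i` as the volume term.
    have hE : ∀ χ φ : Fin 3 → H S τ, E q coeff freq ε σ A B χ φ = Complex.I *
        ∑ i, weakForm N₁ N₂ (fun p => (volForce q ε p).mulVec (A p i))
          (fun p => (R₂ p).mulVec (B p i)) (χ i) (φ i) := by
      intro χ φ
      have hf : (freq : ℂ) ≠ 0 := by exact_mod_cast hfreq.ne'
      rw [E, hvI, hsI, integral_const_mul, integral_const_mul,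
        integral_finsetSum _ fun i _ => (hint χ φ i).1,
        integral_finsetSum _ fun i _ => (hint χ φ i).2]
      simp only [weakForm, Finset.sum_add_distrib, mul_add]
      rw [sub_eq_add_neg]
      congr 1
      rw [← mul_assoc, ← neg_mul]
      congr 1
      field_simp
      rw [Complex.I_sq]
    refine ⟨fun χ φ => ⟨?_, ?_⟩, ?_⟩
    · rw [hvI]
      exact (integrable_finsetSum _ fun i _ => (hint χ φ i).1).const_mul _
    · rw [hsI]
      exact (integrable_finsetSum _ fun i _ => (hint χ φ i).2).const_mul _
    choose χ hχ0 hχs hχe using fun i => hsol _ _ (hr₁ i) (hr₂ i)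
    refine ⟨χ, ⟨fun φ => ?_, hχ0, fun χ' hχ' => ?_⟩, ?_⟩
    · rw [hE]
      simp [hχs]
    -- Uniqueness: the equation of the second solution is tested with the difference. The real part
    -- of each summand is nonnegative and the sum vanishes, so every gradient vanishes.
    · choose k hk1 hk2 hk3 using fun i => (χ' i).exists_sub hS hτ (χ i)
      have h1 := hχ' k
      rw [hE, mul_eq_zero, or_iff_right Complex.I_ne_zero] at h1
      have h2 : ∑ i, weakForm N₁ N₂ 0 0 (k i) (k i) = 0 := by
        rw [← h1]
        refine Finset.sum_congr rfl fun i _ => ?_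
        rw [← weakForm_sub hN₁ hN₂ (hr₁ i) (hr₂ i) (hk2 i) (hk3 i), hχs i, sub_zero]
      have h3 : ∀ i, min c₁ c₂ * ∫ p, ∑ j, ‖(k i).grad p j‖ ^ 2 ∂vol
          ≤ (weakForm N₁ N₂ 0 0 (k i) (k i)).re :=
        fun i => le_re_weakForm_self hN₁ hN₂ hc hcv' hcs' (k i)
      have h4 : ∀ i, 0 ≤ min c₁ c₂ * ∫ p, ∑ j, ‖(k i).grad p j‖ ^ 2 ∂vol := fun i =>
        mul_nonneg hc.le (integral_nonneg fun p => by positivity)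
      have h5 : ∀ i, ∃ c : ℂ, ∀ᵐ p, (χ' i).val p = (χ i).val p + c := by
        intro i
        refine H.val_ae_eq_of_grad_eq_zero hS hτ (hk1 i) ?_
        refine le_of_mul_le_mul_left ?_ hc
        rw [mul_zero]
        refine (h3 i).trans ?_
        have h6 := Finset.single_le_sum (f := fun i => (weakForm N₁ N₂ 0 0 (k i) (k i)).re)
          (fun i _ => (h4 i).trans (h3 i)) (Finset.mem_univ i)
        rw [← Complex.re_sum, h2] at h6
        exact h6
      choose c hc' using h5
      exact ⟨c, hc'⟩
    · have hAi : ∀ i, ∫ p, ∑ j, ‖(volForce q ε p).mulVec (A p i) j‖ ^ 2 ∂vol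
          ≤ C₁ * ∫ p, ∑ j, ‖A p i j‖ ^ 2 ∂vol := fun i => hest₁ _ (hA.eval i)
      have hBi : ∀ i, ∫ p, ∑ j, ‖(R₂ p).mulVec (B p i) j‖ ^ 2 ∂area S
          ≤ C₂ * ∫ p, ∑ j, ‖B p i j‖ ^ 2 ∂area S := fun i => hest₂ _ (hB.eval i)
      rw [integral_finsetSum _ fun i _ => integrable_sum_norm_sq (hA.eval i),
        integral_finsetSum _ fun i _ => integrable_sum_norm_sq (hB.eval i),
        ← Finset.sum_add_distrib, Finset.mul_sum, normSq]
      refine Finset.sum_le_sum fun i _ => (hχe i).trans ?_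
      rw [mul_assoc]
      refine mul_le_mul_of_nonneg_left ((add_le_add (hAi i) (hBi i)).trans ?_) hC
      have hA0 : 0 ≤ ∫ p, ∑ j, ‖A p i j‖ ^ 2 ∂vol := integral_nonneg fun p => by positivity
      have hB0 : 0 ≤ ∫ p, ∑ j, ‖B p i j‖ ^ 2 ∂area S := integral_nonneg fun p => by positivity
      nlinarith [mul_nonneg hC₁ hB0, mul_nonneg hC₂ hA0]
  refine ⟨?_, hsecond⟩
  -- Finite area makes the constant forcing of the cell problem square integrable on the surface.
  have := hS.isFiniteMeasure
  obtain ⟨C', h⟩ := hsecond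
  obtain ⟨-, χ, hχ, -⟩ := h unitForcing unitForcing (memLp_const _) (memLp_const _)
  exact ⟨χ, hχ⟩

end WellPosed

end CellProblem

/-- Well-posedness of the deformed cell problem, both for the orthogonal projection to the
tangent planes of the deformed surface and for the operator `∑ k, t k (t k)ᵀ` built from the
normalised push-forwards `t k = F τ k / ‖F τ k‖` of the reference tangential fields. -/
theorem mainTheorem1
    (S : Set CellProblem.R3) (hS : CellProblem.IsSurface S)
    (τ : Fin 2 → CellProblem.R3 → CellProblem.R3) (hτ : CellProblem.IsTangentFrame S τ)
    (q : CellProblem.R3 → CellProblem.R3) (hq : CellProblem.MemD S q)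
    (hbij : Set.BijOn (CellProblem.deform q) CellProblem.cell CellProblem.cell)
    (δ : ℝ) (hδ : 0 < δ) (hJ : ∀ᵐ p ∂CellProblem.vol, δ ≤ CellProblem.J q p)
    (freq : ℝ) (hfreq : 0 < freq)
    (ε : CellProblem.R3 → Matrix (Fin 3) (Fin 3) ℂ) (hε : CellProblem.IsPermittivity ε)
    (σ : CellProblem.R3 → Matrix (Fin 3) (Fin 3) ℂ)
    (hσ : CellProblem.IsConductivity (CellProblem.deform q '' S) σ) :
    CellProblem.IsWellPosed S τ q CellProblem.projCoeff freq ε σ ∧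
      CellProblem.IsWellPosed S τ q CellProblem.frameCoeff freq ε σ :=
  ⟨CellProblem.isWellPosed_of_coeff hS hτ hq hbij hδ hJ hfreq hε hσ
      (CellProblem.exists_projCoeff_inverse hS hτ hq hbij hδ hJ),
    CellProblem.isWellPosed_of_coeff hS hτ hq hbij hδ hJ hfreq hε hσ
      (CellProblem.exists_frameCoeff_inverse hS hτ hq hbij hδ hJ)⟩
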